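/- Let $d\ge 1$, let $\Omega\subset\mathbb R^d$ be a bounded measurable set (for instance $\Omega=[0,1]^d$ or a bounded domain), let $T>0$ and $p\in\,]1,\infty[$. Write $\Psi(r)=|r|^{p-2}r$ with $\Psi(0)=0$, and for a kernel $K$ put $$\Delta_p^K u(x)=-\int_\Omega K(x,y)\,\Psi(u(y)-u(x))\,dy ,$$ with domain the set of $u\in L^1(\Omega)$ for which $(x,y)\mapsto K(x,y)\Psi(u(y)-u(x))$ is integrable on $\Omega\times\Omega$. A solution on $[0,T]$ of the nonlocal $p$-Laplacian problem with kernel $K$ and data $(f,g)$ is a function $u\in C([0,T];L^1(\Omega))\cap W^{1,1}(]0,T[;L^1(\Omega))$ with $u(\cdot,0)=g$ a.e. in $\Omega$, such that $u(\cdot,t)$ lies in the domain of $\Delta_p^K$ for a.e. $t$ and $\partial_t u=-\Delta_p^K u+f$ a.e. in $\Omega\times]0,T[$. Here $L^1([0,T];L^q(\Omega))$ is the space of measurable functions $f$ with $\|f\|_{L^1([0,T];L^q(\Omega))}=\int_0^T\|f(\cdot,t)\|_{L^q(\Omega)}\,dt<\infty$, $\|u\|_{C([0,T];L^2(\Omega))}=\sup_{t\in[0,T]}\|u(\cdot,t)\|_{L^2(\Omega)}$,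 and $\Omega-\Omega=\{x-y:x,y\in\Omega\}$. A sequence $(h_n)$ is uniformly integrable on a set $E$ if for each $\varepsilon>0$ there is $\delta>0$ such that $\int_A|h_n|\le\varepsilon$ for all $n$ and all measurable $A\subset E$ with $|A|\le\delta$. Let $J,J_n:\mathbb R^d\to\mathbb R$ ($n\in\mathbb N$) be nonnegative, measurable and symmetric ($J(-x)=J(x)$, $J_n(-x)=J_n(x)$), with $J,J_n\in L^2(\Omega-\Omega)$, and let $f,f_n,g,g_n$ satisfy one of the following, for all $n$: (a) $p<2$, $g,g_n\in L^2(\Omega)$ and $f,f_n\in L^1([0,T];L^2(\Omega))$; (b) $p\ge2$, $g,g_n\in L^{2(p-1)}(\Omega)$ and $f,f_n\in L^1([0,T];L^{2(p-1)}(\Omega))$; (c) $g,g_n\in L^\infty(\Omega)$ and $f,f_n\in L^1([0,T];L^\infty(\Omega))$. Then the following hold. (i) The problem with kernel $J(x-y)$ and data $(f,g)$ has exactly one solution $u$ on $[0,T]$, and for each $n$ the problem with kernel $J_n(x-y)$ and data $(f_n,g_n)$ has exactly one solution $u_n$ on $[0,T]$. (ii) $u,u_n\in C([0,T];L^2(\Omega))$,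 and for all $n$ $$\|u_n-u\|_{C([0,T];L^2(\Omega))}\le\|g_n-g\|_{L^2(\Omega)}+\|f_n-f\|_{L^1([0,T];L^2(\Omega))}+CT\,\|J_n-J\|_{L^2(\Omega-\Omega)} ,$$ where the constant $C>0$ depends only on $p$, $g$ and $f$ (including their domains of definition $\Omega$ and $\Omega\times[0,T]$), and not on $n,J,J_n,f_n,g_n$. (iii) Suppose moreover that $(|J_n|^2)$ is uniformly integrable on $\Omega-\Omega$, that $J_n\to J$ a.e. on $\Omega-\Omega$, $g_n\to g$ a.e. on $\Omega$ and $f_n\to f$ a.e. on $\Omega\times[0,T]$, and that one of the following holds: (a') $p<2$, $(|g_n|^2)$ is uniformly integrable on $\Omega$ and $(|f_n|^2)$ is uniformly integrable on $\Omega\times[0,T]$; (b') $p\ge2$, $(|g_n|^{2(p-1)})$ is uniformly integrable on $\Omega$ and $(|f_n|^{2(p-1)})$ is uniformly integrable on $\Omega\times[0,T]$; (c') there is a constant $M$ such that $\sup_n|g_n(x)|\le M$ for a.e. $x\in\Omega$ and $\sup_n|f_n(x,t)|\le M$ for a.e. $(x,t)\in\Omega\times[0,T]$. Then $\lim_{n\to\infty}\|u_n-u\|_{C([0,T];L^2(\Omega))}=0$.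 -/

import Mathlib

open MeasureTheory Set Filter Topology
open scoped ENNReal ContDiff Pointwise

namespace NonlocalPLaplace

noncomputable section

/-- `Ψ(r) = |r|^{p-2} r`, with `Ψ(0) = 0`. -/
def psi (p r : ℝ) : ℝ := |r| ^ (p - 2) * r

/-- `L¹(Ω)`. -/
abbrev L1 {d : ℕ} (Ω : Set (EuclideanSpace ℝ (Fin d))) : Type :=
  Lp ℝ 1 (volume.restrict Ω)

/-- `u` belongs to the domain of the nonlocal `p`-Laplacian with kernel `K`: the integrand
`K(x,y) |u(y) - u(x)|^{p-2} (u(y) - u(x))` is integrable on `Ω × Ω`, so that the operator takes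
its value in `L¹(Ω)` and Fubini's theorem applies. -/
def InDomain {d : ℕ} (Ω : Set (EuclideanSpace ℝ (Fin d))) (p : ℝ)
    (K : EuclideanSpace ℝ (Fin d) → EuclideanSpace ℝ (Fin d) → ℝ)
    (u : EuclideanSpace ℝ (Fin d) → ℝ) : Prop :=
  Integrable
    (fun z : EuclideanSpace ℝ (Fin d) × EuclideanSpace ℝ (Fin d) =>
      K z.1 z.2 * psi p (u z.2 - u z.1))
    ((volume.restrict Ω).prod (volume.restrict Ω))

/-- The nonlocal `p`-Laplacian
`(Δ_p^K u)(x) = - ∫_Ω K(x,y) |u(y) - u(x)|^{p-2} (u(y) - u(x)) dy`. -/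
def pLaplacian {d : ℕ} (Ω : Set (EuclideanSpace ℝ (Fin d))) (p : ℝ)
    (K : EuclideanSpace ℝ (Fin d) → EuclideanSpace ℝ (Fin d) → ℝ)
    (u : EuclideanSpace ℝ (Fin d) → ℝ) (x : EuclideanSpace ℝ (Fin d)) : ℝ :=
  - ∫ y in Ω, K x y * psi p (u y - u x)

/-- `u ∈ W^{1,1}(]0,T[; X)` with weak derivative `v`. -/
structure HasWeakTimeDeriv {X : Type*} [NormedAddCommGroup X] [NormedSpace ℝ X]
    (T : ℝ) (u v : ℝ → X) : Prop where
  integrable : IntegrableOn u (Ioo 0 T)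
  integrable_deriv : IntegrableOn v (Ioo 0 T)
  weak_deriv : ∀ φ : ℝ → ℝ, ContDiff ℝ ∞ φ → HasCompactSupport φ → tsupport φ ⊆ Ioo 0 T →
    ∫ t in Ioo 0 T, deriv φ t • u t = - ∫ t in Ioo 0 T, φ t • v t

/-- `u` is a solution on `[0,T]` of `∂ₜ u = - Δ_p^K u + f`, `u(0) = g`, that is,
`u ∈ C([0,T]; L¹(Ω)) ∩ W^{1,1}(]0,T[; L¹(Ω))`, the initial condition holds a.e. in `Ω`, and
`u(t)` lies in the domain of `Δ_p^K` and satisfies the equation for a.e. `t`, a.e. in `Ω`. -/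
def IsSolution {d : ℕ} (Ω : Set (EuclideanSpace ℝ (Fin d))) (T p : ℝ)
    (K : EuclideanSpace ℝ (Fin d) → EuclideanSpace ℝ (Fin d) → ℝ)
    (f : ℝ → EuclideanSpace ℝ (Fin d) → ℝ) (g : EuclideanSpace ℝ (Fin d) → ℝ)
    (u : ℝ → L1 Ω) : Prop :=
  ContinuousOn u (Icc 0 T) ∧
  (u 0 : EuclideanSpace ℝ (Fin d) → ℝ) =ᵐ[volume.restrict Ω] g ∧
  ∃ v : ℝ → L1 Ω, HasWeakTimeDeriv T u v ∧
    ∀ᵐ t ∂(volume.restrict (Ioo 0 T)),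
      InDomain Ω p K (u t) ∧
      ∀ᵐ x ∂(volume.restrict Ω), v t x = - pLaplacian Ω p K (u t) x + f t x

/-- The problem with kernel `K` and data `(f, g)` has exactly one solution on `[0,T]`. -/
def UniquelySolvable {d : ℕ} (Ω : Set (EuclideanSpace ℝ (Fin d))) (T p : ℝ)
    (K : EuclideanSpace ℝ (Fin d) → EuclideanSpace ℝ (Fin d) → ℝ)
    (f : ℝ → EuclideanSpace ℝ (Fin d) → ℝ) (g : EuclideanSpace ℝ (Fin d) → ℝ) : Prop :=
  ∃ u : ℝ → L1 Ω, IsSolution Ω T p K f g u ∧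
    ∀ v : ℝ → L1 Ω, IsSolution Ω T p K f g v → ∀ t ∈ Icc 0 T, v t = u t

/-- Lebesgue measure on the space-time cylinder, with the time variable first. -/
def cylinderMeasure {d : ℕ} (Ω : Set (EuclideanSpace ℝ (Fin d))) (T : ℝ) :
    Measure (ℝ × EuclideanSpace ℝ (Fin d)) :=
  (volume.restrict (Icc 0 T)).prod (volume.restrict Ω)

/-- The norm of `L¹([0,T]; L^q(Ω))`, with values in `[0,∞]`. -/
def normL1Lq {d : ℕ} (Ω : Set (EuclideanSpace ℝ (Fin d))) (T : ℝ) (q : ℝ≥0∞)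
    (f : ℝ → EuclideanSpace ℝ (Fin d) → ℝ) : ℝ≥0∞ :=
  ∫⁻ t in Icc 0 T, eLpNorm (f t) q (volume.restrict Ω)

/-- `g ∈ L^q(Ω)` and `f ∈ L¹([0,T]; L^q(Ω))`. -/
structure DataIn {d : ℕ} (Ω : Set (EuclideanSpace ℝ (Fin d))) (T : ℝ) (q : ℝ≥0∞)
    (f : ℝ → EuclideanSpace ℝ (Fin d) → ℝ) (g : EuclideanSpace ℝ (Fin d) → ℝ) : Prop where
  memLp_initial : MemLp g q (volume.restrict Ω)
  measurable_source : AEStronglyMeasurable (Function.uncurry f) (cylinderMeasure Ω T)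
  source_lt_top : normL1Lq Ω T q f < (⊤ : ℝ≥0∞)

/-- `J` is nonnegative, measurable, symmetric, and belongs to `L²(Ω - Ω)`. -/
structure IsConvKernel {d : ℕ} (Ω : Set (EuclideanSpace ℝ (Fin d)))
    (J : EuclideanSpace ℝ (Fin d) → ℝ) : Prop where
  nonneg : ∀ x, 0 ≤ J x
  measurable : AEMeasurable J volume
  symm : ∀ x, J (-x) = J x
  memLp : MemLp J 2 (volume.restrict (Ω - Ω))

/-- The kernel `K(x,y) = J(x - y)`. -/
def convKernel {d : ℕ} (J : EuclideanSpace ℝ (Fin d) → ℝ) :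
    EuclideanSpace ℝ (Fin d) → EuclideanSpace ℝ (Fin d) → ℝ :=
  fun x y => J (x - y)

/-- `u ∈ C([0,T]; L²(Ω))`. -/
def ContinuousL2 {d : ℕ} (Ω : Set (EuclideanSpace ℝ (Fin d))) (T : ℝ) (u : ℝ → L1 Ω) : Prop :=
  ∀ t ∈ Icc 0 T, MemLp (u t) 2 (volume.restrict Ω) ∧
    Tendsto (fun s => eLpNorm (u s - u t) 2 (volume.restrict Ω)) (𝓝[Icc 0 T] t) (𝓝 0)

/-- The norm of `C([0,T]; L²(Ω))`, with values in `[0,∞]`. -/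
def normCL2 {d : ℕ} (Ω : Set (EuclideanSpace ℝ (Fin d))) (T : ℝ) (u : ℝ → L1 Ω) : ℝ≥0∞ :=
  ⨆ t ∈ Icc 0 T, eLpNorm (u t) 2 (volume.restrict Ω)

end

end NonlocalPLaplace

/-! The equation is an evolution `u' = B u + F` with `B u (x) = ∫ K(x,y) Ψ(u(y) - u(x)) dy`. Since
`K` is nonnegative and symmetric and `Ψ` is odd and increasing, exchanging `x` and `y` shows that
`Bu₁ - Bu₂` pairs nonpositively with every increasing function of `u₁ - u₂` for which the pairing is
integrable (`SymmKernel.integral_mul_nonpos`). Pairing with the derivative of `|s|^r / r` and using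
convexity gives dissipativity in `L^r`: `‖u₁ - u₂‖ ≤ ‖u₁ - u₂ - δ (Bu₁ - Bu₂)‖` for `δ ≥ 0`. For
absolutely continuous curves this yields a Gronwall inequality without exponential growth
(`IsPrimitive.norm_le_of_dissipative`). In `L¹` only the domain condition is needed, and uniqueness
follows.

For existence, `Ψ` is replaced by odd increasing Lipschitz functions `θ k`
(`exists_lipschitz_approx_psi`). Convolution against `J` is controlled on each section by the `L¹`
norm of `J` on `Ω - Ω`, so the approximate operators are Lipschitz on every `L^r` with finite `r ≥
1`, and Picard iteration solves the approximate equations. Put `q = max 2 (2(p-1))`. Dissipativity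
in `L^q` bounds the approximate solutions uniformly. Since `θ k - Ψ` is at most `(1 + |s|^q)/(k+1)`,
dissipativity in `L¹` makes them a Cauchy sequence there, and the limit solves the original
equation.

The exponent `q` is chosen so that `|Ψ(s)|² ` is at most of order `1 + |s|^q`. An `L^q` bound on `u`
therefore bounds `B u` in `L²`, linearly in the `L¹` norm of the kernel. Comparing two approximate
solutions by dissipativity in `L²` leaves as defect the operator with kernel `J_n - J`, evaluated
along the solution for `(f, g)`. This gives an error constant depending only on `p` and `(f, g)`
with their domains (`ApproxFamily.eLpNorm_two_sub_le_of_kernels`). The estimate survives the `L¹`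
limit by lower semicontinuity of the `L²` norm. Convergence then follows from Vitali's theorem
applied to the three terms on the right. -/

namespace NonlocalPLaplace

noncomputable section

/-! ### Evolution equations in a Banach space: dissipative estimates, Lipschitz existence, weak
derivatives -/

section Evolution

set_option linter.unusedSectionVars false

variable {X Y : Type*} [NormedAddCommGroup X] [NormedSpace ℝ X]
  [NormedAddCommGroup Y] [NormedSpace ℝ Y]

/-- `w(t) = w(0) + ∫₀ᵗ v` on `[0,T]`, with `v` integrable. -/
structure IsPrimitive (T : ℝ) (w v : ℝ → X) : Prop where
  integrable : IntervalIntegrable v volume 0 T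
  eq_integral : ∀ t ∈ Icc 0 T, w t = w 0 + ∫ s in (0)..t, v s

theorem intervalIntegrable_of_mem {T : ℝ} {v : ℝ → X} (hv : IntervalIntegrable v volume 0 T)
    {s t : ℝ} (hs : s ∈ Icc 0 T) (ht : t ∈ Icc 0 T) : IntervalIntegrable v volume s t := by
  refine hv.mono_set ?_
  have hT : (0:ℝ) ≤ T := hs.1.trans hs.2
  rw [uIcc_of_le hT]
  exact (uIcc_subset_Icc hs ht)

theorem IsPrimitive.sub_eq {T : ℝ} {w v : ℝ → X} (h : IsPrimitive T w v) {s t : ℝ}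
    (hs : s ∈ Icc 0 T) (ht : t ∈ Icc 0 T) : w t - w s = ∫ τ in s..t, v τ := by
  have h0 : (0:ℝ) ∈ Icc 0 T := ⟨le_rfl, hs.1.trans hs.2⟩
  rw [h.eq_integral t ht, h.eq_integral s hs,
    ← intervalIntegral.integral_add_adjacent_intervals
      (intervalIntegrable_of_mem h.integrable h0 hs) (intervalIntegrable_of_mem h.integrable hs ht)]
  abel

theorem IsPrimitive.sub {T : ℝ} (hT : 0 ≤ T) {w₁ v₁ w₂ v₂ : ℝ → X} (h₁ : IsPrimitive T w₁ v₁)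
    (h₂ : IsPrimitive T w₂ v₂) : IsPrimitive T (w₁ - w₂) (v₁ - v₂) := by
  have h0 : (0:ℝ) ∈ Icc 0 T := ⟨le_rfl, hT⟩
  refine ⟨h₁.integrable.sub h₂.integrable, fun t ht => ?_⟩
  have := intervalIntegral.integral_sub (intervalIntegrable_of_mem h₁.integrable h0 ht)
    (intervalIntegrable_of_mem h₂.integrable h0 ht)
  simp only [Pi.sub_apply]
  rw [this, h₁.eq_integral t ht, h₂.eq_integral t ht]
  abel

theorem IsPrimitive.map [CompleteSpace X] [CompleteSpace Y] {T : ℝ} {w v : ℝ → X}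
    (h : IsPrimitive T w v) (ι : X →L[ℝ] Y) :
    IsPrimitive T (fun t => ι (w t)) (fun t => ι (v t)) := by
  refine ⟨⟨ι.integrable_comp h.integrable.1, ι.integrable_comp h.integrable.2⟩, fun t ht => ?_⟩
  have h0 : (0:ℝ) ∈ Icc 0 T := ⟨le_rfl, ht.1.trans ht.2⟩
  rw [h.eq_integral t ht, map_add,
    ι.intervalIntegral_comp_comm (intervalIntegrable_of_mem h.integrable h0 ht)]

theorem IsPrimitive.continuousOn {T : ℝ} (hT : 0 ≤ T) {w v : ℝ → X} (h : IsPrimitive T w v) :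
    ContinuousOn w (Icc 0 T) := by
  have := intervalIntegral.continuousOn_primitive_interval
    (f := v) (μ := volume) (a := 0) (b := T) (by
      rw [uIcc_of_le hT, integrableOn_Icc_iff_integrableOn_Ioc]
      exact (intervalIntegrable_iff_integrableOn_Ioc_of_le hT).1 h.integrable)
  rw [uIcc_of_le hT] at this
  exact (continuousOn_const.add this).congr h.eq_integral

theorem IsPrimitive.ae_hasDerivAt [CompleteSpace X] {T : ℝ} (hT : 0 ≤ T) {w v : ℝ → X}
    (h : IsPrimitive T w v) : ∀ᵐ t, t ∈ Ioo 0 T → HasDerivAt w (v t) t := by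
  filter_upwards [h.integrable.ae_hasDerivAt_integral] with t ht htT
  have h1 := ht (by rw [uIcc_of_le hT]; exact Ioo_subset_Icc_self htT) 0 (by simp)
  refine (h1.const_add (w 0)).congr_of_eventuallyEq ?_
  filter_upwards [Ioo_mem_nhds htT.1 htT.2] with s hs
  exact h.eq_integral s (Ioo_subset_Icc_self hs)

/-- Applied with `g t = ∫₀ᵗ ‖v‖`, whose increments dominate those of a primitive of `v` and of its
norm. -/
theorem absolutelyContinuousOnInterval_of_dist_le {f : ℝ → X} {g : ℝ → ℝ} {a b : ℝ}
    (hg : AbsolutelyContinuousOnInterval g a b)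
    (hfg : ∀ s ∈ uIcc a b, ∀ t ∈ uIcc a b, dist (f s) (f t) ≤ dist (g s) (g t)) :
    AbsolutelyContinuousOnInterval f a b := by
  rw [absolutelyContinuousOnInterval_iff] at hg ⊢
  intro ε hε
  obtain ⟨δ, hδ, h⟩ := hg ε hε
  refine ⟨δ, hδ, fun E hE hEδ => lt_of_le_of_lt (Finset.sum_le_sum fun i hi => ?_) (h E hE hEδ)⟩
  have := hE.1 i (by simpa using hi)
  exact hfg _ this.1 _ this.2

theorem IsPrimitive.absolutelyContinuousOnInterval {T : ℝ} (hT : 0 ≤ T) {w v : ℝ → X}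
    (h : IsPrimitive T w v) : AbsolutelyContinuousOnInterval w 0 T := by
  have h0 : (0:ℝ) ∈ Icc 0 T := ⟨le_rfl, hT⟩
  refine absolutelyContinuousOnInterval_of_dist_le
    (h.integrable.norm.absolutelyContinuousOnInterval_intervalIntegral (c := 0) (by simp)) ?_
  rw [uIcc_of_le hT]
  have key : ∀ s ∈ Icc 0 T, ∀ t ∈ Icc 0 T, s ≤ t →
      dist (w s) (w t) ≤ dist (∫ x in (0)..s, ‖v x‖) (∫ x in (0)..t, ‖v x‖) := by
    intro s hs t ht hst
    rw [dist_comm, dist_eq_norm, h.sub_eq hs ht, dist_comm, Real.dist_eq,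
      intervalIntegral.integral_interval_sub_left
        (intervalIntegrable_of_mem h.integrable.norm h0 ht)
        (intervalIntegrable_of_mem h.integrable.norm h0 hs)]
    exact (intervalIntegral.norm_integral_le_integral_norm hst).trans (le_abs_self _)
  intro s hs t ht
  rcases le_total s t with hst | hst
  · exact key s hs t ht hst
  · rw [dist_comm, dist_comm (∫ x in (0)..s, ‖v x‖)]
    exact key t ht s hs hst

/-- The norm of a primitive grows at most at the rate `ρ` if its derivative is dissipative up to
an error of size `ρ`. -/
theorem IsPrimitive.norm_le_of_dissipative [CompleteSpace X] {T : ℝ} {w v : ℝ → X}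
    (h : IsPrimitive T w v) {ρ : ℝ → ℝ} (hρ : IntervalIntegrable ρ volume 0 T)
    (hd : ∀ᵐ t, t ∈ Ioo 0 T → ∀ δ : ℝ, 0 ≤ δ → ‖w t‖ ≤ ‖w t - δ • v t‖ + δ * ρ t)
    {t : ℝ} (ht : t ∈ Icc 0 T) : ‖w t‖ ≤ ‖w 0‖ + ∫ s in (0)..t, ρ s := by
  have hT : (0:ℝ) ≤ T := ht.1.trans ht.2
  have h0 : (0:ℝ) ∈ Icc 0 T := ⟨le_rfl, hT⟩
  have hac : AbsolutelyContinuousOnInterval (fun t => ‖w t‖) 0 t := by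
    refine absolutelyContinuousOnInterval_of_dist_le (f := fun t => ‖w t‖)
      ((h.integrable.norm.absolutelyContinuousOnInterval_intervalIntegral
        (c := 0) (by simp)).mono (c := 0) (d := t) ?_) ?_
    · rw [uIcc_of_le hT, uIcc_of_le ht.1]; exact Icc_subset_Icc_right ht.2
    · rw [uIcc_of_le ht.1]
      intro s hs r hr
      have hs' : s ∈ Icc 0 T := ⟨hs.1, hs.2.trans ht.2⟩
      have hr' : r ∈ Icc 0 T := ⟨hr.1, hr.2.trans ht.2⟩
      refine (dist_norm_norm_le (w s) (w r)).trans ?_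
      rw [h.sub_eq hr' hs', Real.dist_eq, intervalIntegral.integral_interval_sub_left
        (intervalIntegrable_of_mem h.integrable.norm h0 hs')
        (intervalIntegrable_of_mem h.integrable.norm h0 hr')]
      exact intervalIntegral.norm_integral_le_abs_integral_norm
  have hle : ∀ᵐ s, s ∈ Ioo 0 t → deriv (fun t => ‖w t‖) s ≤ ρ s := by
    filter_upwards [hac.ae_differentiableAt, h.ae_hasDerivAt hT, hd] with s h1 h2 h3 hs
    have hsT : s ∈ Ioo 0 T := ⟨hs.1, hs.2.trans_le ht.2⟩
    have h1' := (h1 (by rw [uIcc_of_le ht.1]; exact Ioo_subset_Icc_self hs)).hasDerivAt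
    have h2' := h2 hsT
    -- Left difference quotients are the useful ones: `w s - δ • v s` with `δ > 0` is `w (s - δ)` up
    -- to `o(δ)`, which is the point that the dissipativity hypothesis compares with `w s`.
    have l1 := (hasDerivAt_iff_tendsto_slope_zero.1 h1').mono_left
      (nhdsWithin_mono 0 (fun x (hx : x ∈ Iio (0:ℝ)) => ne_of_lt hx))
    have l2 := ((hasDerivAt_iff_tendsto_slope_zero.1 h2').mono_left
      (nhdsWithin_mono 0 (fun x (hx : x ∈ Iio (0:ℝ)) => ne_of_lt hx)))
    have l3 : Tendsto (fun δ : ℝ => ‖δ⁻¹ • (w (s + δ) - w s) - v s‖ + ρ s) (𝓝[<] 0)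
        (𝓝 (ρ s)) := by
      have := ((l2.sub_const (v s)).norm).add_const (ρ s)
      simpa using this
    refine le_of_tendsto_of_tendsto l1 l3 ?_
    filter_upwards [self_mem_nhdsWithin] with δ hδ
    have hδ' : δ < 0 := hδ
    have h4 := h3 hsT (-δ) (by linarith)
    have h5 : w s - (-δ) • v s = w (s + δ) - δ • (δ⁻¹ • (w (s + δ) - w s) - v s) := by
      rw [smul_sub, smul_smul, mul_inv_cancel₀ hδ'.ne]
      simp only [one_smul, neg_smul]; abel
    have h6 := norm_sub_le (w (s + δ)) (δ • (δ⁻¹ • (w (s + δ) - w s) - v s))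
    rw [norm_smul, Real.norm_eq_abs, abs_of_neg hδ'] at h6
    rw [h5] at h4
    rw [smul_eq_mul, inv_mul_eq_div, div_le_iff_of_neg hδ']
    linarith
  have hint := hac.integral_deriv_eq_sub
  have hmono : ∫ s in (0)..t, deriv (fun t => ‖w t‖) s ≤ ∫ s in (0)..t, ρ s := by
    refine intervalIntegral.integral_mono_ae_restrict ht.1 hac.intervalIntegrable_deriv
      (intervalIntegrable_of_mem hρ h0 ht) ?_
    rw [EventuallyLE, ← restrict_Ioo_eq_restrict_Icc, ae_restrict_iff' measurableSet_Ioo]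
    exact hle
  linarith

/-- Global existence for `u' = B u + F` with `B` Lipschitz and `F` integrable in time. -/
theorem exists_isPrimitive_of_lipschitz [CompleteSpace X] {T : ℝ} (hT : 0 ≤ T) {B : X → X}
    {L : NNReal} (hB : LipschitzWith L B) {F : ℝ → X} (hF : IntervalIntegrable F volume 0 T)
    (x₀ : X) : ∃ u : ℝ → X, Continuous u ∧ u 0 = x₀ ∧ IsPrimitive T u (fun t => B (u t) + F t) := by
  -- Extending the source by zero makes it integrable on the whole line, so that primitives are
  -- continuous without restriction to `[0,T]`.
  set G : ℝ → X := (Ioc 0 T).indicator F with hG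
  have hGi : Integrable G :=
    (integrable_indicator_iff measurableSet_Ioc).2
      ((intervalIntegrable_iff_integrableOn_Ioc_of_le hT).1 hF)
  -- The unknown is written as `exp(c t) w(t)`. In this weighted norm the Picard map has Lipschitz
  -- constant at most `L / c ≤ 1/2`, so one fixed point covers all of `[0,T]`; the `+ 1` keeps `c`
  -- positive when `L = 0`.
  set c : ℝ := 2 * L + 1 with hc
  have hc0 : 0 < c := by positivity
  let E : C(Icc (0:ℝ) T, X) → ℝ → X := fun w s => Real.exp (c * s) • IccExtend hT w s
  have hE : ∀ w, Continuous (E w) := fun w => by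
    have : Continuous (IccExtend hT w) := w.continuous.Icc_extend'
    fun_prop
  have hBE : ∀ w, Continuous fun s => B (E w s) := fun w => hB.continuous.comp (hE w)
  have hI : ∀ w a b, IntervalIntegrable (fun s => B (E w s) + G s) volume a b := fun w a b =>
    ((hBE w).intervalIntegrable a b).add hGi.intervalIntegrable
  have hP : ∀ w, Continuous fun t => ∫ s in (0)..t, (B (E w s) + G s) := fun w =>
    intervalIntegral.continuous_primitive (hI w) 0
  let Φ : C(Icc (0:ℝ) T, X) → C(Icc (0:ℝ) T, X) := fun w =>
    ⟨fun t => Real.exp (-(c * t)) • (x₀ + ∫ s in (0)..t, (B (E w s) + G s)), by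
      have := (hP w).comp (continuous_subtype_val (p := fun t => t ∈ Icc (0:ℝ) T))
      simp only [Function.comp_def] at this
      fun_prop⟩
  have hΦ : ContractingWith (1/2) Φ := by
    refine ⟨by rw [← NNReal.coe_lt_coe]; norm_num, LipschitzWith.of_dist_le_mul fun w₁ w₂ => ?_⟩
    rw [ContinuousMap.dist_le (by positivity)]
    intro t
    have ht0 : (0:ℝ) ≤ t := t.2.1
    have hb : ‖∫ s in (0)..(t:ℝ), ((B (E w₁ s) + G s) - (B (E w₂ s) + G s))‖ ≤
        ∫ s in (0)..(t:ℝ), L * dist w₁ w₂ * Real.exp (c * s) := by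
      refine intervalIntegral.norm_integral_le_of_norm_le ht0 (ae_of_all _ fun s _ => ?_)
        (by apply Continuous.intervalIntegrable; fun_prop)
      rw [add_sub_add_right_eq_sub, ← dist_eq_norm]
      refine (hB.dist_le_mul _ _).trans ?_
      simp only [E]
      rw [dist_eq_norm, ← smul_sub, norm_smul, Real.norm_eq_abs, abs_of_pos (Real.exp_pos _),
        mul_assoc, mul_comm (Real.exp _)]
      gcongr
      rw [← dist_eq_norm]
      exact ContinuousMap.dist_apply_le_dist _
    have hint : ∫ s in (0)..(t:ℝ), L * dist w₁ w₂ * Real.exp (c * s) =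
        L * dist w₁ w₂ * ((Real.exp (c * t) - 1) / c) := by
      rw [intervalIntegral.integral_const_mul, intervalIntegral.integral_comp_mul_left _ hc0.ne']
      simp [div_eq_inv_mul]
    rw [dist_eq_norm]
    simp only [Φ, ContinuousMap.coe_mk]
    rw [← smul_sub, add_sub_add_left_eq_sub, ← intervalIntegral.integral_sub (hI _ _ _) (hI _ _ _),
      norm_smul, Real.norm_eq_abs, abs_of_pos (Real.exp_pos _)]
    have hexp : Real.exp (-(c * t)) * Real.exp (c * t) = 1 := by rw [← Real.exp_add]; simp
    calc Real.exp (-(c * t)) * _ ≤ Real.exp (-(c * t)) *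
          (L * dist w₁ w₂ * ((Real.exp (c * t) - 1) / c)) := by gcongr; rw [← hint]; exact hb
      _ = (L / c) * dist w₁ w₂ * (1 - Real.exp (-(c * t))) := by
          rw [mul_comm, mul_assoc, div_mul_eq_mul_div, sub_mul, one_mul, mul_comm (Real.exp (c * t)),
            hexp]; ring
      _ ≤ (L / c) * dist w₁ w₂ * 1 := by
          gcongr; linarith [Real.exp_pos (-(c * t))]
      _ ≤ ((1/2 : NNReal) : ℝ) * dist w₁ w₂ := by
          rw [mul_one]; gcongr; rw [div_le_iff₀ hc0, hc]; push_cast; linarith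
  set w := hΦ.fixedPoint Φ with hw
  have hfix : Φ w = w := hΦ.fixedPoint_isFixedPt
  have hu : ∀ t ∈ Icc 0 T, E w t = x₀ + ∫ s in (0)..t, (B (E w s) + G s) := by
    intro t ht
    have := congrArg (fun f : C(Icc (0:ℝ) T, X) => f ⟨t, ht⟩) hfix
    simp only [Φ, ContinuousMap.coe_mk] at this
    simp only [E] at this ⊢
    rw [IccExtend_of_mem hT _ ht, ← this, smul_smul, ← Real.exp_add]
    simp
  have h0 : E w 0 = x₀ := by rw [hu 0 ⟨le_rfl, hT⟩]; simp
  refine ⟨E w, hE w, h0, ((hBE w).intervalIntegrable _ _).add hF, fun t ht => ?_⟩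
  rw [h0, hu t ht]
  congr 1
  refine intervalIntegral.integral_congr_ae (ae_of_all _ fun s hs => ?_)
  rw [uIoc_of_le ht.1] at hs
  simp [hG, indicator_of_mem (show s ∈ Ioc 0 T from ⟨hs.1, hs.2.trans ht.2⟩)]

/-- Integration by parts against test functions. -/
theorem IsPrimitive.hasWeakTimeDeriv [CompleteSpace X] {T : ℝ} (hT : 0 ≤ T) {w v : ℝ → X}
    (h : IsPrimitive T w v) : HasWeakTimeDeriv T w v := by
  have hw : IntegrableOn w (Ioo 0 T) :=
    ((h.continuousOn hT).integrableOn_compact isCompact_Icc).mono_set Ioo_subset_Icc_self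
  have hv : IntegrableOn v (Ioo 0 T) :=
    (((intervalIntegrable_iff_integrableOn_Ioc_of_le hT).1 h.integrable)).mono_set
      Ioo_subset_Ioc_self
  refine ⟨hw, hv, fun φ hφ hφc hφs => ?_⟩
  have hφd : Continuous (deriv φ) := hφ.continuous_deriv (by simp)
  obtain ⟨C₁, hC₁⟩ := hφc.exists_bound_of_continuous hφ.continuous
  obtain ⟨C₂, hC₂⟩ := (hφc.deriv).exists_bound_of_continuous hφd
  have i1 : IntegrableOn (fun t => deriv φ t • w t) (Ioo 0 T) :=
    hw.bdd_smul C₂ hφd.aestronglyMeasurable (ae_of_all _ hC₂)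
  have i2 : IntegrableOn (fun t => φ t • v t) (Ioo 0 T) :=
    hv.bdd_smul C₁ hφ.continuous.aestronglyMeasurable (ae_of_all _ hC₁)
  rw [← sub_eq_zero, sub_neg_eq_add]
  -- Testing against functionals reduces the claim to integration by parts for scalar absolutely
  -- continuous functions; the boundary terms vanish with `φ`.
  refine SeparatingDual.eq_zero_of_forall_dual_eq_zero (R := ℝ) fun ℓ => ?_
  rw [map_add, ← ℓ.integral_comp_comm i1, ← ℓ.integral_comp_comm i2]
  simp only [map_smul, smul_eq_mul, ← integral_Ioc_eq_integral_Ioo,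
    ← intervalIntegral.integral_of_le hT]
  have hℓ := h.map ℓ
  have hφac : AbsolutelyContinuousOnInterval φ 0 T :=
    ((hφ.of_le (by simp)).contDiffOn).absolutelyContinuousOnInterval
  have hz : ∀ x, x ∉ Ioo 0 T → φ x = 0 := fun x hx =>
    image_eq_zero_of_notMem_tsupport fun hx' => hx (hφs hx')
  have key := hφac.integral_mul_deriv_eq_deriv_mul (hℓ.absolutelyContinuousOnInterval hT)
  rw [hz 0 (by simp), hz T (by simp)] at key
  have hc : ∫ x in (0)..T, φ x * deriv (fun t => ℓ (w t)) x = ∫ x in (0)..T, φ x * ℓ (v x) := by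
    refine intervalIntegral.integral_congr_ae ?_
    filter_upwards [hℓ.ae_hasDerivAt hT, measure_eq_zero_iff_ae_notMem.1
      (measure_singleton (μ := (volume : Measure ℝ)) T)] with t ht htT ht'
    rw [uIoc_of_le hT] at ht'
    rw [(ht ⟨ht'.1, lt_of_le_of_ne ht'.2 (by simpa using htT)⟩).deriv]
  rw [hc] at key
  rw [key]; ring

/-- A continuous function with integrable weak derivative is a primitive of it. -/
theorem HasWeakTimeDeriv.isPrimitive [CompleteSpace X] {T : ℝ} (hT : 0 < T) {w v : ℝ → X}
    (h : HasWeakTimeDeriv T w v) (hw : ContinuousOn w (Icc 0 T)) : IsPrimitive T w v := by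
  have hv : IntervalIntegrable v volume 0 T := by
    rw [intervalIntegrable_iff_integrableOn_Ioc_of_le hT.le, integrableOn_Ioc_iff_integrableOn_Ioo]
    exact h.integrable_deriv
  have hV : IsPrimitive T (fun t => ∫ s in (0)..t, v s) v := ⟨hv, fun t _ => by simp⟩
  have hVw := hV.hasWeakTimeDeriv hT.le
  -- The difference `z` has weak derivative zero, and the rest is the du Bois-Reymond argument that
  -- `z` is constant.
  set z : ℝ → X := fun t => w t - ∫ s in (0)..t, v s with hz
  have hzc : ContinuousOn z (Icc 0 T) := hw.sub (hV.continuousOn hT.le)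
  have hzi : IntegrableOn z (Ioo 0 T) := h.integrable.sub hVw.integrable
  have hz0 : ∀ φ : ℝ → ℝ, ContDiff ℝ ∞ φ → HasCompactSupport φ → tsupport φ ⊆ Ioo 0 T →
      ∫ t in Ioo 0 T, deriv φ t • z t = 0 := by
    intro φ hφ hφc hφs
    have hφd : Continuous (deriv φ) := hφ.continuous_deriv (by simp)
    obtain ⟨C₂, hC₂⟩ := (hφc.deriv).exists_bound_of_continuous hφd
    simp only [hz, smul_sub]
    rw [integral_sub (f := fun t => deriv φ t • w t)
      (g := fun t => deriv φ t • ∫ s in (0)..t, v s) (h.integrable.bdd_smul C₂ hφd.aestronglyMeasurable (ae_of_all _ hC₂))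
      (hVw.integrable.bdd_smul C₂ hφd.aestronglyMeasurable (ae_of_all _ hC₂)),
      h.weak_deriv φ hφ hφc hφs, hVw.weak_deriv φ hφ hφc hφs, sub_self]
  -- A reference bump of integral one, supported in `[T/6, 5T/6]`. The candidate constant is the
  -- average of `z` against it.
  let η : ContDiffBump (T / 2) := ⟨T / 4, T / 3, by linarith, by linarith⟩
  have hηt : tsupport (η.normed volume) ⊆ Ioo 0 T := by
    rw [η.tsupport_normed_eq, Real.closedBall_eq_Icc]
    intro x hx
    have h1 : T / 2 - T / 3 ≤ x := hx.1
    have h2 : x ≤ T / 2 + T / 3 := hx.2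
    constructor <;> linarith
  set c : X := ∫ t in Ioo 0 T, η.normed volume t • z t with hc
  have hηs : ContDiff ℝ ∞ (η.normed volume) := η.contDiff_normed
  have hηcs : HasCompactSupport (η.normed volume) := η.hasCompactSupport_normed
  have hzero : ∀ {φ : ℝ → ℝ}, tsupport φ ⊆ Ioo 0 T → ∀ x, x ∉ Ioo 0 T → φ x = 0 :=
    fun h x hx => image_eq_zero_of_notMem_tsupport fun hx' => hx (h hx')
  have hbdd : ∀ {φ : ℝ → ℝ}, ContDiff ℝ ∞ φ → HasCompactSupport φ →
      IntegrableOn (fun t => φ t • z t) (Ioo 0 T) := by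
    intro φ hφ hφc
    obtain ⟨C, hC⟩ := hφc.exists_bound_of_continuous hφ.continuous
    exact hzi.bdd_smul C hφ.continuous.aestronglyMeasurable (ae_of_all _ hC)
  have main : ∀ ψ : ℝ → ℝ, ContDiff ℝ ∞ ψ → HasCompactSupport ψ → tsupport ψ ⊆ Ioo 0 T →
      ∫ t, ψ t • (z t - c) = 0 := by
    intro ψ hψ hψc hψs
    set a : ℝ := ∫ t, ψ t with ha
    -- Removing the mean makes `χ` the derivative of a test function: its primitive from `0`
    -- vanishes to the left of the support, and to the right because `∫ χ = 0`.
    set χ : ℝ → ℝ := fun t => ψ t - a * η.normed volume t with hχ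
    have hχs : ContDiff ℝ ∞ χ := hψ.sub (contDiff_const.mul hηs)
    have hχi : ∫ t, χ t = 0 := by
      rw [hχ, integral_sub (hψ.continuous.integrable_of_hasCompactSupport hψc)
        ((hηs.continuous.integrable_of_hasCompactSupport hηcs).const_mul a),
        integral_const_mul, η.integral_normed, ← ha]; ring
    obtain ⟨l, r, hl, hr, hlr⟩ : ∃ l r : ℝ, 0 < l ∧ r < T ∧ ∀ x, x ∉ Icc l r → χ x = 0 := by
      set S := tsupport ψ ∪ tsupport (η.normed volume) with hS
      have hSc : IsCompact S := hψc.isCompact.union hηcs.isCompact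
      have hSs : S ⊆ Ioo 0 T := union_subset hψs hηt
      have hSn : S.Nonempty := by
        by_contra hne
        rw [not_nonempty_iff_eq_empty] at hne
        have : η.normed volume = 0 := by
          rw [← tsupport_eq_empty_iff]
          exact (union_empty_iff.1 hne).2
        have h1 := η.integral_normed (μ := volume)
        rw [this] at h1
        simp at h1
      refine ⟨sInf S, sSup S, (hSs (hSc.sInf_mem hSn)).1, (hSs (hSc.sSup_mem hSn)).2,
        fun x hx => ?_⟩
      have hxS : x ∉ S := fun h => hx ⟨csInf_le hSc.bddBelow h, le_csSup hSc.bddAbove h⟩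
      rw [hS, mem_union, not_or] at hxS
      simp [hχ, image_eq_zero_of_notMem_tsupport hxS.1, image_eq_zero_of_notMem_tsupport hxS.2]
    set φ : ℝ → ℝ := fun t => ∫ s in (0)..t, χ s with hφ
    have hφd : ∀ t, HasDerivAt φ (χ t) t := fun t =>
      (hχs.continuous.integral_hasStrictDerivAt 0 t).hasDerivAt
    have hφderiv : deriv φ = χ := funext fun t => (hφd t).deriv
    have hφs : ContDiff ℝ ∞ φ := by
      rw [contDiff_infty_iff_deriv]
      exact ⟨fun t => (hφd t).differentiableAt, hφderiv ▸ hχs⟩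
    have hφ0 : ∀ x, x ∉ Icc l r → φ x = 0 := by
      intro x hx
      rcases lt_or_ge x l with hxl | hxl
      · refine (intervalIntegral.integral_congr (g := fun _ => (0:ℝ)) fun s hs => ?_).trans (by simp)
        refine hlr s fun hs' => ?_
        rcases mem_uIcc.1 hs with h1 | h1 <;> linarith [hs'.1, h1.2]
      · have hxr : r < x := not_le.1 fun h => hx ⟨hxl, h⟩
        rw [hφ]
        simp only
        rw [intervalIntegral.integral_of_le (by linarith), ← hχi]
        refine setIntegral_eq_integral_of_forall_compl_eq_zero fun s hs => hlr s fun hs' => ?_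
        exact hs ⟨by linarith [hs'.1], by linarith [hs'.2]⟩
    have hts : tsupport φ ⊆ Icc l r :=
      closure_minimal (fun x hx => by_contra fun h => hx (hφ0 x h)) isClosed_Icc
    have hφcs : HasCompactSupport φ := isCompact_Icc.of_isClosed_subset (isClosed_tsupport _) hts
    have hts' : tsupport φ ⊆ Ioo 0 T := hts.trans fun x hx => ⟨by linarith [hx.1], by linarith [hx.2]⟩
    have h1 := hz0 φ hφs hφcs hts'
    rw [hφderiv] at h1
    have h2 : ∫ t in Ioo 0 T, χ t • z t = (∫ t in Ioo 0 T, ψ t • z t) - a • c := by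
      simp only [hχ, sub_smul, mul_smul]
      rw [integral_sub (g := fun t => a • η.normed volume t • z t) (hbdd hψ hψc)
        ((hbdd hηs hηcs).smul a), integral_smul]
    have h3 : ∫ t, ψ t • (z t - c) = ∫ t in Ioo 0 T, ψ t • (z t - c) :=
      (setIntegral_eq_integral_of_forall_compl_eq_zero fun s hs => by
        rw [hzero hψs s hs, zero_smul]).symm
    have h4 : ∫ t in Ioo 0 T, ψ t = a :=
      setIntegral_eq_integral_of_forall_compl_eq_zero fun s hs => hzero hψs s hs
    rw [h3]
    simp only [smul_sub]
    rw [integral_sub (hbdd hψ hψc)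
      ((hψ.continuous.integrable_of_hasCompactSupport hψc).integrableOn.smul_const c),
      integral_smul_const, h4, ← h2, h1]
  have hloc : LocallyIntegrableOn (fun t => z t - c) (Ioo 0 T) :=
    (hzi.sub (integrableOn_const (by simp))).locallyIntegrableOn
  have hae := isOpen_Ioo.ae_eq_zero_of_integral_contDiff_smul_eq_zero hloc main
  have heq : EqOn z (fun _ => c) (Icc 0 T) := by
    refine Measure.eqOn_Icc_of_ae_eq volume hT.ne ?_ hzc continuousOn_const
    rw [← restrict_Ioo_eq_restrict_Icc, EventuallyEq, ae_restrict_iff' measurableSet_Ioo]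
    filter_upwards [hae] with t ht htT
    exact sub_eq_zero.1 (ht htT)
  refine ⟨hv, fun t ht => ?_⟩
  have e1 := heq ht
  have e2 := heq (show (0:ℝ) ∈ Icc 0 T from ⟨le_rfl, hT.le⟩)
  simp only [hz, intervalIntegral.integral_same, sub_zero] at e1 e2
  rw [e2, ← e1]; abel

end Evolution

/-! ### Integral bounds for symmetric kernels with uniformly bounded sections -/

section Kernel

variable {α : Type*} [MeasurableSpace α] {μ : Measure α} [IsFiniteMeasure μ]

/-- A symmetric kernel whose sections have `L¹` norm at most `M`. -/
structure SymmKernel (μ : Measure α) (K : α → α → ℝ) (M : NNReal) : Prop where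
  aestronglyMeasurable : AEStronglyMeasurable (Function.uncurry K) (μ.prod μ)
  symm : ∀ x y, K x y = K y x
  bound : ∀ᵐ x ∂μ, ∫⁻ y, ‖K x y‖ₑ ∂μ ≤ M

/-- `x ↦ ∫ K(x,y) θ(u(y) - u(x)) dy`. -/
def nonlocalOp (μ : Measure α) (K : α → α → ℝ) (θ : ℝ → ℝ) (u : α → ℝ) (x : α) : ℝ :=
  ∫ y, K x y * θ (u y - u x) ∂μ

namespace SymmKernel

variable {K : α → α → ℝ} {M : NNReal}

set_option linter.unusedSectionVars false

theorem aemeasurable_enorm (hK : SymmKernel μ K M) :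
    AEMeasurable (fun z : α × α => ‖K z.1 z.2‖ₑ) (μ.prod μ) :=
  hK.aestronglyMeasurable.enorm

theorem aemeasurable_enorm_mul (hK : SymmKernel μ K M) {G : α × α → ℝ≥0∞}
    (hG : AEMeasurable G (μ.prod μ)) :
    AEMeasurable (fun z : α × α => ‖K z.1 z.2‖ₑ * G z) (μ.prod μ) :=
  hK.aemeasurable_enorm.mul hG

theorem aestronglyMeasurable_mul (hK : SymmKernel μ K M) {G : α × α → ℝ}
    (hG : AEStronglyMeasurable G (μ.prod μ)) :
    AEStronglyMeasurable (fun z : α × α => K z.1 z.2 * G z) (μ.prod μ) :=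
  hK.aestronglyMeasurable.mul hG

/-- Tonelli's theorem with the inner integral in `y`, where only the section bound enters. Symmetry
of `K` transfers the same estimate to functions of the second variable, as in Schur's test. -/
theorem lintegral_fst_le (hK : SymmKernel μ K M) {G : α → ℝ≥0∞} (hG : AEMeasurable G μ) :
    ∫⁻ z, ‖K z.1 z.2‖ₑ * G z.1 ∂(μ.prod μ) ≤ M * ∫⁻ x, G x ∂μ := by
  rw [lintegral_prod _ (hK.aemeasurable_enorm_mul hG.comp_fst)]
  simp only
  rw [← lintegral_const_mul'' _ hG]
  refine lintegral_mono_ae ?_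
  filter_upwards [hK.bound, hK.aestronglyMeasurable.prodMk_left] with x hx hm
  rw [lintegral_mul_const'' (f := fun y => ‖K x y‖ₑ) _ hm.enorm]
  gcongr

theorem lintegral_snd_le (hK : SymmKernel μ K M) {G : α → ℝ≥0∞} (hG : AEMeasurable G μ) :
    ∫⁻ z, ‖K z.1 z.2‖ₑ * G z.2 ∂(μ.prod μ) ≤ M * ∫⁻ x, G x ∂μ := by
  rw [← lintegral_prod_swap]
  simp only [Prod.fst_swap, Prod.snd_swap]
  simp_rw [hK.symm _ (Prod.fst _)]
  exact hK.lintegral_fst_le hG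

theorem lintegral_le (hK : SymmKernel μ K M) (c : ℝ≥0∞) :
    ∫⁻ z, ‖K z.1 z.2‖ₑ * c ∂(μ.prod μ) ≤ M * (c * μ univ) := by
  simpa using hK.lintegral_fst_le (aemeasurable_const (b := c))

/-- Convexity gives `|a - b|^r ≤ 2^(r-1) (|a|^r + |b|^r)`, and each summand depends on one variable
only. -/
theorem lintegral_diff_le (hK : SymmKernel μ K M) {r : ℝ≥0∞} (hr : 1 ≤ r) {u : α → ℝ}
    (hu : AEStronglyMeasurable u μ) :
    ∫⁻ z, ‖K z.1 z.2‖ₑ * ‖u z.2 - u z.1‖ₑ ^ r.toReal ∂(μ.prod μ) ≤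
      2 ^ r.toReal * M * ∫⁻ x, ‖u x‖ₑ ^ r.toReal ∂μ := by
  rcases eq_or_ne r ⊤ with rfl | hr'
  -- For `r = ⊤` the real exponent is `0`, so every power is `1`.
  · simpa using hK.lintegral_fst_le (G := fun _ => 1) aemeasurable_const
  have h1 : 1 ≤ r.toReal := by simpa using ENNReal.toReal_mono hr' hr
  have hum : AEMeasurable (fun x => ‖u x‖ₑ ^ r.toReal) μ := hu.enorm.pow_const _
  calc ∫⁻ z, ‖K z.1 z.2‖ₑ * ‖u z.2 - u z.1‖ₑ ^ r.toReal ∂(μ.prod μ)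
      ≤ ∫⁻ z, 2 ^ (r.toReal - 1) * (‖K z.1 z.2‖ₑ * ‖u z.2‖ₑ ^ r.toReal +
          ‖K z.1 z.2‖ₑ * ‖u z.1‖ₑ ^ r.toReal) ∂(μ.prod μ) := by
        refine lintegral_mono fun z => ?_
        simp only
        rw [← mul_add, mul_left_comm]
        gcongr
        calc ‖u z.2 - u z.1‖ₑ ^ r.toReal ≤ (‖u z.2‖ₑ + ‖u z.1‖ₑ) ^ r.toReal := by
              gcongr; exact enorm_sub_le
          _ ≤ _ := ENNReal.rpow_add_le_mul_rpow_add_rpow _ _ h1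
    _ ≤ 2 ^ (r.toReal - 1) * (M * (∫⁻ x, ‖u x‖ₑ ^ r.toReal ∂μ) +
          M * (∫⁻ x, ‖u x‖ₑ ^ r.toReal ∂μ)) := by
        rw [lintegral_const_mul' _ _ (by finiteness), lintegral_add_left'
          (hK.aemeasurable_enorm_mul hum.comp_snd)]
        gcongr
        · exact hK.lintegral_snd_le hum
        · exact hK.lintegral_fst_le hum
    _ = 2 ^ r.toReal * M * ∫⁻ x, ‖u x‖ₑ ^ r.toReal ∂μ := by
        rw [ENNReal.rpow_sub _ _ (by simp) (by simp), ← two_mul, ← mul_assoc, ENNReal.rpow_one,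
          ENNReal.div_mul_cancel (by simp) (by simp), mul_assoc]

/-- The weighted average of `G` against the kernel is bounded in `L^r` (Jensen's inequality). -/
theorem eLpNorm_integral_le (hK : SymmKernel μ K M) {r : ℝ≥0∞} (hr : 1 ≤ r) (hr' : r ≠ ⊤)
    {G : α × α → ℝ} (hG : AEStronglyMeasurable G (μ.prod μ)) :
    eLpNorm (fun x => ∫ y, K x y * G (x, y) ∂μ) r μ ≤
      (M : ℝ≥0∞) ^ (1 - 1 / r.toReal) *
        (∫⁻ z, ‖K z.1 z.2‖ₑ * ‖G z‖ₑ ^ r.toReal ∂(μ.prod μ)) ^ (1 / r.toReal) := by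
  have h1 : 1 ≤ r.toReal := by simpa using ENNReal.toReal_mono hr' hr
  have h0 : 0 < r.toReal := by linarith
  have hinv : 1 / r.toReal ≤ 1 := by rw [div_le_one h0]; exact h1
  rw [eLpNorm_eq_lintegral_rpow_enorm_toReal (by positivity) hr', lintegral_prod _
    (hK.aemeasurable_enorm_mul (hG.enorm.pow_const _)),
    ← ENNReal.rpow_le_rpow_iff h0, ENNReal.mul_rpow_of_nonneg _ _ h0.le, ← ENNReal.rpow_mul,
    ← ENNReal.rpow_mul, ← ENNReal.rpow_mul, one_div_mul_cancel h0.ne', ENNReal.rpow_one,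
    ENNReal.rpow_one, ← lintegral_const_mul' _ _ (by
      have : 0 ≤ (1 - 1 / r.toReal) * r.toReal := mul_nonneg (by linarith) h0.le
      finiteness)]
  refine lintegral_mono_ae ?_
  filter_upwards [hK.bound, hK.aestronglyMeasurable.prodMk_left, hG.prodMk_left] with x hx hm hGm
  have hm' : AEMeasurable (fun y => ‖K x y‖ₑ) μ := hm.enorm
  -- Hölder's inequality for the factorization `|K| |G| = |K|^(1-1/r) · (|K| |G|^r)^(1/r)`.
  have key : ‖∫ y, K x y * G (x, y) ∂μ‖ₑ ≤ (∫⁻ y, ‖K x y‖ₑ ∂μ) ^ (1 - 1 / r.toReal) *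
      (∫⁻ y, ‖K x y‖ₑ * ‖G (x, y)‖ₑ ^ r.toReal ∂μ) ^ (1 / r.toReal) := by
    refine (enorm_integral_le_lintegral_enorm _).trans (le_trans (lintegral_mono fun y => ?_)
      (ENNReal.lintegral_mul_norm_pow_le hm' (hm'.mul (hGm.enorm.pow_const _))
        (by linarith) (by positivity) (by ring)))
    simp only
    rw [enorm_mul, Pi.mul_apply, ENNReal.mul_rpow_of_nonneg _ _ (by positivity), ← ENNReal.rpow_mul,
      mul_one_div_cancel h0.ne', ENNReal.rpow_one, ← mul_assoc]
    rcases eq_or_ne ‖K x y‖ₑ 0 with h | h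
    · simp [h]
    · rw [← ENNReal.rpow_add _ _ h (by simp)]
      simp
  calc ‖∫ y, K x y * G (x, y) ∂μ‖ₑ ^ r.toReal
      ≤ ((M : ℝ≥0∞) ^ (1 - 1 / r.toReal) *
        (∫⁻ y, ‖K x y‖ₑ * ‖G (x, y)‖ₑ ^ r.toReal ∂μ) ^ (1 / r.toReal)) ^ r.toReal := by
        gcongr
        exact key.trans (by gcongr)
    _ = _ := by
        rw [ENNReal.mul_rpow_of_nonneg _ _ h0.le, ← ENNReal.rpow_mul, ← ENNReal.rpow_mul,
          one_div_mul_cancel h0.ne', ENNReal.rpow_one]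

theorem eLpNorm_integral_lt_top (hK : SymmKernel μ K M) {r : ℝ≥0∞} (hr : 1 ≤ r) (hr' : r ≠ ⊤)
    {G : α × α → ℝ} (hG : AEStronglyMeasurable G (μ.prod μ))
    (h : ∫⁻ z, ‖K z.1 z.2‖ₑ * ‖G z‖ₑ ^ r.toReal ∂(μ.prod μ) < ⊤) :
    MemLp (fun x => ∫ y, K x y * G (x, y) ∂μ) r μ := by
  have h1 : 1 ≤ r.toReal := by simpa using ENNReal.toReal_mono hr' hr
  have hinv : 1 / r.toReal ≤ 1 := by rw [div_le_one (by linarith)]; exact h1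
  refine ⟨(hK.aestronglyMeasurable_mul hG).integral_prod_right',
    (hK.eLpNorm_integral_le hr hr' hG).trans_lt ?_⟩
  refine ENNReal.mul_lt_top (ENNReal.rpow_lt_top_of_nonneg (by linarith) (by simp))
    (ENNReal.rpow_lt_top_of_nonneg (by positivity) h.ne)

theorem aestronglyMeasurable_diff {u : α → ℝ} (hu : AEStronglyMeasurable u μ) {θ : ℝ → ℝ}
    (hθ : Measurable θ) :
    AEStronglyMeasurable (fun z : α × α => θ (u z.2 - u z.1)) (μ.prod μ) :=
  (hθ.comp_aemeasurable (hu.comp_snd.sub hu.comp_fst).aemeasurable).aestronglyMeasurable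

theorem lintegral_growth_le (hK : SymmKernel μ K M) {r : ℝ≥0∞} (hr : 1 ≤ r) {u : α → ℝ}
    (hu : AEStronglyMeasurable u μ) :
    ∫⁻ z, ‖K z.1 z.2‖ₑ * (1 + ‖u z.2 - u z.1‖ₑ ^ r.toReal) ∂(μ.prod μ) ≤
      M * (μ univ + 2 ^ r.toReal * ∫⁻ x, ‖u x‖ₑ ^ r.toReal ∂μ) := by
  simp only [mul_add, mul_one]
  rw [lintegral_add_left' hK.aemeasurable_enorm]
  gcongr
  · simpa using hK.lintegral_le 1
  · refine (hK.lintegral_diff_le hr hu).trans (le_of_eq ?_)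
    ring

end SymmKernel

end Kernel

/-! ### Dissipativity of the nonlocal operator -/

section Dissipative

set_option linter.unusedSectionVars false

variable {α : Type*} [MeasurableSpace α] {μ : Measure α} [IsFiniteMeasure μ]

/-- The derivative of `|s|^r / r`. -/
def powSign (r s : ℝ) : ℝ := |s| ^ (r - 1) * SignType.sign s

theorem abs_powSign_le (r s : ℝ) : |powSign r s| ≤ |s| ^ (r - 1) := by
  rw [powSign, abs_mul, abs_of_nonneg (a := |s| ^ (r - 1)) (by positivity)]
  refine mul_le_of_le_one_right (by positivity) ?_
  rcases lt_trichotomy s 0 with h | rfl | h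
  · simp [sign_neg h]
  · simp
  · simp [sign_pos h]

theorem mul_powSign_self {r : ℝ} (hr : 0 < r) (s : ℝ) : s * powSign r s = |s| ^ r := by
  rcases eq_or_ne s 0 with rfl | h
  · simp [powSign, Real.zero_rpow hr.ne']
  · have h1 : |s| ^ (r - 1) * |s| = |s| ^ r := by
      rw [← Real.rpow_add_one (abs_pos.2 h).ne']; simp
    rw [powSign, mul_left_comm, mul_comm s, sign_mul_self, h1]

theorem monotone_powSign {r : ℝ} (hr : 1 ≤ r) : Monotone (powSign r) := by
  intro a b hab
  simp only [powSign]
  rcases lt_trichotomy a 0 with ha | rfl | ha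
  · rcases lt_trichotomy b 0 with hb | rfl | hb
    · simp only [sign_neg ha, sign_neg hb, abs_of_neg ha, abs_of_neg hb]
      have : (-b) ^ (r - 1) ≤ (-a) ^ (r - 1) :=
        Real.rpow_le_rpow (by linarith) (by linarith) (by linarith)
      simpa using this
    · simp only [sign_neg ha, sign_zero]
      have : 0 ≤ |a| ^ (r - 1) := by positivity
      simpa using this
    · simp only [sign_neg ha, sign_pos hb]
      have h1 : 0 ≤ |a| ^ (r - 1) := by positivity
      have h2 : 0 ≤ |b| ^ (r - 1) := by positivity
      simp; linarith
  · rcases hab.eq_or_lt with rfl | hb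
    · simp
    · simp only [sign_pos hb, sign_zero]
      have h2 : 0 ≤ |b| ^ (r - 1) := by positivity
      simpa using h2
  · have hb : 0 < b := ha.trans_le hab
    simp only [sign_pos ha, sign_pos hb, abs_of_pos ha, abs_of_pos hb]
    have : a ^ (r - 1) ≤ b ^ (r - 1) := Real.rpow_le_rpow ha.le hab (by linarith)
    simpa using this

/-- Young's inequality, obtained from weighted means of `a^r` and `c^r` with weights `1 - 1/r` and
`1/r`. Written without the conjugate exponent, it includes `r = 1`. -/
theorem mul_rpow_sub_one_le {r : ℝ} (hr : 1 ≤ r) {a c : ℝ} (ha : 0 ≤ a) (hc : 0 ≤ c) :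
    r * (a ^ (r - 1) * c) ≤ (r - 1) * a ^ r + c ^ r := by
  have h0 : 0 < r := by linarith
  have hinv : 1 / r ≤ 1 := by rw [div_le_one h0]; exact hr
  have := Real.geom_mean_le_arith_mean2_weighted (w₁ := 1 - 1 / r) (w₂ := 1 / r) (p₁ := a ^ r)
    (p₂ := c ^ r) (by linarith) (by positivity) (by positivity) (by positivity) (by ring)
  rw [← Real.rpow_mul ha, ← Real.rpow_mul hc, mul_one_div_cancel h0.ne', Real.rpow_one,
    show r * (1 - 1 / r) = r - 1 by field_simp] at this
  calc r * (a ^ (r - 1) * c) ≤ r * ((1 - 1 / r) * a ^ r + 1 / r * c ^ r) := by gcongr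
    _ = _ := by field_simp

/-- Convexity of `|s|^r`: its graph lies above the tangent line at `a`, where `powSign` selects the
subgradient `0` at the origin when `r = 1`. -/
theorem abs_rpow_add_le {r : ℝ} (hr : 1 ≤ r) (a c : ℝ) :
    |a| ^ r + r * (powSign r a * (c - a)) ≤ |c| ^ r := by
  have h1 : powSign r a * c ≤ |a| ^ (r - 1) * |c| := by
    refine (le_abs_self _).trans ?_
    rw [abs_mul]
    gcongr
    exact abs_powSign_le r a
  have h2 := mul_powSign_self (by linarith : 0 < r) a
  have h3 := mul_rpow_sub_one_le hr (abs_nonneg a) (abs_nonneg c)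
  have h4 : r * (powSign r a * c) ≤ r * (|a| ^ (r - 1) * |c|) := by gcongr
  nlinarith

/-- Integrating the tangent inequality between `w` and `w - δ b` leaves a first-order term of
favourable sign. This turns a sign condition on a pairing into dissipativity of the norm. -/
theorem eLpNorm_le_eLpNorm_sub_of_integral_nonpos {r : ℝ≥0∞} (hr : 1 ≤ r) (hr' : r ≠ ⊤)
    {w b : α → ℝ} (hw : MemLp w r μ) (hb : MemLp b r μ)
    (h : ∫ x, b x * powSign r.toReal (w x) ∂μ ≤ 0) {δ : ℝ} (hδ : 0 ≤ δ) :
    eLpNorm w r μ ≤ eLpNorm (fun x => w x - δ * b x) r μ := by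
  have h1 : 1 ≤ r.toReal := by simpa using ENNReal.toReal_mono hr' hr
  have hr0 : r ≠ 0 := by positivity
  have hwb : MemLp (fun x => w x - δ * b x) r μ := hw.sub (hb.const_mul δ)
  rw [hw.eLpNorm_eq_integral_rpow_norm hr0 hr', hwb.eLpNorm_eq_integral_rpow_norm hr0 hr']
  have iw := hw.integrable_norm_rpow hr0 hr'
  have iwb := hwb.integrable_norm_rpow hr0 hr'
  have ib := hb.integrable_norm_rpow hr0 hr'
  have ibw : Integrable (fun x => b x * powSign r.toReal (w x)) μ := by
    refine Integrable.mono' ((iw.const_mul (r.toReal - 1)).add ib)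
      (hb.1.mul ((monotone_powSign h1).measurable.comp_aemeasurable
        hw.1.aemeasurable).aestronglyMeasurable) (ae_of_all _ fun x => ?_)
    simp only [Pi.add_apply, Real.norm_eq_abs, abs_mul]
    refine le_trans ?_ (mul_rpow_sub_one_le h1 (abs_nonneg (w x)) (abs_nonneg (b x)))
    have : |b x| * |powSign r.toReal (w x)| ≤ |w x| ^ (r.toReal - 1) * |b x| := by
      rw [mul_comm]; gcongr; exact abs_powSign_le _ _
    refine this.trans (le_mul_of_one_le_left (by positivity) h1)
  apply ENNReal.ofReal_le_ofReal
  gcongr ?_ ^ _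
  calc ∫ x, ‖w x‖ ^ r.toReal ∂μ
      ≤ ∫ x, ‖w x‖ ^ r.toReal ∂μ - r.toReal * δ * ∫ x, b x * powSign r.toReal (w x) ∂μ := by
        have : 0 ≤ r.toReal * δ * -∫ x, b x * powSign r.toReal (w x) ∂μ := by
          apply mul_nonneg (by positivity) (by linarith)
        linarith
    _ = ∫ x, (‖w x‖ ^ r.toReal - r.toReal * δ * (b x * powSign r.toReal (w x))) ∂μ := by
        rw [integral_sub iw (ibw.const_mul _), integral_const_mul]
    _ ≤ ∫ x, ‖w x - δ * b x‖ ^ r.toReal ∂μ := by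
        refine integral_mono (iw.sub (ibw.const_mul _)) iwb fun x => ?_
        have := abs_rpow_add_le h1 (w x) (w x - δ * b x)
        simp only [Real.norm_eq_abs]
        refine le_trans (le_of_eq ?_) this
        ring

theorem enorm_le_of_growth {a c s r : ℝ} (hr : 0 ≤ r) (h : |a| ≤ c * (1 + |s| ^ r)) :
    ‖a‖ₑ ≤ ENNReal.ofReal c * (1 + ‖s‖ₑ ^ r) := by
  rw [Real.enorm_eq_ofReal_abs, Real.enorm_eq_ofReal_abs,
    ENNReal.ofReal_rpow_of_nonneg (abs_nonneg s) hr, ← ENNReal.ofReal_one,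
    ← ENNReal.ofReal_add (by norm_num) (by positivity), ← ENNReal.ofReal_mul' (by positivity)]
  exact ENNReal.ofReal_le_ofReal h

theorem lintegral_enorm_rpow_le {r : ℝ≥0∞} (hr : 1 ≤ r) (hr' : r ≠ ⊤) {u : α → ℝ} {R : ℝ≥0∞}
    (hR : eLpNorm u r μ ≤ R) : ∫⁻ x, ‖u x‖ₑ ^ r.toReal ∂μ ≤ R ^ r.toReal := by
  have h0 : 0 < r.toReal := ENNReal.toReal_pos (by positivity) hr'
  rw [eLpNorm_eq_lintegral_rpow_enorm_toReal (by positivity) hr', one_div,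
    ENNReal.rpow_inv_le_iff h0] at hR
  exact hR

namespace SymmKernel

set_option linter.unusedSectionVars false

variable {K : α → α → ℝ} {M : NNReal} {θ σ : ℝ → ℝ} {u u₁ u₂ : α → ℝ}

theorem nonlocalOp_sub_ae_eq
    (h₁ : Integrable (fun z : α × α => K z.1 z.2 * θ (u₁ z.2 - u₁ z.1)) (μ.prod μ))
    (h₂ : Integrable (fun z : α × α => K z.1 z.2 * θ (u₂ z.2 - u₂ z.1)) (μ.prod μ)) :
    (fun x => nonlocalOp μ K θ u₁ x - nonlocalOp μ K θ u₂ x) =ᵐ[μ]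
      fun x => ∫ y, K x y * (θ (u₁ y - u₁ x) - θ (u₂ y - u₂ x)) ∂μ := by
  filter_upwards [h₁.prod_right_ae, h₂.prod_right_ae] with x hx₁ hx₂
  simp only [nonlocalOp, mul_sub]
  rw [integral_sub hx₁ hx₂]

/-- The central cancellation. Adding the double integral to its image under `x ↔ y`, and using
symmetry of `K` and oddness of `θ`, gives the integrand `K · (θ₁ - θ₂) · (σ(w(x)) - σ(w(y)))` with
`w = u₁ - u₂`. By monotonicity, the first difference has the sign of `w(y) - w(x)` and the second
the opposite sign. -/
theorem integral_mul_nonpos (hK : SymmKernel μ K M) (hK0 : ∀ x y, 0 ≤ K x y)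
    (hθ : Monotone θ) (hodd : ∀ s, θ (-s) = -θ s) (hσ : Monotone σ)
    (h : Integrable (fun z : α × α => K z.1 z.2 * (θ (u₁ z.2 - u₁ z.1) - θ (u₂ z.2 - u₂ z.1)) *
      σ (u₁ z.1 - u₂ z.1)) (μ.prod μ)) :
    ∫ x, (∫ y, K x y * (θ (u₁ y - u₁ x) - θ (u₂ y - u₂ x)) ∂μ) * σ (u₁ x - u₂ x) ∂μ ≤ 0 := by
  simp_rw [← integral_mul_const]
  rw [← integral_prod (f := fun z : α × α => K z.1 z.2 *
    (θ (u₁ z.2 - u₁ z.1) - θ (u₂ z.2 - u₂ z.1)) * σ (u₁ z.1 - u₂ z.1)) h]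
  have hs := integral_prod_swap (μ := μ) (ν := μ) (fun z : α × α => K z.1 z.2 *
    (θ (u₁ z.2 - u₁ z.1) - θ (u₂ z.2 - u₂ z.1)) * σ (u₁ z.1 - u₂ z.1))
  have hadd := integral_add h h.swap
  have hneg : ∫ z : α × α, (K z.1 z.2 *
      (θ (u₁ z.2 - u₁ z.1) - θ (u₂ z.2 - u₂ z.1)) * σ (u₁ z.1 - u₂ z.1)) + ((fun z : α × α =>
      K z.1 z.2 * (θ (u₁ z.2 - u₁ z.1) - θ (u₂ z.2 - u₂ z.1)) * σ (u₁ z.1 - u₂ z.1)) ∘ Prod.swap) z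
      ∂(μ.prod μ) ≤ 0 := by
    refine integral_nonpos fun z => ?_
    simp only [Function.comp_apply, Prod.fst_swap, Prod.snd_swap, Pi.zero_apply]
    rw [hK.symm z.2 z.1, ← neg_sub (u₁ z.2), ← neg_sub (u₂ z.2), hodd, hodd]
    have hk := hK0 z.1 z.2
    have : K z.1 z.2 * (θ (u₁ z.2 - u₁ z.1) - θ (u₂ z.2 - u₂ z.1)) * σ (u₁ z.1 - u₂ z.1) +
        K z.1 z.2 * (-θ (u₁ z.2 - u₁ z.1) - -θ (u₂ z.2 - u₂ z.1)) * σ (u₁ z.2 - u₂ z.2) =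
        K z.1 z.2 * ((θ (u₁ z.2 - u₁ z.1) - θ (u₂ z.2 - u₂ z.1)) *
          (σ (u₁ z.1 - u₂ z.1) - σ (u₁ z.2 - u₂ z.2))) := by ring
    rw [this]
    refine mul_nonpos_of_nonneg_of_nonpos hk ?_
    rcases le_total (u₁ z.2 - u₁ z.1) (u₂ z.2 - u₂ z.1) with h | h
    · exact mul_nonpos_of_nonpos_of_nonneg (sub_nonpos.2 (hθ h))
        (sub_nonneg.2 (hσ (by linarith)))
    · exact mul_nonpos_of_nonneg_of_nonpos (sub_nonneg.2 (hθ h))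
        (sub_nonpos.2 (hσ (by linarith)))
  rw [hadd] at hneg
  simp only [Function.comp_def] at hneg
  linarith

theorem integrable_of_growth (hK : SymmKernel μ K M) {r : ℝ≥0∞} (hr : 1 ≤ r) (hr' : r ≠ ⊤)
    (hu : MemLp u r μ) (hθ : Measurable θ) {c : ℝ} (hc : ∀ s, |θ s| ≤ c * (1 + |s| ^ r.toReal)) :
    Integrable (fun z : α × α => K z.1 z.2 * θ (u z.2 - u z.1)) (μ.prod μ) := by
  refine ⟨hK.aestronglyMeasurable_mul (aestronglyMeasurable_diff hu.1 hθ), ?_⟩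
  calc ∫⁻ z, ‖K z.1 z.2 * θ (u z.2 - u z.1)‖ₑ ∂(μ.prod μ)
      ≤ ∫⁻ z, ENNReal.ofReal c * (‖K z.1 z.2‖ₑ * (1 + ‖u z.2 - u z.1‖ₑ ^ r.toReal))
          ∂(μ.prod μ) := by
        refine lintegral_mono fun z => ?_
        rw [enorm_mul, mul_left_comm]
        gcongr
        exact enorm_le_of_growth (by positivity) (hc _)
    _ < ⊤ := by
        rw [lintegral_const_mul' _ _ (by simp)]
        refine ENNReal.mul_lt_top (by simp) ((hK.lintegral_growth_le hr hu.1).trans_lt ?_)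
        have h1 := (lintegral_rpow_enorm_lt_top_of_eLpNorm_lt_top (by positivity) hr' hu.2).ne
        finiteness

theorem growth_of_lipschitz {L : NNReal} (hL : LipschitzWith L θ) (h0 : θ 0 = 0) {r : ℝ}
    (hr : 1 ≤ r) (s : ℝ) : |θ s| ≤ L * (1 + |s| ^ r) := by
  have h := hL.dist_le_mul s 0
  rw [h0, Real.dist_eq, Real.dist_eq, sub_zero, sub_zero] at h
  refine h.trans ?_
  gcongr
  rcases le_total |s| 1 with h1 | h1
  · have : 0 ≤ |s| ^ r := by positivity
    linarith
  · have := Real.rpow_le_rpow_of_exponent_le h1 hr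
    rw [Real.rpow_one] at this
    linarith

theorem zero_of_odd (hodd : ∀ s, θ (-s) = -θ s) : θ 0 = 0 := by
  have := hodd 0
  rw [neg_zero] at this
  linarith

theorem enorm_sub_le_of_lipschitz {L : NNReal} (hL : LipschitzWith L θ) (a b : ℝ) :
    ‖θ a - θ b‖ₑ ≤ L * ‖a - b‖ₑ := by
  have := hL.edist_le_mul a b
  rwa [edist_eq_enorm_sub, edist_eq_enorm_sub] at this

theorem memLp_nonlocalOp (hK : SymmKernel μ K M) {r : ℝ≥0∞} (hr : 1 ≤ r) (hr' : r ≠ ⊤)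
    (hu : MemLp u r μ) {L : NNReal} (hL : LipschitzWith L θ) (h0 : θ 0 = 0) :
    MemLp (nonlocalOp μ K θ u) r μ := by
  refine hK.eLpNorm_integral_lt_top hr hr'
    (aestronglyMeasurable_diff hu.1 hL.continuous.measurable) ?_
  have h1 := (lintegral_rpow_enorm_lt_top_of_eLpNorm_lt_top (by positivity) hr' hu.2).ne
  calc ∫⁻ z, ‖K z.1 z.2‖ₑ * ‖θ (u z.2 - u z.1)‖ₑ ^ r.toReal ∂(μ.prod μ)
      ≤ ∫⁻ z, (L : ℝ≥0∞) ^ r.toReal * (‖K z.1 z.2‖ₑ * ‖u z.2 - u z.1‖ₑ ^ r.toReal)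
          ∂(μ.prod μ) := by
        refine lintegral_mono fun z => ?_
        rw [mul_left_comm, ← ENNReal.mul_rpow_of_nonneg _ _ (by positivity)]
        gcongr
        simpa [h0] using enorm_sub_le_of_lipschitz hL (u z.2 - u z.1) 0
    _ < ⊤ := by
        rw [lintegral_const_mul' _ _ (by finiteness)]
        refine ENNReal.mul_lt_top (by finiteness) ((hK.lintegral_diff_le hr hu.1).trans_lt ?_)
        finiteness

/-- The Lipschitz bound moves to the difference `u₁ - u₂`, to which Jensen's inequality and
`lintegral_diff_le` apply. The powers `M^(1-1/r)` and `M^(1/r)` combine into one factor `M`. -/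
theorem eLpNorm_nonlocalOp_sub_le (hK : SymmKernel μ K M) {r : ℝ≥0∞} (hr : 1 ≤ r) (hr' : r ≠ ⊤)
    (hu₁ : MemLp u₁ r μ) (hu₂ : MemLp u₂ r μ) {L : NNReal} (hL : LipschitzWith L θ)
    (h0 : θ 0 = 0) :
    eLpNorm (fun x => nonlocalOp μ K θ u₁ x - nonlocalOp μ K θ u₂ x) r μ ≤
      2 * L * M * eLpNorm (fun x => u₁ x - u₂ x) r μ := by
  have h1 : 1 ≤ r.toReal := by simpa using ENNReal.toReal_mono hr' hr
  have hpos : 0 < r.toReal := by linarith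
  have hinv : 1 / r.toReal ≤ 1 := by rw [div_le_one hpos]; exact h1
  have hm := hL.continuous.measurable
  rw [eLpNorm_congr_ae (nonlocalOp_sub_ae_eq
    (hK.integrable_of_growth hr hr' hu₁ hm (growth_of_lipschitz hL h0 h1))
    (hK.integrable_of_growth hr hr' hu₂ hm (growth_of_lipschitz hL h0 h1)))]
  refine (hK.eLpNorm_integral_le hr hr' (G := fun z => θ (u₁ z.2 - u₁ z.1) - θ (u₂ z.2 - u₂ z.1))
    ((aestronglyMeasurable_diff hu₁.1 hm).sub (aestronglyMeasurable_diff hu₂.1 hm))).trans ?_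
  have hle : ∫⁻ z, ‖K z.1 z.2‖ₑ * ‖θ (u₁ z.2 - u₁ z.1) - θ (u₂ z.2 - u₂ z.1)‖ₑ ^ r.toReal
      ∂(μ.prod μ) ≤ (L : ℝ≥0∞) ^ r.toReal *
        (2 ^ r.toReal * M * ∫⁻ x, ‖u₁ x - u₂ x‖ₑ ^ r.toReal ∂μ) := by
    refine le_trans ?_ (mul_le_mul_right (hK.lintegral_diff_le hr (hu₁.1.sub hu₂.1)) _)
    rw [← lintegral_const_mul' _ _ (by finiteness)]
    refine lintegral_mono fun z => ?_
    simp only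
    rw [mul_left_comm, ← ENNReal.mul_rpow_of_nonneg _ _ (by positivity)]
    gcongr
    refine (enorm_sub_le_of_lipschitz hL _ _).trans (le_of_eq ?_)
    simp only [Pi.sub_apply]
    congr 2
    ring
  calc (M : ℝ≥0∞) ^ (1 - 1 / r.toReal) * (∫⁻ z, ‖K z.1 z.2‖ₑ *
        ‖θ (u₁ z.2 - u₁ z.1) - θ (u₂ z.2 - u₂ z.1)‖ₑ ^ r.toReal ∂(μ.prod μ)) ^ (1 / r.toReal)
      ≤ (M : ℝ≥0∞) ^ (1 - 1 / r.toReal) * ((L : ℝ≥0∞) ^ r.toReal *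
        (2 ^ r.toReal * M * ∫⁻ x, ‖u₁ x - u₂ x‖ₑ ^ r.toReal ∂μ)) ^ (1 / r.toReal) := by
        gcongr
    _ = _ := by
        rw [eLpNorm_eq_lintegral_rpow_enorm_toReal (by positivity) hr',
          ENNReal.mul_rpow_of_nonneg _ _ (by positivity),
          ENNReal.mul_rpow_of_nonneg _ _ (by positivity),
          ENNReal.mul_rpow_of_nonneg _ _ (by positivity),
          ← ENNReal.rpow_mul, ← ENNReal.rpow_mul, mul_one_div_cancel hpos.ne', ENNReal.rpow_one,
          ENNReal.rpow_one]
        have hM : (M : ℝ≥0∞) ^ (1 - 1 / r.toReal) * (M : ℝ≥0∞) ^ (1 / r.toReal) = M := by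
          rw [← ENNReal.rpow_add_of_nonneg _ _ (by linarith) (by positivity)]
          simp
        calc _ = 2 * L * ((M : ℝ≥0∞) ^ (1 - 1 / r.toReal) * (M : ℝ≥0∞) ^ (1 / r.toReal)) *
              (∫⁻ x, ‖u₁ x - u₂ x‖ₑ ^ r.toReal ∂μ) ^ (1 / r.toReal) := by ring
          _ = _ := by rw [hM]

/-- The `L²` norm of the operator is controlled by the `L^q` norm of its argument if the
nonlinearity grows at most like `|s|^{q/2}`. -/
theorem eLpNorm_two_nonlocalOp_le (hK : SymmKernel μ K M) {P : ℝ≥0∞} (hP : 1 ≤ P) (hP' : P ≠ ⊤)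
    (hu : AEStronglyMeasurable u μ) {R : ℝ≥0∞} (hR : eLpNorm u P μ ≤ R) (hθ : Measurable θ)
    (hg : ∀ s, |θ s| ≤ 1 + |s| ^ (P.toReal / 2)) :
    eLpNorm (nonlocalOp μ K θ u) 2 μ ≤
      M * (2 * (μ univ + 2 ^ P.toReal * R ^ P.toReal)) ^ (1 / 2 : ℝ) := by
  refine (hK.eLpNorm_integral_le (G := fun z => θ (u z.2 - u z.1)) one_le_two (by simp)
    (aestronglyMeasurable_diff hu hθ)).trans ?_
  simp only [ENNReal.toReal_ofNat]
  have hle : ∫⁻ z, ‖K z.1 z.2‖ₑ * ‖θ (u z.2 - u z.1)‖ₑ ^ (2:ℝ) ∂(μ.prod μ) ≤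
      M * (2 * (μ univ + 2 ^ P.toReal * R ^ P.toReal)) := by
    calc ∫⁻ z, ‖K z.1 z.2‖ₑ * ‖θ (u z.2 - u z.1)‖ₑ ^ (2:ℝ) ∂(μ.prod μ)
        ≤ ∫⁻ z, 2 * (‖K z.1 z.2‖ₑ * (1 + ‖u z.2 - u z.1‖ₑ ^ P.toReal)) ∂(μ.prod μ) := by
          refine lintegral_mono fun z => ?_
          rw [mul_left_comm]
          gcongr
          -- Squaring turns growth of order `P/2` into growth of order `P`: this is where the half
          -- exponent pays off.
          have h1 : |θ (u z.2 - u z.1) ^ 2| ≤ 2 * (1 + |u z.2 - u z.1| ^ P.toReal) := by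
            have h2 := hg (u z.2 - u z.1)
            have h3 : (|u z.2 - u z.1| ^ (P.toReal / 2)) ^ 2 = |u z.2 - u z.1| ^ P.toReal := by
              rw [← Real.rpow_natCast, ← Real.rpow_mul (abs_nonneg _)]
              norm_num
            rw [abs_pow]
            calc |θ (u z.2 - u z.1)| ^ 2 ≤ (1 + |u z.2 - u z.1| ^ (P.toReal / 2)) ^ 2 := by gcongr
              _ ≤ _ := by
                rw [← h3]; nlinarith [sq_nonneg (1 - |u z.2 - u z.1| ^ (P.toReal / 2))]
          have h4 := enorm_le_of_growth (by positivity) h1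
          rw [enorm_pow] at h4
          simpa using h4
      _ ≤ 2 * (M * (μ univ + 2 ^ P.toReal * ∫⁻ x, ‖u x‖ₑ ^ P.toReal ∂μ)) := by
          rw [lintegral_const_mul' _ _ (by simp)]
          gcongr
          exact hK.lintegral_growth_le hP hu
      _ ≤ 2 * (M * (μ univ + 2 ^ P.toReal * R ^ P.toReal)) := by
          gcongr
          exact lintegral_enorm_rpow_le hP hP' hR
      _ = _ := by ring
  calc (M : ℝ≥0∞) ^ (1 - 1 / (2:ℝ)) * (∫⁻ z, ‖K z.1 z.2‖ₑ * ‖θ (u z.2 - u z.1)‖ₑ ^ (2:ℝ)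
        ∂(μ.prod μ)) ^ (1 / (2:ℝ))
      ≤ (M : ℝ≥0∞) ^ (1 - 1 / (2:ℝ)) * (M * (2 * (μ univ + 2 ^ P.toReal * R ^ P.toReal))) ^
          (1 / (2:ℝ)) := by gcongr
    _ = _ := by
        rw [ENNReal.mul_rpow_of_nonneg _ _ (by positivity), ← mul_assoc,
          ← ENNReal.rpow_add_of_nonneg _ _ (by norm_num) (by norm_num)]
        norm_num

theorem eLpNorm_one_nonlocalOp_sub_le (hK : SymmKernel μ K M) {P : ℝ≥0∞} (hP : 1 ≤ P)
    (hP' : P ≠ ⊤) (hu : MemLp u P μ) {R : ℝ≥0∞} (hR : eLpNorm u P μ ≤ R) {θ' : ℝ → ℝ}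
    (hθ : Measurable θ) (hθ' : Measurable θ') {c : ℝ} (hg : ∀ s, |θ s| ≤ c * (1 + |s| ^ P.toReal))
    (hg' : ∀ s, |θ' s| ≤ c * (1 + |s| ^ P.toReal)) {ε : ℝ}
    (hε : ∀ s, |θ s - θ' s| ≤ ε * (1 + |s| ^ P.toReal)) :
    eLpNorm (fun x => nonlocalOp μ K θ u x - nonlocalOp μ K θ' u x) 1 μ ≤
      ENNReal.ofReal ε * (M * (μ univ + 2 ^ P.toReal * R ^ P.toReal)) := by
  have h₁ := hK.integrable_of_growth hP hP' hu hθ hg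
  have h₂ := hK.integrable_of_growth hP hP' hu hθ' hg'
  have hae : (fun x => nonlocalOp μ K θ u x - nonlocalOp μ K θ' u x) =ᵐ[μ]
      fun x => ∫ y, K x y * (θ (u y - u x) - θ' (u y - u x)) ∂μ := by
    filter_upwards [h₁.prod_right_ae, h₂.prod_right_ae] with x hx₁ hx₂
    simp only [nonlocalOp, mul_sub]
    rw [integral_sub hx₁ hx₂]
  rw [eLpNorm_congr_ae hae]
  refine (hK.eLpNorm_integral_le (G := fun z => θ (u z.2 - u z.1) - θ' (u z.2 - u z.1)) le_rfl
    (by simp) ((aestronglyMeasurable_diff hu.1 hθ).sub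
      (aestronglyMeasurable_diff hu.1 hθ'))).trans ?_
  simp only [ENNReal.toReal_one, div_one, sub_self, ENNReal.rpow_zero, one_mul, ENNReal.rpow_one]
  calc ∫⁻ z, ‖K z.1 z.2‖ₑ * ‖θ (u z.2 - u z.1) - θ' (u z.2 - u z.1)‖ₑ ∂(μ.prod μ)
      ≤ ∫⁻ z, ENNReal.ofReal ε * (‖K z.1 z.2‖ₑ * (1 + ‖u z.2 - u z.1‖ₑ ^ P.toReal))
          ∂(μ.prod μ) := by
        refine lintegral_mono fun z => ?_
        rw [mul_left_comm]
        gcongr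
        exact enorm_le_of_growth (by positivity) (hε _)
    _ ≤ _ := by
        rw [lintegral_const_mul' _ _ (by simp)]
        gcongr
        refine (hK.lintegral_growth_le hP hu.1).trans ?_
        gcongr
        exact lintegral_enorm_rpow_le hP hP' hR

/-- The operator with Lipschitz nonlinearity is dissipative in `L^r`. -/
theorem eLpNorm_sub_le_of_lipschitz (hK : SymmKernel μ K M) (hK0 : ∀ x y, 0 ≤ K x y)
    (hθ : Monotone θ) (hodd : ∀ s, θ (-s) = -θ s) {L : NNReal} (hL : LipschitzWith L θ)
    {r : ℝ≥0∞} (hr : 1 ≤ r) (hr' : r ≠ ⊤) (hu₁ : MemLp u₁ r μ) (hu₂ : MemLp u₂ r μ) {δ : ℝ}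
    (hδ : 0 ≤ δ) :
    eLpNorm (fun x => u₁ x - u₂ x) r μ ≤ eLpNorm (fun x => (u₁ x - u₂ x) -
      δ * (nonlocalOp μ K θ u₁ x - nonlocalOp μ K θ u₂ x)) r μ := by
  have h1 : 1 ≤ r.toReal := by simpa using ENNReal.toReal_mono hr' hr
  have h0 := zero_of_odd hodd
  have hm := hL.continuous.measurable
  have hw := hu₁.sub hu₂
  refine eLpNorm_le_eLpNorm_sub_of_integral_nonpos hr hr' hw
    ((hK.memLp_nonlocalOp hr hr' hu₁ hL h0).sub (hK.memLp_nonlocalOp hr hr' hu₂ hL h0)) ?_ hδ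
  have hae := nonlocalOp_sub_ae_eq
    (hK.integrable_of_growth hr hr' hu₁ hm (growth_of_lipschitz hL h0 h1))
    (hK.integrable_of_growth hr hr' hu₂ hm (growth_of_lipschitz hL h0 h1))
  refine le_trans (le_of_eq ?_)
    (hK.integral_mul_nonpos hK0 hθ hodd (monotone_powSign h1) (u₁ := u₁) (u₂ := u₂) ?_)
  · refine integral_congr_ae ?_
    filter_upwards [hae] with x hx
    simp only [Pi.sub_apply]
    rw [hx]
  · have hG := (aestronglyMeasurable_diff hu₁.1 hm).sub (aestronglyMeasurable_diff hu₂.1 hm)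
    refine ⟨(hK.aestronglyMeasurable_mul hG).mul ((monotone_powSign h1).measurable.comp_aemeasurable
      (hw.1.comp_fst).aemeasurable).aestronglyMeasurable, ?_⟩
    have hfin := (lintegral_rpow_enorm_lt_top_of_eLpNorm_lt_top (by positivity) hr' hw.2).ne
    calc ∫⁻ z, ‖K z.1 z.2 * (θ (u₁ z.2 - u₁ z.1) - θ (u₂ z.2 - u₂ z.1)) *
          powSign r.toReal (u₁ z.1 - u₂ z.1)‖ₑ ∂(μ.prod μ)
        ≤ ∫⁻ z, (L * ENNReal.ofReal r.toReal * (‖K z.1 z.2‖ₑ * ‖(u₁ - u₂) z.1‖ₑ ^ r.toReal) +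
            L * (‖K z.1 z.2‖ₑ * ‖(u₁ - u₂) z.2 - (u₁ - u₂) z.1‖ₑ ^ r.toReal)) ∂(μ.prod μ) := by
          refine lintegral_mono fun z => ?_
          rw [enorm_mul, enorm_mul]
          have e1 := enorm_sub_le_of_lipschitz hL (u₁ z.2 - u₁ z.1) (u₂ z.2 - u₂ z.1)
          have e0 : u₁ z.2 - u₁ z.1 - (u₂ z.2 - u₂ z.1) = (u₁ - u₂) z.2 - (u₁ - u₂) z.1 := by
            simp only [Pi.sub_apply]; ring
          rw [e0] at e1
          -- Young's inequality separates the product into an `r`-th power at one point and an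
          -- `r`-th power of a difference, both integrable against the kernel.
          have e2 : ‖(u₁ - u₂) z.2 - (u₁ - u₂) z.1‖ₑ * ‖powSign r.toReal (u₁ z.1 - u₂ z.1)‖ₑ ≤
              ENNReal.ofReal r.toReal * ‖(u₁ - u₂) z.1‖ₑ ^ r.toReal +
                ‖(u₁ - u₂) z.2 - (u₁ - u₂) z.1‖ₑ ^ r.toReal := by
            simp only [Real.enorm_eq_ofReal_abs]
            rw [ENNReal.ofReal_rpow_of_nonneg (abs_nonneg _) (by positivity),
              ENNReal.ofReal_rpow_of_nonneg (abs_nonneg _) (by positivity),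
              ← ENNReal.ofReal_mul (abs_nonneg _), ← ENNReal.ofReal_mul (by positivity),
              ← ENNReal.ofReal_add (by positivity) (by positivity)]
            apply ENNReal.ofReal_le_ofReal
            set a := (u₁ - u₂) z.2 - (u₁ - u₂) z.1
            set b := (u₁ - u₂) z.1 with hb
            have e3 := abs_powSign_le r.toReal b
            have e4 := mul_rpow_sub_one_le h1 (abs_nonneg b) (abs_nonneg a)
            have e5 : |a| * |powSign r.toReal b| ≤ |b| ^ (r.toReal - 1) * |a| := by
              rw [mul_comm]; gcongr
            have e6 : |b| ^ (r.toReal - 1) * |a| ≤ r.toReal * (|b| ^ (r.toReal - 1) * |a|) :=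
              le_mul_of_one_le_left (by positivity) h1
            have e7 : (0:ℝ) ≤ |b| ^ r.toReal := by positivity
            have e8 : u₁ z.1 - u₂ z.1 = b := rfl
            rw [e8]
            linarith
          calc ‖K z.1 z.2‖ₑ * ‖θ (u₁ z.2 - u₁ z.1) - θ (u₂ z.2 - u₂ z.1)‖ₑ *
                ‖powSign r.toReal (u₁ z.1 - u₂ z.1)‖ₑ
              ≤ ‖K z.1 z.2‖ₑ * (L * ‖(u₁ - u₂) z.2 - (u₁ - u₂) z.1‖ₑ) *
                ‖powSign r.toReal (u₁ z.1 - u₂ z.1)‖ₑ := by gcongr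
            _ = L * ‖K z.1 z.2‖ₑ * (‖(u₁ - u₂) z.2 - (u₁ - u₂) z.1‖ₑ *
                ‖powSign r.toReal (u₁ z.1 - u₂ z.1)‖ₑ) := by ring
            _ ≤ L * ‖K z.1 z.2‖ₑ * (ENNReal.ofReal r.toReal * ‖(u₁ - u₂) z.1‖ₑ ^ r.toReal +
                ‖(u₁ - u₂) z.2 - (u₁ - u₂) z.1‖ₑ ^ r.toReal) := by gcongr
            _ = _ := by ring
      _ < ⊤ := by
          have m1 := hK.aemeasurable_enorm_mul ((hw.1.enorm.pow_const r.toReal).comp_fst)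
          rw [lintegral_add_left' (m1.const_mul _), lintegral_const_mul' _ _ (by finiteness),
            lintegral_const_mul' _ _ (by finiteness)]
          have f1 := ((hK.lintegral_fst_le (hw.1.enorm.pow_const r.toReal)).trans_lt
            (by finiteness)).ne
          have f2 := ((hK.lintegral_diff_le hr hw.1).trans_lt (by finiteness)).ne
          finiteness

/-- The operator is dissipative in `L¹` on its natural domain. -/
theorem eLpNorm_one_sub_le (hK : SymmKernel μ K M) (hK0 : ∀ x y, 0 ≤ K x y)
    (hθ : Monotone θ) (hodd : ∀ s, θ (-s) = -θ s) (hu₁ : MemLp u₁ 1 μ) (hu₂ : MemLp u₂ 1 μ)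
    (h₁ : Integrable (fun z : α × α => K z.1 z.2 * θ (u₁ z.2 - u₁ z.1)) (μ.prod μ))
    (h₂ : Integrable (fun z : α × α => K z.1 z.2 * θ (u₂ z.2 - u₂ z.1)) (μ.prod μ)) {δ : ℝ}
    (hδ : 0 ≤ δ) :
    eLpNorm (fun x => u₁ x - u₂ x) 1 μ ≤ eLpNorm (fun x => (u₁ x - u₂ x) -
      δ * (nonlocalOp μ K θ u₁ x - nonlocalOp μ K θ u₂ x)) 1 μ := by
  have hw := hu₁.sub hu₂
  refine eLpNorm_le_eLpNorm_sub_of_integral_nonpos le_rfl (by simp) hw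
    ((memLp_one_iff_integrable.2 h₁.integral_prod_left).sub
      (memLp_one_iff_integrable.2 h₂.integral_prod_left)) ?_ hδ
  have hσ : Monotone (powSign (1 : ℝ≥0∞).toReal) := monotone_powSign (by simp)
  refine le_trans (le_of_eq ?_)
    (hK.integral_mul_nonpos hK0 hθ hodd hσ (u₁ := u₁) (u₂ := u₂) ?_)
  · refine integral_congr_ae ?_
    filter_upwards [nonlocalOp_sub_ae_eq h₁ h₂] with x hx
    simp only [Pi.sub_apply]
    rw [← hx]
    rfl
  -- For `r = 1` the multiplier is a sign, bounded by `1`, so integrability on the natural domain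
  -- suffices and no growth or Lipschitz condition is needed.
  · have := (h₁.sub h₂).mul_bdd (g := fun z : α × α => powSign (1 : ℝ≥0∞).toReal
      (u₁ z.1 - u₂ z.1)) (c := 1) (hσ.measurable.comp_aemeasurable
      (hw.1.comp_fst).aemeasurable).aestronglyMeasurable (ae_of_all _ fun z => by
        refine (abs_powSign_le _ _).trans ?_
        simp)
    refine this.congr (ae_of_all _ fun z => ?_)
    simp only [Pi.sub_apply]
    ring

end SymmKernel

end Dissipative

/-! ### Lipschitz monotone approximation of the power nonlinearity -/

section Nonlinearity

/-- The odd extension of a function on `[0,∞)`. -/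
def oddExt (h : ℝ → ℝ) (r : ℝ) : ℝ := if 0 ≤ r then h r else -h (-r)

variable {h h' : ℝ → ℝ}

theorem oddExt_neg (h0 : h 0 = 0) (r : ℝ) : oddExt h (-r) = -oddExt h r := by
  rcases lt_trichotomy r 0 with hr | rfl | hr
  · simp [oddExt, hr.le, hr.not_ge]
  · simp [oddExt, h0]
  · simp [oddExt, hr.le, hr.not_ge]

theorem abs_oddExt_sub (r : ℝ) : |oddExt h r - oddExt h' r| = |h (|r|) - h' (|r|)| := by
  rcases le_or_gt 0 r with hr | hr
  · simp [oddExt, hr, abs_of_nonneg hr]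
  · simp only [oddExt, hr.not_ge, if_false, abs_of_neg hr]
    rw [← abs_neg]; congr 1; ring

theorem abs_oddExt (r : ℝ) : |oddExt h r| = |h (|r|)| := by
  rcases le_or_gt 0 r with hr | hr
  · simp [oddExt, hr, abs_of_nonneg hr]
  · simp [oddExt, hr.not_ge, abs_of_neg hr]

theorem monotone_oddExt (h0 : h 0 = 0) (hm : MonotoneOn h (Ici 0)) : Monotone (oddExt h) := by
  have hnn : ∀ x, 0 ≤ x → 0 ≤ h x := fun x hx => h0 ▸ hm (mem_Ici.2 le_rfl) hx hx
  intro a b hab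
  simp only [oddExt]
  split_ifs with ha hb hb
  · exact hm ha hb hab
  · exact absurd (ha.trans hab) hb
  · have := hnn (-a) (by linarith [not_le.1 ha]); have := hnn b hb; linarith
  · exact neg_le_neg (hm (by simp; linarith [not_le.1 hb]) (by simp; linarith [not_le.1 ha])
      (neg_le_neg hab))

theorem lipschitzWith_oddExt (h0 : h 0 = 0) (hm : MonotoneOn h (Ici 0)) {L : NNReal}
    (hL : ∀ a b, 0 ≤ a → a ≤ b → h b - h a ≤ L * (b - a)) : LipschitzWith L (oddExt h) := by
  have hmono := monotone_oddExt h0 hm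
  have key : ∀ a b, a ≤ b → oddExt h b - oddExt h a ≤ L * (b - a) := by
    intro a b hab
    simp only [oddExt]
    split_ifs with hb ha ha
    · exact hL a b ha hab
    · have h1 := hL 0 b le_rfl hb
      have h2 := hL 0 (-a) le_rfl (by linarith)
      rw [h0] at h1 h2
      linarith
    · exact absurd (ha.trans hab) hb
    · have := hL (-b) (-a) (by linarith) (by linarith)
      linarith
  refine LipschitzWith.of_dist_le_mul fun a b => ?_
  rcases le_total a b with hab | hab
  · rw [dist_comm, dist_comm a, Real.dist_eq, Real.dist_eq, abs_of_nonneg (sub_nonneg.2 (hmono hab)),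
      abs_of_nonneg (sub_nonneg.2 hab)]
    exact key a b hab
  · rw [Real.dist_eq, Real.dist_eq, abs_of_nonneg (sub_nonneg.2 (hmono hab)),
      abs_of_nonneg (sub_nonneg.2 hab)]
    exact key b a hab

variable {p : ℝ}

theorem psi_eq_oddExt (hp : 1 < p) : psi p = oddExt fun x => x ^ (p - 1) := by
  funext r
  rcases lt_trichotomy r 0 with hr | rfl | hr
  · simp only [psi, oddExt, hr.not_ge, if_false, abs_of_neg hr]
    rw [show p - 1 = (p - 2) + 1 by ring, Real.rpow_add_one (by linarith : -r ≠ 0)]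
    ring
  · simp [psi, oddExt, Real.zero_rpow (by linarith : p - 1 ≠ 0)]
  · simp only [psi, oddExt, hr.le, if_true, abs_of_pos hr]
    rw [show p - 1 = (p - 2) + 1 by ring, Real.rpow_add_one hr.ne']

theorem monotone_psi (hp : 1 < p) : Monotone (psi p) := by
  rw [psi_eq_oddExt hp]
  exact monotone_oddExt (Real.zero_rpow (by linarith))
    fun a ha b _ hab => Real.rpow_le_rpow ha hab (by linarith)

theorem psi_neg (p r : ℝ) : psi p (-r) = -psi p r := by simp [psi]

theorem abs_psi (hp : 1 < p) (r : ℝ) : |psi p r| = |r| ^ (p - 1) := by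
  rw [psi_eq_oddExt hp, abs_oddExt, abs_of_nonneg (by positivity)]

theorem rpow_le_one_add_rpow {a b x : ℝ} (hx : 0 ≤ x) (ha : 0 ≤ a) (hab : a ≤ b) :
    x ^ a ≤ 1 + x ^ b := by
  rcases le_total x 1 with h1 | h1
  · have := Real.rpow_le_one hx h1 ha
    have : 0 ≤ x ^ b := by positivity
    linarith
  · have := Real.rpow_le_rpow_of_exponent_le h1 hab
    linarith

/-- The obstruction to Lipschitz continuity lies at the origin for `p < 2` and is removed by a
shift; for `p > 2` it lies at infinity and is removed by truncation. Both changes keep oddness and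
monotonicity and do not increase `|Ψ|`. -/
theorem exists_lipschitz_approx_psi (hp : 1 < p) {ε : ℝ} (hε : 0 < ε) :
    ∃ θ : ℝ → ℝ, (∃ L : NNReal, LipschitzWith L θ) ∧ Monotone θ ∧ (∀ s, θ (-s) = -θ s) ∧
      (∀ s, |θ s| ≤ |psi p s|) ∧ ∀ s, |θ s - psi p s| ≤ ε * (1 + |s| ^ max 2 (2 * (p - 1))) := by
  have hs : 0 < p - 1 := by linarith
  have hψ := psi_eq_oddExt hp
  obtain ⟨s, hsdef⟩ : ∃ s, s = p - 1 := ⟨_, rfl⟩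
  rw [← hsdef] at hs hψ ⊢
  rcases lt_or_ge p 2 with hp2 | hp2
  -- With `δ^s = ε`, subadditivity of `x^s` for `s ≤ 1` places `(x + δ)^s - δ^s` between `x^s - ε`
  -- and `x^s`.
  · set δ : ℝ := ε ^ (1 / s) with hδ
    have hδ0 : 0 < δ := by positivity
    have hδs : δ ^ s = ε := by rw [hδ, ← Real.rpow_mul hε.le, one_div_mul_cancel hs.ne', Real.rpow_one]
    set h : ℝ → ℝ := fun x => (x + δ) ^ s - δ ^ s with hh
    have h0 : h 0 = 0 := by simp [hh]
    have hm : MonotoneOn h (Ici 0) := fun a (ha : 0 ≤ a) b _ hab => by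
      simp only [hh]
      gcongr
    refine ⟨oddExt h, ⟨⟨s * δ ^ (s - 1), by positivity⟩, lipschitzWith_oddExt h0 hm ?_⟩,
      monotone_oddExt h0 hm, oddExt_neg h0, fun x => ?_, fun x => ?_⟩
    · intro a b ha hab
      simp only [hh]
      change _ ≤ s * δ ^ (s - 1) * (b - a)
      have ha' : 0 < a + δ := by linarith
      -- Bernoulli's inequality for an exponent in `[0,1]` bounds the increment by the slope at `a +
      -- δ`, which is at most the slope at `δ`.
      have h1 := rpow_one_add_le_one_add_mul_self (s := (b - a) / (a + δ)) (p := s)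
        (by have : 0 ≤ (b - a) / (a + δ) := div_nonneg (by linarith) ha'.le
            linarith) hs.le (by linarith)
      have h2 : (a + δ) ^ s * (1 + (b - a) / (a + δ)) ^ s = (b + δ) ^ s := by
        rw [← Real.mul_rpow ha'.le (by
          have : 0 ≤ (b - a) / (a + δ) := div_nonneg (by linarith) ha'.le
          linarith)]
        congr 1
        field_simp
        ring
      have h3 : (a + δ) ^ s * (s * ((b - a) / (a + δ))) = s * (a + δ) ^ (s - 1) * (b - a) := by
        rw [Real.rpow_sub_one ha'.ne']; field_simp
      have h4 : (a + δ) ^ (s - 1) ≤ δ ^ (s - 1) :=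
        Real.rpow_le_rpow_of_nonpos hδ0 (by linarith) (by linarith)
      have h5 : s * (a + δ) ^ (s - 1) * (b - a) ≤ s * δ ^ (s - 1) * (b - a) := by
        have : 0 ≤ b - a := by linarith
        gcongr
      have h6 := mul_le_mul_of_nonneg_left h1 (by positivity : 0 ≤ (a + δ) ^ s)
      rw [h2, mul_add, mul_one, h3] at h6
      linarith
    · rw [hψ, abs_oddExt, abs_oddExt]
      have hx := abs_nonneg x
      have h1 : 0 ≤ h (|x|) := h0 ▸ hm (mem_Ici.2 le_rfl) hx hx
      rw [abs_of_nonneg h1, abs_of_nonneg (Real.rpow_nonneg hx s)]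
      have := Real.rpow_add_le_add_rpow hx hδ0.le hs.le (by linarith : s ≤ 1)
      simp only [hh]
      linarith
    · rw [hψ, abs_oddExt_sub]
      have hx := abs_nonneg x
      have h1 := Real.rpow_add_le_add_rpow hx hδ0.le hs.le (by linarith : s ≤ 1)
      have h2 : |x| ^ s ≤ (|x| + δ) ^ s := by gcongr; linarith
      have h3 : |h (|x|) - |x| ^ s| ≤ ε := by
        simp only [hh, ← hδs]
        rw [abs_le]; constructor <;> linarith
      refine h3.trans (le_mul_of_one_le_right hε.le ?_)
      have : 0 ≤ |x| ^ max 2 (2 * s) := by positivity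
      linarith
  · have hmax : max 2 (2 * s) = 2 * s := max_eq_right (by linarith)
    -- Truncation at the level where `k^s = 1/ε`: beyond it `ε |x|^s ≥ 1`, so the error is at most
    -- `|x|^s ≤ ε |x|^(2s)`.
    set k : ℝ := ε⁻¹ ^ (1 / s) with hk
    have hk0 : 0 < k := by positivity
    have hks : k ^ s = ε⁻¹ := by
      rw [hk, ← Real.rpow_mul (by positivity), one_div_mul_cancel hs.ne', Real.rpow_one]
    set h : ℝ → ℝ := fun x => (min x k) ^ s with hh
    have h0 : h 0 = 0 := by simp [hh, min_eq_left hk0.le, Real.zero_rpow hs.ne']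
    have hm : MonotoneOn h (Ici 0) := fun a (ha : 0 ≤ a) b _ hab => by
      simp only [hh]
      have : 0 ≤ min a k := le_min ha hk0.le
      gcongr
    refine ⟨oddExt h, ⟨⟨s * k ^ (s - 1), by positivity⟩, lipschitzWith_oddExt h0 hm ?_⟩,
      monotone_oddExt h0 hm, oddExt_neg h0, fun x => ?_, fun x => ?_⟩
    · intro a b ha hab
      simp only [hh]
      change _ ≤ s * k ^ (s - 1) * (b - a)
      have hx : 0 ≤ min a k := le_min ha hk0.le
      have hxy : min a k ≤ min b k := by gcongr
      -- The tangent inequality at the larger point bounds the increment of the convex power by its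
      -- slope there.
      have h1 := abs_rpow_add_le (by linarith : 1 ≤ s) (min b k) (min a k)
      rw [abs_of_nonneg hx, abs_of_nonneg (hx.trans hxy)] at h1
      have h2 : powSign s (min b k) ≤ k ^ (s - 1) := by
        refine (le_abs_self _).trans ((abs_powSign_le _ _).trans ?_)
        rw [abs_of_nonneg (hx.trans hxy)]
        exact Real.rpow_le_rpow (hx.trans hxy) (min_le_right _ _) (by linarith)
      have h3 : min b k - min a k ≤ b - a := by
        rcases le_total a k with h | h
        · rw [min_eq_left h]; linarith [min_le_left b k]
        · rw [min_eq_right h]; linarith [min_le_right b k]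
      have h4 : s * (powSign s (min b k) * (min b k - min a k)) ≤
          s * (k ^ (s - 1) * (b - a)) := by
        have : 0 ≤ min b k - min a k := by linarith
        gcongr
      linarith
    · rw [hψ, abs_oddExt, abs_oddExt]
      have hx : 0 ≤ min |x| k := le_min (abs_nonneg x) hk0.le
      rw [abs_of_nonneg (Real.rpow_nonneg hx s), abs_of_nonneg (Real.rpow_nonneg (abs_nonneg x) s)]
      exact Real.rpow_le_rpow hx (min_le_left _ _) hs.le
    · rw [hψ, abs_oddExt_sub, hmax]
      have hx := abs_nonneg x
      have hpos : 0 ≤ ε * (1 + |x| ^ (2 * s)) := by positivity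
      simp only [hh]
      rcases le_total |x| k with h | h
      · rw [min_eq_left h]; simpa using hpos
      · rw [min_eq_right h]
        have h1 : k ^ s ≤ |x| ^ s := by gcongr
        have h2 : |x| ^ (2 * s) = |x| ^ s * |x| ^ s := by
          rw [two_mul, Real.rpow_add (hk0.trans_le h)]
        have h3 : 0 ≤ k ^ s := by positivity
        have h4 : |x| ^ s ≤ ε * (|x| ^ s * |x| ^ s) := by
          rw [hks] at h1
          have : 1 ≤ ε * |x| ^ s := by
            rw [inv_le_iff_one_le_mul₀ hε] at h1; linarith
          have h5 : 0 ≤ |x| ^ s := by positivity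
          nlinarith
        rw [abs_sub_comm, abs_of_nonneg (by linarith), h2]
        linarith

end Nonlinearity

/-! ### Functions of time with values in Lebesgue spaces -/

section LpValued

set_option linter.unusedSectionVars false

/-- In a second countable space every open set is a countable union of balls, whose preimages are
described by distances alone. -/
theorem measurable_of_measurable_dist {β X : Type*} [MeasurableSpace β] [PseudoMetricSpace X]
    [SecondCountableTopology X] [MeasurableSpace X] [BorelSpace X] {F : β → X}
    (h : ∀ c, Measurable fun t => dist (F t) c) : Measurable F := by
  refine measurable_of_isOpen fun O hO => ?_
  have hx : ∀ x : O, ∃ ε > 0, Metric.ball x.1 ε ⊆ O := fun x => Metric.isOpen_iff.1 hO x x.2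
  choose ε hε hεO using hx
  obtain ⟨S, hS, hSO⟩ := TopologicalSpace.isOpen_iUnion_countable
    (fun x : O => Metric.ball x.1 (ε x)) fun x => Metric.isOpen_ball
  have hO' : O = ⋃ x ∈ S, Metric.ball x.1 (ε x) := by
    rw [hSO]
    refine Subset.antisymm (fun x hx => ?_) (iUnion_subset hεO)
    exact mem_iUnion.2 ⟨⟨x, hx⟩, Metric.mem_ball_self (hε _)⟩
  rw [hO', preimage_iUnion₂]
  exact MeasurableSet.biUnion hS fun x _ => measurableSet_lt (h x.1) measurable_const

variable {α : Type*} [MeasurableSpace α] {μ : Measure α} [IsFiniteMeasure μ]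

/-- The inclusion `L^P → L^r` for `r ≤ P`. -/
def lpIncl (μ : Measure α) [IsFiniteMeasure μ] {P r : ℝ≥0∞} [Fact (1 ≤ P)] [Fact (1 ≤ r)]
    (h : r ≤ P) : Lp ℝ P μ →L[ℝ] Lp ℝ r μ :=
  LinearMap.mkContinuous
    { toFun := fun u => ((Lp.memLp u).mono_exponent h).toLp u
      map_add' := fun u v => by
        rw [← MemLp.toLp_add, MemLp.toLp_eq_toLp_iff]
        exact Lp.coeFn_add u v
      map_smul' := fun c u => by
        rw [RingHom.id_apply, ← MemLp.toLp_const_smul, MemLp.toLp_eq_toLp_iff]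
        exact Lp.coeFn_smul c u }
    (μ univ ^ (1 / r.toReal - 1 / P.toReal)).toReal fun u => by
      simp only [LinearMap.coe_mk, AddHom.coe_mk, Lp.norm_toLp]
      rw [Lp.norm_def, mul_comm, ← ENNReal.toReal_mul]
      have hr : (0:ℝ) ≤ 1 / r.toReal - 1 / P.toReal := by
        rcases eq_or_ne P ⊤ with rfl | hP
        · simp
        · have hr0 : 0 < r.toReal :=
            ENNReal.toReal_pos (zero_lt_one.trans_le Fact.out).ne' (ne_top_of_le_ne_top hP h)
          have := ENNReal.toReal_mono hP h
          exact sub_nonneg.2 (one_div_le_one_div_of_le hr0 this)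
      refine ENNReal.toReal_mono (ENNReal.mul_ne_top (Lp.eLpNorm_ne_top u)
        (ENNReal.rpow_ne_top_of_nonneg hr (by simp))) ?_
      exact eLpNorm_le_eLpNorm_mul_rpow_measure_univ h (Lp.aestronglyMeasurable u)

variable {P r : ℝ≥0∞} [Fact (1 ≤ P)] [Fact (1 ≤ r)]

theorem coeFn_lpIncl (h : r ≤ P) (u : Lp ℝ P μ) : lpIncl μ h u =ᵐ[μ] u :=
  MemLp.coeFn_toLp ((Lp.memLp u).mono_exponent h)

theorem norm_sub_eq_toReal (u v : Lp ℝ P μ) :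
    ‖u - v‖ = (eLpNorm (fun x => u x - v x) P μ).toReal := by
  rw [Lp.norm_def, eLpNorm_congr_ae (Lp.coeFn_sub u v)]
  rfl

theorem eLpNorm_sub_eq_ofReal (u v : Lp ℝ P μ) :
    eLpNorm (fun x => u x - v x) P μ = ENNReal.ofReal ‖u - v‖ := by
  rw [norm_sub_eq_toReal, ENNReal.ofReal_toReal]
  exact ((Lp.memLp u).sub (Lp.memLp v)).2.ne

theorem eLpNorm_eq_ofReal (u : Lp ℝ P μ) : eLpNorm u P μ = ENNReal.ofReal ‖u‖ := by
  rw [Lp.norm_def, ENNReal.ofReal_toReal (Lp.eLpNorm_ne_top u)]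

theorem measurable_eLpNorm_section {f : ℝ × α → ℝ} (hf : Measurable f) (hP : 1 ≤ P) (hP' : P ≠ ⊤) :
    Measurable fun t => eLpNorm (fun x => f (t, x)) P μ := by
  have : (fun t => eLpNorm (fun x => f (t, x)) P μ) =
      fun t => (∫⁻ x, ‖f (t, x)‖ₑ ^ P.toReal ∂μ) ^ (1 / P.toReal) :=
    funext fun t => eLpNorm_eq_lintegral_rpow_enorm_toReal (by positivity) hP'
  rw [this]
  exact (Measurable.lintegral_prod_right' (f := fun z : ℝ × α => ‖f z‖ₑ ^ P.toReal)
    (hf.enorm.pow_const _)).pow_const _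

/-- A jointly measurable function in `L¹(0,T; L^P)` is Bochner integrable as an `L^P`-valued
function. -/
theorem exists_lpValued [MeasurableSpace.CountablyGenerated α] (hP' : P ≠ ⊤) {T : ℝ} (hT : 0 ≤ T)
    {f : ℝ → α → ℝ}
    (hf : AEStronglyMeasurable (Function.uncurry f) ((volume.restrict (Icc 0 T)).prod μ))
    (hfin : ∫⁻ t in Icc 0 T, eLpNorm (f t) P μ < ⊤) :
    ∃ F : ℝ → Lp ℝ P μ, IntervalIntegrable F volume 0 T ∧
      ∀ᵐ t ∂(volume.restrict (Icc 0 T)), F t =ᵐ[μ] f t := by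
  have hP : 1 ≤ P := Fact.out
  -- A finite exponent makes `L^P` separable, as required for measurability tested on distances.
  have : Fact (P ≠ ⊤) := ⟨hP'⟩
  borelize ↥(Lp ℝ P μ)
  obtain ⟨f', hf'm, hff'⟩ := hf
  have hsec : ∀ᵐ t ∂(volume.restrict (Icc 0 T)), f t =ᵐ[μ] fun x => f' (t, x) :=
    Measure.ae_ae_of_ae_prod hff'
  have hmeas : Measurable fun t => eLpNorm (fun x => f' (t, x)) P μ :=
    measurable_eLpNorm_section hf'm.measurable hP hP'
  have hfin' : ∫⁻ t in Icc 0 T, eLpNorm (fun x => f' (t, x)) P μ < ⊤ := by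
    rwa [← lintegral_congr_ae (hsec.mono fun t ht => eLpNorm_congr_ae ht)]
  have hmem : ∀ t, eLpNorm (fun x => f' (t, x)) P μ < ⊤ → MemLp (fun x => f' (t, x)) P μ :=
    fun t ht => ⟨(hf'm.comp_measurable measurable_prodMk_left).aestronglyMeasurable, ht⟩
  classical
  -- Slices of infinite norm form a measurable null set of times and are replaced by `0`, so that
  -- `F` is defined and measurable everywhere.
  let F : ℝ → Lp ℝ P μ := fun t =>
    if h : eLpNorm (fun x => f' (t, x)) P μ < ⊤ then (hmem t h).toLp else 0
  have hS : MeasurableSet {t | eLpNorm (fun x => f' (t, x)) P μ < ⊤} :=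
    measurableSet_lt hmeas measurable_const
  have hF : Measurable F := by
    refine measurable_of_measurable_dist fun c => ?_
    have hc : Measurable fun t => (eLpNorm (fun x => f' (t, x) - c x) P μ).toReal :=
      (measurable_eLpNorm_section (f := fun z => f' z - c z.2) (hf'm.measurable.sub
        ((Lp.stronglyMeasurable c).measurable.comp measurable_snd)) hP hP').ennreal_toReal
    suffices h : (fun t => dist (F t) c) = fun t =>
        if t ∈ {t | eLpNorm (fun x => f' (t, x)) P μ < ⊤} then
          (eLpNorm (fun x => f' (t, x) - c x) P μ).toReal else dist (0 : Lp ℝ P μ) c from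
      h ▸ Measurable.ite hS hc measurable_const
    funext t
    by_cases ht : eLpNorm (fun x => f' (t, x)) P μ < ⊤
    · simp only [F, dif_pos ht, mem_ofPred_eq, if_pos ht]
      rw [dist_eq_norm, norm_sub_eq_toReal]
      congr 1
      refine eLpNorm_congr_ae ?_
      filter_upwards [(hmem t ht).coeFn_toLp] with x hx
      rw [hx]
    · simp only [F, dif_neg ht, mem_ofPred_eq, if_neg ht]
  have hfinae := ae_lt_top hmeas hfin'.ne
  have hFae : ∀ᵐ t ∂(volume.restrict (Icc 0 T)), F t =ᵐ[μ] fun x => f' (t, x) := by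
    filter_upwards [hfinae] with t ht
    simp only [F, dif_pos ht]
    exact (hmem t ht).coeFn_toLp
  refine ⟨F, ?_, ?_⟩
  · rw [intervalIntegrable_iff_integrableOn_Ioc_of_le hT, ← integrableOn_Icc_iff_integrableOn_Ioc]
    refine ⟨hF.stronglyMeasurable.aestronglyMeasurable, ?_⟩
    refine lt_of_le_of_lt (le_of_eq (lintegral_congr_ae ?_)) hfin'
    filter_upwards [hFae] with t ht
    rw [Lp.enorm_def, eLpNorm_congr_ae ht]
  · filter_upwards [hFae, hsec] with t h1 h2
    exact h1.trans h2.symm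

end LpValued

/-! ### Perturbation estimates and the operator on Lebesgue spaces -/

section Approximation

set_option linter.unusedSectionVars false

/-- Here `w₂` solves the equation for `B` only up to the defect `B w₂ - G`; dissipativity is
required of `B` alone. The comparison is used with the zero solution in `L^P`, with another
nonlinearity in `L¹`, and with another kernel in `L²`. -/
theorem IsPrimitive.norm_sub_le_of_dissipative {X : Type*} [NormedAddCommGroup X] [NormedSpace ℝ X]
    [CompleteSpace X] {B : X → X}
    (hB : ∀ u v : X, ∀ δ : ℝ, 0 ≤ δ → ‖u - v‖ ≤ ‖(u - v) - δ • (B u - B v)‖) {T : ℝ}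
    {w₁ w₂ F₁ F₂ G : ℝ → X} (h₁ : IsPrimitive T w₁ fun t => B (w₁ t) + F₁ t)
    (h₂ : IsPrimitive T w₂ fun t => G t + F₂ t)
    (hF₁ : IntervalIntegrable F₁ volume 0 T) (hF₂ : IntervalIntegrable F₂ volume 0 T) {c : ℝ}
    (hc : ∀ t ∈ Icc 0 T, ‖B (w₂ t) - G t‖ ≤ c) {t : ℝ} (ht : t ∈ Icc 0 T) :
    ‖w₁ t - w₂ t‖ ≤ ‖w₁ 0 - w₂ 0‖ + (∫ s in (0)..t, ‖F₁ s - F₂ s‖) + c * t := by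
  have hT : 0 ≤ T := ht.1.trans ht.2
  have hF := (hF₁.sub hF₂).norm
  have key := (h₁.sub hT h₂).norm_le_of_dissipative (ρ := fun t => ‖F₁ t - F₂ t‖ + c)
    (hF.add intervalIntegrable_const) (ae_of_all _ fun s hs δ hδ => ?_) ht
  · have h0 : (0:ℝ) ∈ Icc 0 T := ⟨le_rfl, hT⟩
    rw [intervalIntegral.integral_add (intervalIntegrable_of_mem hF h0 ht)
      intervalIntegrable_const, intervalIntegral.integral_const, smul_eq_mul] at key
    simp only [Pi.sub_apply] at key
    linarith
  · have h1 := hB (w₁ s) (w₂ s) δ hδ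
    have h2 := hc s (Ioo_subset_Icc_self hs)
    simp only [Pi.sub_apply]
    have e : (w₁ s - w₂ s) - δ • (B (w₁ s) - B (w₂ s)) =
        ((w₁ s - w₂ s) - δ • (B (w₁ s) + F₁ s - (G s + F₂ s))) +
          (δ • (F₁ s - F₂ s) + δ • (B (w₂ s) - G s)) := by
      module
    rw [e] at h1
    refine h1.trans ((norm_add_le _ _).trans ?_)
    gcongr
    refine (norm_add_le _ _).trans ?_
    rw [norm_smul, norm_smul, Real.norm_of_nonneg hδ, mul_add]
    gcongr

variable {α : Type*} [MeasurableSpace α] {μ : Measure α} [IsFiniteMeasure μ]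
  {P r : ℝ≥0∞} [Fact (1 ≤ P)] [Fact (1 ≤ r)] {K : α → α → ℝ} {M : NNReal} {θ ψ : ℝ → ℝ}

theorem nonlocalOp_congr {u v : α → ℝ} (h : u =ᵐ[μ] v) :
    nonlocalOp μ K θ u =ᵐ[μ] nonlocalOp μ K θ v := by
  filter_upwards [h] with x hx
  refine integral_congr_ae ?_
  filter_upwards [h] with y hy
  rw [hx, hy]

theorem nonlocalOp_zero (h0 : θ 0 = 0) : nonlocalOp μ K θ 0 = 0 := by
  funext x
  simp [nonlocalOp, h0]

/-- The nonlocal operator on `L^r`. -/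
def opLp (μ : Measure α) [IsFiniteMeasure μ] {r : ℝ≥0∞} (K : α → α → ℝ) (θ : ℝ → ℝ)
    (u : Lp ℝ r μ) : Lp ℝ r μ := by
  classical
  exact if h : MemLp (nonlocalOp μ K θ u) r μ then h.toLp else 0

-- The default value `0` in `opLp` never matters where the operator maps into `L^r`.
theorem coeFn_opLp {u : Lp ℝ r μ} (h : MemLp (nonlocalOp μ K θ u) r μ) :
    opLp μ K θ u =ᵐ[μ] nonlocalOp μ K θ u := by
  rw [opLp, dif_pos h]
  exact h.coeFn_toLp

namespace SymmKernel

theorem coeFn_opLp_of_lipschitz (hK : SymmKernel μ K M) (hr' : r ≠ ⊤) {L : NNReal}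
    (hL : LipschitzWith L θ) (h0 : θ 0 = 0) (u : Lp ℝ r μ) :
    opLp μ K θ u =ᵐ[μ] nonlocalOp μ K θ u :=
  coeFn_opLp (hK.memLp_nonlocalOp Fact.out hr' (Lp.memLp u) hL h0)

/-- Lets one approximate solution, constructed in `L^P`, be read as a solution in `L²` and in `L¹`,
with the estimate proper to each space. -/
theorem lpIncl_opLp (hK : SymmKernel μ K M) (hP' : P ≠ ⊤) (h : r ≤ P) {L : NNReal}
    (hL : LipschitzWith L θ) (h0 : θ 0 = 0) (u : Lp ℝ P μ) :
    lpIncl μ h (opLp μ K θ u) = opLp μ K θ (lpIncl μ h u) := by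
  apply Lp.ext
  refine (coeFn_lpIncl h _).trans ((hK.coeFn_opLp_of_lipschitz hP' hL h0 u).trans ?_)
  refine EventuallyEq.trans ?_
    (hK.coeFn_opLp_of_lipschitz (ne_top_of_le_ne_top hP' h) hL h0 (lpIncl μ h u)).symm
  exact nonlocalOp_congr (coeFn_lpIncl h u).symm

theorem lipschitzWith_opLp (hK : SymmKernel μ K M) (hr' : r ≠ ⊤) {L : NNReal}
    (hL : LipschitzWith L θ) (h0 : θ 0 = 0) :
    LipschitzWith (2 * L * M) (opLp (r := r) μ K θ) := by
  refine LipschitzWith.of_dist_le_mul fun u v => ?_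
  have h := hK.eLpNorm_nonlocalOp_sub_le Fact.out hr' (Lp.memLp u) (Lp.memLp v) hL h0
  rw [dist_eq_norm, dist_eq_norm, ← ENNReal.ofReal_le_ofReal_iff (by positivity),
    ← eLpNorm_sub_eq_ofReal, ENNReal.ofReal_mul (by positivity), ← eLpNorm_sub_eq_ofReal]
  refine le_trans (le_of_eq (eLpNorm_congr_ae ?_)) (h.trans (le_of_eq ?_))
  · filter_upwards [hK.coeFn_opLp_of_lipschitz hr' hL h0 u,
      hK.coeFn_opLp_of_lipschitz hr' hL h0 v] with x hx hy
    rw [hx, hy]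
  · simp

theorem dissipative_opLp (hK : SymmKernel μ K M) (hK0 : ∀ x y, 0 ≤ K x y) (hr' : r ≠ ⊤)
    (hθ : Monotone θ) (hodd : ∀ s, θ (-s) = -θ s) {L : NNReal}
    (hL : LipschitzWith L θ) (u v : Lp ℝ r μ) (δ : ℝ) (hδ : 0 ≤ δ) :
    ‖u - v‖ ≤ ‖(u - v) - δ • (opLp μ K θ u - opLp μ K θ v)‖ := by
  have h0 := zero_of_odd hodd
  have h := hK.eLpNorm_sub_le_of_lipschitz hK0 hθ hodd hL Fact.out hr' (Lp.memLp u) (Lp.memLp v) hδ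
  rw [← ENNReal.ofReal_le_ofReal_iff (by positivity), ← eLpNorm_sub_eq_ofReal,
    ← eLpNorm_eq_ofReal]
  refine h.trans (le_of_eq (eLpNorm_congr_ae ?_))
  filter_upwards [hK.coeFn_opLp_of_lipschitz hr' hL h0 u, hK.coeFn_opLp_of_lipschitz hr' hL h0 v,
    Lp.coeFn_sub (u - v) (δ • (opLp μ K θ u - opLp μ K θ v)), Lp.coeFn_sub u v,
    Lp.coeFn_smul δ (opLp μ K θ u - opLp μ K θ v),
    Lp.coeFn_sub (opLp μ K θ u) (opLp μ K θ v)] with x h1 h2 h3 h4 h5 h6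
  rw [h3, Pi.sub_apply, h4, h5, Pi.sub_apply, Pi.smul_apply, h6, Pi.sub_apply, h1, h2, smul_eq_mul]

end SymmKernel

theorem opLp_zero (h0 : θ 0 = 0) : opLp μ K θ (0 : Lp ℝ r μ) = 0 := by
  have h : nonlocalOp μ K θ (0 : Lp ℝ r μ) =ᵐ[μ] 0 :=
    (nonlocalOp_congr (Lp.coeFn_zero ℝ r μ)).trans (by rw [nonlocalOp_zero h0])
  apply Lp.ext
  refine (coeFn_opLp ?_).trans (h.trans (Lp.coeFn_zero ℝ r μ).symm)
  exact (MemLp.zero' (ε := ℝ)).ae_eq h.symm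

/-- Lipschitz, monotone, odd nonlinearities of growth `q / 2` converging to `ψ`. -/
structure NonlinApprox (q : ℝ) (ψ : ℝ → ℝ) (θ : ℕ → ℝ → ℝ) : Prop where
  lipschitz : ∀ k, ∃ L : NNReal, LipschitzWith L (θ k)
  monotone : ∀ k, Monotone (θ k)
  odd : ∀ k s, θ k (-s) = -θ k s
  growth : ∀ k s, |θ k s| ≤ 1 + |s| ^ (q / 2)
  monotone_lim : Monotone ψ
  growth_lim : ∀ s, |ψ s| ≤ 1 + |s| ^ (q / 2)
  approx : ∀ k s, |θ k s - ψ s| ≤ 1 / (k + 1) * (1 + |s| ^ q)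

theorem le_two_mul_of_growth {q a s : ℝ} (hq : 0 ≤ q) (h : |a| ≤ 1 + |s| ^ (q / 2)) :
    |a| ≤ 2 * (1 + |s| ^ q) := by
  have := rpow_le_one_add_rpow (abs_nonneg s) (by linarith : 0 ≤ q / 2) (by linarith : q / 2 ≤ q)
  have : 0 ≤ |s| ^ q := by positivity
  linarith

namespace NonlinApprox

variable {q : ℝ} {θ : ℕ → ℝ → ℝ}

theorem zero (h : NonlinApprox q ψ θ) (k : ℕ) : θ k 0 = 0 := SymmKernel.zero_of_odd (h.odd k)

theorem measurable (h : NonlinApprox q ψ θ) (k : ℕ) : Measurable (θ k) := (h.monotone k).measurable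

theorem sub_le (h : NonlinApprox q ψ θ) (k m : ℕ) (s : ℝ) :
    |θ k s - θ m s| ≤ (1 / (k + 1) + 1 / (m + 1)) * (1 + |s| ^ q) := by
  have h1 := h.approx k s
  have h2 := h.approx m s
  have := abs_sub_le (θ k s) (ψ s) (θ m s)
  rw [abs_sub_comm (ψ s)] at this
  rw [add_mul]
  linarith

end NonlinApprox

/-- A bound for `∫∫ K (1 + |u(y) - u(x)|^q) / M` if `‖u‖_q ≤ R`. -/
def growthConst (μ : Measure α) (P : ℝ≥0∞) (R : ℝ) : ℝ :=
  (μ univ + 2 ^ P.toReal * ENNReal.ofReal R ^ P.toReal).toReal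

theorem growthConst_nonneg (R : ℝ) : 0 ≤ growthConst μ P R := ENNReal.toReal_nonneg

theorem ofReal_growthConst (R : ℝ) : ENNReal.ofReal (growthConst μ P R) =
    μ univ + 2 ^ P.toReal * ENNReal.ofReal R ^ P.toReal := by
  rw [growthConst, ENNReal.ofReal_toReal]
  finiteness

namespace SymmKernel

/-- Comparison of two nonlinearities in `L¹`. -/
theorem norm_opLp_sub_opLp_le (hK : SymmKernel μ K M) (hP' : P ≠ ⊤) {θ' : ℝ → ℝ}
    (hθ : Measurable θ) (hθ' : Measurable θ') (hg : ∀ s, |θ s| ≤ 1 + |s| ^ (P.toReal / 2))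
    (hg' : ∀ s, |θ' s| ≤ 1 + |s| ^ (P.toReal / 2)) {ε : ℝ} (hε0 : 0 ≤ ε)
    (hε : ∀ s, |θ s - θ' s| ≤ ε * (1 + |s| ^ P.toReal)) {R : ℝ} {u : Lp ℝ 1 μ}
    (hR : eLpNorm u P μ ≤ ENNReal.ofReal R) :
    ‖opLp μ K θ u - opLp μ K θ' u‖ ≤ ε * (M * growthConst μ P R) := by
  have hP : 1 ≤ P := Fact.out
  have hu : MemLp u P μ := ⟨Lp.aestronglyMeasurable u, hR.trans_lt (by simp)⟩
  have g1 := fun s => le_two_mul_of_growth ENNReal.toReal_nonneg (hg s)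
  have g2 := fun s => le_two_mul_of_growth ENNReal.toReal_nonneg (hg' s)
  have m1 : MemLp (nonlocalOp μ K θ u) 1 μ := memLp_one_iff_integrable.2
    (hK.integrable_of_growth hP hP' hu hθ g1).integral_prod_left
  have m2 : MemLp (nonlocalOp μ K θ' u) 1 μ := memLp_one_iff_integrable.2
    (hK.integrable_of_growth hP hP' hu hθ' g2).integral_prod_left
  have h := hK.eLpNorm_one_nonlocalOp_sub_le hP hP' hu hR hθ hθ' g1 g2 hε
  rw [← ENNReal.ofReal_le_ofReal_iff
    (mul_nonneg hε0 (mul_nonneg M.coe_nonneg (growthConst_nonneg R))), ← eLpNorm_sub_eq_ofReal,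
    ENNReal.ofReal_mul hε0, ENNReal.ofReal_mul M.coe_nonneg, ofReal_growthConst]
  refine le_trans (le_of_eq (eLpNorm_congr_ae ?_)) (h.trans (le_of_eq ?_))
  · filter_upwards [coeFn_opLp m1, coeFn_opLp m2] with x hx hy
    rw [hx, hy]
  · simp

end SymmKernel

end Approximation

/-! ### Passage to the limit in the approximating nonlinearities -/

section Limit

set_option linter.unusedSectionVars false

variable {α : Type*} [MeasurableSpace α] {μ : Measure α} [IsFiniteMeasure μ]
  {P : ℝ≥0∞} [Fact (1 ≤ P)] {K : α → α → ℝ} {M : NNReal} {ψ : ℝ → ℝ} {θ : ℕ → ℝ → ℝ}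

/-- The solutions `u k` of the evolution equations with the approximate nonlinearities `θ k`. -/
structure ApproxFamily (μ : Measure α) [IsFiniteMeasure μ] (K : α → α → ℝ) (M : NNReal)
    (ψ : ℝ → ℝ) (θ : ℕ → ℝ → ℝ) (T : ℝ) (g : Lp ℝ P μ) (F : ℝ → Lp ℝ P μ)
    (u : ℕ → ℝ → Lp ℝ P μ) : Prop where
  two_le : 2 ≤ P
  ne_top : P ≠ ⊤
  nonneg_time : 0 ≤ T
  kernel : SymmKernel μ K M
  nonneg : ∀ x y, 0 ≤ K x y
  nonlin : NonlinApprox P.toReal ψ θ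
  source : IntervalIntegrable F volume 0 T
  init : ∀ k, u k 0 = g
  isPrimitive : ∀ k, IsPrimitive T (u k) fun t => opLp μ K (θ k) (u k t) + F t

/-- The a priori bound for the solution in `L^P`. -/
def dataRadius (T : ℝ) (g : Lp ℝ P μ) (F : ℝ → Lp ℝ P μ) : ℝ := ‖g‖ + ∫ s in (0)..T, ‖F s‖

theorem exists_approxFamily (h2 : 2 ≤ P) (hP' : P ≠ ⊤) {T : ℝ} (hT : 0 ≤ T)
    (hK : SymmKernel μ K M) (hK0 : ∀ x y, 0 ≤ K x y) (hN : NonlinApprox P.toReal ψ θ)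
    (g : Lp ℝ P μ) {F : ℝ → Lp ℝ P μ} (hF : IntervalIntegrable F volume 0 T) :
    ∃ u, ApproxFamily μ K M ψ θ T g F u := by
  have : ∀ k, ∃ u : ℝ → Lp ℝ P μ, Continuous u ∧ u 0 = g ∧
      IsPrimitive T u (fun t => opLp μ K (θ k) (u t) + F t) := fun k => by
    obtain ⟨L, hL⟩ := hN.lipschitz k
    exact exists_isPrimitive_of_lipschitz hT (hK.lipschitzWith_opLp hP' hL (hN.zero k)) hF g
  choose u _ h0 hu using this
  exact ⟨u, h2, hP', hT, hK, hK0, hN, hF, h0, hu⟩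

theorem intervalIntegrable_lpIncl {r : ℝ≥0∞} [Fact (1 ≤ r)] (h : r ≤ P) {T : ℝ}
    {F : ℝ → Lp ℝ P μ} (hF : IntervalIntegrable F volume 0 T) :
    IntervalIntegrable (fun t => lpIncl μ h (F t)) volume 0 T :=
  ⟨(lpIncl μ h).integrable_comp hF.1, (lpIncl μ h).integrable_comp hF.2⟩

theorem norm_opLp_two_le {P : ℝ≥0∞} [Fact (1 ≤ P)] (hP' : P ≠ ⊤) {K : α → α → ℝ} {M : NNReal}
    (hK : SymmKernel μ K M) {θ : ℝ → ℝ} {L : NNReal} (hL : LipschitzWith L θ) (h0 : θ 0 = 0)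
    (hg : ∀ s, |θ s| ≤ 1 + |s| ^ (P.toReal / 2)) {R : ℝ} {u : Lp ℝ 2 μ}
    (hR : eLpNorm u P μ ≤ ENNReal.ofReal R) :
    ‖opLp μ K θ u‖ ≤ M * (2 * growthConst μ P R) ^ (1 / 2 : ℝ) := by
  have h := hK.eLpNorm_two_nonlocalOp_le Fact.out hP' (Lp.aestronglyMeasurable u) hR
    hL.continuous.measurable hg
  have hc := growthConst_nonneg (μ := μ) (P := P) R
  rw [← ENNReal.ofReal_le_ofReal_iff (by positivity), ← eLpNorm_eq_ofReal,
    eLpNorm_congr_ae (hK.coeFn_opLp_of_lipschitz (by simp) hL h0 u)]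
  refine h.trans (le_of_eq ?_)
  rw [ENNReal.ofReal_mul M.coe_nonneg, ← ENNReal.ofReal_rpow_of_nonneg (by positivity) (by norm_num),
    ENNReal.ofReal_mul (by norm_num), ofReal_growthConst]
  simp

theorem eLpNorm_lpIncl_sub {r r' : ℝ≥0∞} [Fact (1 ≤ r)] [Fact (1 ≤ r')] (h : r ≤ P) (h' : r' ≤ P)
    (u v : Lp ℝ P μ) : eLpNorm ⇑(lpIncl μ h u - lpIncl μ h v) r' μ =
      ENNReal.ofReal ‖lpIncl μ h' u - lpIncl μ h' v‖ := by
  rw [← map_sub, ← map_sub, ← eLpNorm_eq_ofReal]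
  exact eLpNorm_congr_ae ((coeFn_lpIncl h _).trans (coeFn_lpIncl h' _).symm)

/-- Lower semicontinuity under convergence in measure. Bounds in stronger norms pass to the limit
although convergence is known only in `L¹`. -/
theorem eLpNorm_le_of_tendsto {r : ℝ≥0∞} {w : ℕ → Lp ℝ 1 μ} {W : Lp ℝ 1 μ}
    (hw : Tendsto w atTop (𝓝 W)) {C : ℝ≥0∞} (hC : ∀ k, eLpNorm (w k) r μ ≤ C) :
    eLpNorm W r μ ≤ C :=
  eLpNorm_le_of_tendstoInMeasure (Eventually.of_forall hC) (tendstoInMeasure_of_tendsto_Lp hw)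
    fun k => Lp.aestronglyMeasurable (w k)

/-- Linearity in the kernel. The difference may change sign, which `SymmKernel` allows. -/
theorem opLp_sub_kernel {K' : α → α → ℝ} {M' MD : NNReal} (hK : SymmKernel μ K M)
    (hK' : SymmKernel μ K' M') (hD : SymmKernel μ (fun x y => K' x y - K x y) MD) {r : ℝ≥0∞}
    [Fact (1 ≤ r)] (hr' : r ≠ ⊤) {θ : ℝ → ℝ} {L : NNReal} (hL : LipschitzWith L θ) (h0 : θ 0 = 0)
    (w : Lp ℝ r μ) :
    opLp μ K' θ w - opLp μ K θ w = opLp μ (fun x y => K' x y - K x y) θ w := by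
  have hr : 1 ≤ r := Fact.out
  have hr1 : 1 ≤ r.toReal := by simpa using ENNReal.toReal_mono hr' hr
  have g := SymmKernel.growth_of_lipschitz hL h0 hr1
  have i := hK.integrable_of_growth hr hr' (Lp.memLp w) hL.continuous.measurable g
  have i' := hK'.integrable_of_growth hr hr' (Lp.memLp w) hL.continuous.measurable g
  apply Lp.ext
  filter_upwards [hK.coeFn_opLp_of_lipschitz hr' hL h0 w, hK'.coeFn_opLp_of_lipschitz hr' hL h0 w,
    hD.coeFn_opLp_of_lipschitz hr' hL h0 w, Lp.coeFn_sub (opLp μ K' θ w) (opLp μ K θ w),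
    i.prod_right_ae, i'.prod_right_ae] with x a1 a2 a3 a4 a5 a6
  rw [a4, Pi.sub_apply, a1, a2, a3]
  simp only [nonlocalOp, sub_mul]
  rw [integral_sub a6 a5]

namespace ApproxFamily

variable {T : ℝ} {g : Lp ℝ P μ} {F : ℝ → Lp ℝ P μ} {u : ℕ → ℝ → Lp ℝ P μ}

/-- Comparison with the zero solution of the source-free problem; the bound depends neither on `k`
nor on the kernel. -/
theorem norm_le (h : ApproxFamily μ K M ψ θ T g F u) (k : ℕ) {t : ℝ} (ht : t ∈ Icc 0 T) :
    ‖u k t‖ ≤ dataRadius T g F := by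
  obtain ⟨L, hL⟩ := h.nonlin.lipschitz k
  have h0 : (0:ℝ) ∈ Icc 0 T := ⟨le_rfl, h.nonneg_time⟩
  have hz : IsPrimitive T (fun _ => (0 : Lp ℝ P μ)) fun t => (0 : Lp ℝ P μ) + 0 :=
    ⟨by simp, fun t _ => by simp⟩
  have key := IsPrimitive.norm_sub_le_of_dissipative (h.kernel.dissipative_opLp h.nonneg h.ne_top
    (h.nonlin.monotone k) (h.nonlin.odd k) hL) (h.isPrimitive k)
    (w₂ := fun _ => 0) (G := fun _ => 0) (F₂ := fun _ => 0) hz h.source (by simp) (c := 0)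
    (fun t _ => by rw [opLp_zero (h.nonlin.zero k)]; simp) ht
  simp only [sub_zero, zero_mul, add_zero, h.init] at key
  refine key.trans ?_
  rw [dataRadius]
  gcongr
  exact intervalIntegral.integral_mono_interval le_rfl ht.1 ht.2 (ae_of_all _ fun s => norm_nonneg _)
    h.source.norm

theorem isPrimitive_lpIncl (h : ApproxFamily μ K M ψ θ T g F u) {r : ℝ≥0∞} [Fact (1 ≤ r)]
    (hr : r ≤ P) (k : ℕ) : IsPrimitive T (fun t => lpIncl μ hr (u k t))
      fun t => opLp μ K (θ k) (lpIncl μ hr (u k t)) + lpIncl μ hr (F t) := by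
  obtain ⟨L, hL⟩ := h.nonlin.lipschitz k
  have := (h.isPrimitive k).map (lpIncl μ hr)
  simp only [map_add] at this
  simpa only [h.kernel.lpIncl_opLp h.ne_top hr hL (h.nonlin.zero k)] using this

theorem eLpNorm_lpIncl_le (h : ApproxFamily μ K M ψ θ T g F u) {r : ℝ≥0∞} [Fact (1 ≤ r)]
    (hr : r ≤ P) (k : ℕ) {t : ℝ} (ht : t ∈ Icc 0 T) :
    eLpNorm (lpIncl μ hr (u k t)) P μ ≤ ENNReal.ofReal (dataRadius T g F) := by
  rw [eLpNorm_congr_ae (coeFn_lpIncl hr _), eLpNorm_eq_ofReal]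
  exact ENNReal.ofReal_le_ofReal (h.norm_le k ht)

/-- The `m`-th solution is an approximate solution for `θ k`. The defect is small in `L¹` because
the `L^P` bound controls `∫∫ |K| (1 + |u(y) - u(x)|^P)`. -/
theorem norm_sub_le (h : ApproxFamily μ K M ψ θ T g F u) (h1 : 1 ≤ P) (k m : ℕ) {t : ℝ}
    (ht : t ∈ Icc 0 T) : ‖lpIncl μ h1 (u k t) - lpIncl μ h1 (u m t)‖ ≤
      (1 / (k + 1) + 1 / (m + 1)) * (M * growthConst μ P (dataRadius T g F)) * T := by
  obtain ⟨L, hL⟩ := h.nonlin.lipschitz k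
  have hF := intervalIntegrable_lpIncl h1 h.source
  have hc := growthConst_nonneg (μ := μ) (P := P) (dataRadius T g F)
  have key := IsPrimitive.norm_sub_le_of_dissipative
    (h.kernel.dissipative_opLp (r := 1) h.nonneg (by simp) (h.nonlin.monotone k) (h.nonlin.odd k) hL)
    (h.isPrimitive_lpIncl h1 k) (h.isPrimitive_lpIncl h1 m) hF hF
    (c := (1 / (k + 1) + 1 / (m + 1)) * (M * growthConst μ P (dataRadius T g F)))
    (fun s hs => h.kernel.norm_opLp_sub_opLp_le h.ne_top (h.nonlin.measurable k)
      (h.nonlin.measurable m) (h.nonlin.growth k) (h.nonlin.growth m) (by positivity)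
      (h.nonlin.sub_le k m) (h.eLpNorm_lpIncl_le h1 m hs)) ht
  simp only [h.init, sub_self, norm_zero, intervalIntegral.integral_zero, zero_add] at key
  refine key.trans ?_
  gcongr
  exact ht.2

theorem exists_tendsto (h : ApproxFamily μ K M ψ θ T g F u) (h1 : 1 ≤ P) :
    ∃ U : ℝ → Lp ℝ 1 μ, ∀ t ∈ Icc 0 T, Tendsto (fun k => lpIncl μ h1 (u k t)) atTop (𝓝 (U t)) := by
  have : ∀ t, ∃ l, t ∈ Icc 0 T → Tendsto (fun k => lpIncl μ h1 (u k t)) atTop (𝓝 l) := by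
    intro t
    by_cases ht : t ∈ Icc 0 T
    · have hc := growthConst_nonneg (μ := μ) (P := P) (dataRadius T g F)
      have hT := h.nonneg_time
      have hcau : CauchySeq fun k => lpIncl μ h1 (u k t) := by
        refine cauchySeq_of_le_tendsto_0 (fun N : ℕ => (2 * (1 / ((N:ℝ) + 1))) *
          (M * growthConst μ P (dataRadius T g F)) * T) (fun k m N hk hm => ?_) ?_
        · rw [dist_eq_norm]
          refine (h.norm_sub_le h1 k m ht).trans ?_
          have e1 : 1 / ((k:ℝ) + 1) ≤ 1 / (N + 1) := by gcongr
          have e2 : 1 / ((m:ℝ) + 1) ≤ 1 / (N + 1) := by gcongr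
          gcongr
          linarith
        · have := ((tendsto_one_div_add_atTop_nhds_zero_nat (𝕜 := ℝ)).const_mul 2).mul_const
            (M * growthConst μ P (dataRadius T g F)) |>.mul_const T
          simpa using this
      obtain ⟨l, hl⟩ := cauchySeq_tendsto_of_complete hcau
      exact ⟨l, fun _ => hl⟩
    · exact ⟨0, fun h => absurd h ht⟩
  choose U hU using this
  exact ⟨U, hU⟩

variable {U : ℝ → Lp ℝ 1 μ}

theorem eLpNorm_limit_le (h : ApproxFamily μ K M ψ θ T g F u) (h1 : 1 ≤ P)
    (hU : ∀ t ∈ Icc 0 T, Tendsto (fun k => lpIncl μ h1 (u k t)) atTop (𝓝 (U t))) {t : ℝ}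
    (ht : t ∈ Icc 0 T) : eLpNorm (U t) P μ ≤ ENNReal.ofReal (dataRadius T g F) :=
  eLpNorm_le_of_tendsto (hU t ht) fun k => h.eLpNorm_lpIncl_le h1 k ht

theorem integrable_limit (h : ApproxFamily μ K M ψ θ T g F u) (h1 : 1 ≤ P)
    (hU : ∀ t ∈ Icc 0 T, Tendsto (fun k => lpIncl μ h1 (u k t)) atTop (𝓝 (U t))) {t : ℝ}
    (ht : t ∈ Icc 0 T) :
    Integrable (fun z : α × α => K z.1 z.2 * ψ (U t z.2 - U t z.1)) (μ.prod μ) :=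
  h.kernel.integrable_of_growth h1 h.ne_top
    ⟨Lp.aestronglyMeasurable _, (h.eLpNorm_limit_le h1 hU ht).trans_lt (by simp)⟩
    h.nonlin.monotone_lim.measurable
    fun s => le_two_mul_of_growth ENNReal.toReal_nonneg (h.nonlin.growth_lim s)

theorem tendsto_opLp (h : ApproxFamily μ K M ψ θ T g F u) (h1 : 1 ≤ P)
    (hU : ∀ t ∈ Icc 0 T, Tendsto (fun k => lpIncl μ h1 (u k t)) atTop (𝓝 (U t))) {t : ℝ}
    (ht : t ∈ Icc 0 T) :
    Tendsto (fun k => opLp μ K (θ k) (lpIncl μ h1 (u k t))) atTop (𝓝 (opLp μ K ψ (U t))) := by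
  set R := dataRadius T g F
  set c : ℝ := M * growthConst μ P R with hc
  have hc0 : 0 ≤ c := mul_nonneg M.coe_nonneg (growthConst_nonneg R)
  rw [Metric.tendsto_nhds]
  intro ε hε
  have l1 : Tendsto (fun k : ℕ => 1 / ((k:ℝ) + 1) * c) atTop (𝓝 0) := by
    simpa using (tendsto_one_div_add_atTop_nhds_zero_nat (𝕜 := ℝ)).mul_const c
  have l1' := l1.eventually (gt_mem_nhds (by positivity : (0:ℝ) < ε / 4))
  -- The index `j` is frozen: between `θ k` at `u k` and `ψ` at `U` one inserts `θ j` at `u k` and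
  -- `θ j` at `U`. The outer gaps are uniform approximation errors, and the middle one closes by
  -- continuity of the Lipschitz operator for `θ j`.
  obtain ⟨j, hj⟩ := l1'.exists
  obtain ⟨L, hL⟩ := h.nonlin.lipschitz j
  have l2 := ((h.kernel.lipschitzWith_opLp (r := 1) (by simp) hL
    (h.nonlin.zero j)).continuous.tendsto (U t)).comp (hU t ht)
  have l2' := Metric.tendsto_nhds.1 l2 (ε / 4) (by positivity)
  filter_upwards [l1', l2'] with k hk1 hk2
  have e1 := h.kernel.norm_opLp_sub_opLp_le h.ne_top (h.nonlin.measurable k)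
    (h.nonlin.measurable j) (h.nonlin.growth k) (h.nonlin.growth j) (by positivity)
    (h.nonlin.sub_le k j) (h.eLpNorm_lpIncl_le h1 k ht)
  have e2 := h.kernel.norm_opLp_sub_opLp_le h.ne_top (h.nonlin.measurable j)
    h.nonlin.monotone_lim.measurable (h.nonlin.growth j) h.nonlin.growth_lim (by positivity)
    (h.nonlin.approx j) (h.eLpNorm_limit_le h1 hU ht)
  rw [← dist_eq_norm] at e1 e2
  have d1 := dist_triangle4 (opLp μ K (θ k) (lpIncl μ h1 (u k t)))
    (opLp μ K (θ j) (lpIncl μ h1 (u k t))) (opLp μ K (θ j) (U t)) (opLp μ K ψ (U t))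
  simp only [Function.comp_apply] at hk2
  rw [add_mul] at e1
  linarith

/-- Comparison with the zero nonlinearity, with `2` from `le_two_mul_of_growth`. Uniformity in `k`
and `t` supplies the dominating constant for the limit of the integral equations. -/
theorem norm_opLp_le (h : ApproxFamily μ K M ψ θ T g F u) (h1 : 1 ≤ P) (k : ℕ) {t : ℝ}
    (ht : t ∈ Icc 0 T) : ‖opLp μ K (θ k) (lpIncl μ h1 (u k t))‖ ≤
      2 * (M * growthConst μ P (dataRadius T g F)) := by
  have hz : opLp μ K (fun _ => 0) (lpIncl μ h1 (u k t)) = 0 := by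
    have h : nonlocalOp μ K (fun _ => 0) (lpIncl μ h1 (u k t)) = 0 := by
      funext x; simp [nonlocalOp]
    have hm : MemLp (nonlocalOp μ K (fun _ => 0) (lpIncl μ h1 (u k t))) 1 μ := by
      rw [h]; exact MemLp.zero'
    apply Lp.ext
    refine (coeFn_opLp hm).trans ?_
    rw [h]
    exact (Lp.coeFn_zero ℝ 1 μ).symm
  have := h.kernel.norm_opLp_sub_opLp_le (θ' := fun _ => 0) h.ne_top (h.nonlin.measurable k)
    measurable_const (h.nonlin.growth k) (fun s => by simp; positivity) (ε := 2) (by norm_num)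
    (fun s => by
      rw [sub_zero]
      exact le_two_mul_of_growth ENNReal.toReal_nonneg (h.nonlin.growth k s))
    (h.eLpNorm_lpIncl_le h1 k ht)
  rwa [hz, sub_zero] at this

/-- The limit solves the limit equation in `L¹`. -/
theorem isPrimitive_limit (h : ApproxFamily μ K M ψ θ T g F u) (h1 : 1 ≤ P)
    (hU : ∀ t ∈ Icc 0 T, Tendsto (fun k => lpIncl μ h1 (u k t)) atTop (𝓝 (U t))) :
    IsPrimitive T U fun t => opLp μ K ψ (U t) + lpIncl μ h1 (F t) := by
  have hT := h.nonneg_time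
  have h0 : (0:ℝ) ∈ Icc 0 T := ⟨le_rfl, hT⟩
  have hF := intervalIntegrable_lpIncl h1 h.source
  have hcont : ∀ k, ContinuousOn (fun t => opLp μ K (θ k) (lpIncl μ h1 (u k t))) (Icc 0 T) := by
    intro k
    obtain ⟨L, hL⟩ := h.nonlin.lipschitz k
    exact (h.kernel.lipschitzWith_opLp (r := 1) (by simp) hL
      (h.nonlin.zero k)).continuous.comp_continuousOn
        ((lpIncl μ h1).continuous.comp_continuousOn ((h.isPrimitive k).continuousOn hT))
  have hmeas : ∀ k, AEStronglyMeasurable (fun t => opLp μ K (θ k) (lpIncl μ h1 (u k t)))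
      (volume.restrict (uIoc 0 T)) := fun k => by
    rw [uIoc_of_le hT]
    exact ((hcont k).aestronglyMeasurable measurableSet_Icc).mono_measure
      (Measure.restrict_mono Ioc_subset_Icc_self le_rfl)
  have hsub : ∀ {s}, s ∈ uIoc 0 T → s ∈ Icc 0 T := fun hs => by
    rw [uIoc_of_le hT] at hs; exact Ioc_subset_Icc_self hs
  have hlimmeas : AEStronglyMeasurable (fun t => opLp μ K ψ (U t)) (volume.restrict (uIoc 0 T)) := by
    refine aestronglyMeasurable_of_tendsto_ae atTop hmeas ?_
    rw [ae_restrict_iff' measurableSet_uIoc]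
    exact ae_of_all _ fun t ht => h.tendsto_opLp h1 hU (hsub ht)
  set c := 2 * (M * growthConst μ P (dataRadius T g F)) with hc
  have hbound : ∀ t ∈ Icc 0 T, ‖opLp μ K ψ (U t)‖ ≤ c := fun t ht =>
    le_of_tendsto (h.tendsto_opLp h1 hU ht).norm
      (Eventually.of_forall fun k => h.norm_opLp_le h1 k ht)
  have hlim : IntervalIntegrable (fun t => opLp μ K ψ (U t)) volume 0 T := by
    rw [intervalIntegrable_iff]
    have : IsFiniteMeasure (volume.restrict (uIoc 0 T)) := ⟨by simp [uIoc_of_le hT]⟩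
    refine Integrable.of_bound hlimmeas c ?_
    rw [ae_restrict_iff' measurableSet_uIoc]
    exact ae_of_all _ fun t ht => hbound t (hsub ht)
  refine ⟨hlim.add hF, fun t ht => ?_⟩
  have hsub' : ∀ {s}, s ∈ uIoc 0 t → s ∈ uIoc 0 T := fun hs => by
    rw [uIoc_of_le ht.1] at hs; rw [uIoc_of_le hT]; exact ⟨hs.1, hs.2.trans ht.2⟩
  have l1 : Tendsto (fun k => ∫ s in (0)..t, (opLp μ K (θ k) (lpIncl μ h1 (u k s)) +
      lpIncl μ h1 (F s))) atTop (𝓝 (∫ s in (0)..t, (opLp μ K ψ (U s) + lpIncl μ h1 (F s)))) := by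
    have hFt := intervalIntegrable_of_mem hF h0 ht
    refine intervalIntegral.tendsto_integral_filter_of_dominated_convergence
      (fun s => c + ‖lpIncl μ h1 (F s)‖) (Eventually.of_forall fun k => ?_)
      (Eventually.of_forall fun k => ae_of_all _ fun s hs => ?_)
      (intervalIntegrable_const.add hFt.norm) (ae_of_all _ fun s hs => ?_)
    · exact ((hmeas k).mono_measure (Measure.restrict_mono (fun s hs => hsub' hs) le_rfl)).add
        hFt.def'.1
    · refine (norm_add_le _ _).trans ?_
      gcongr
      exact h.norm_opLp_le h1 k (hsub (hsub' hs))
    · exact (h.tendsto_opLp h1 hU (hsub (hsub' hs))).add_const _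
  have l2 : Tendsto (fun k => lpIncl μ h1 (u k t)) atTop
      (𝓝 (U 0 + ∫ s in (0)..t, (opLp μ K ψ (U s) + lpIncl μ h1 (F s)))) := by
    refine ((hU 0 h0).add l1).congr fun k => ?_
    exact ((h.isPrimitive_lpIncl h1 k).eq_integral t ht).symm
  exact tendsto_nhds_unique (hU t ht) l2

theorem limit_zero (h : ApproxFamily μ K M ψ θ T g F u) (h1 : 1 ≤ P)
    (hU : ∀ t ∈ Icc 0 T, Tendsto (fun k => lpIncl μ h1 (u k t)) atTop (𝓝 (U t))) :
    U 0 = lpIncl μ h1 g := by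
  refine tendsto_nhds_unique (hU 0 ⟨le_rfl, h.nonneg_time⟩) ?_
  simp only [h.init]
  exact tendsto_const_nhds

/-- Modulus of continuity in `L²`. -/
theorem eLpNorm_two_sub_le (h : ApproxFamily μ K M ψ θ T g F u) (h1 : 1 ≤ P)
    (hU : ∀ t ∈ Icc 0 T, Tendsto (fun k => lpIncl μ h1 (u k t)) atTop (𝓝 (U t))) {s t : ℝ}
    (hs : s ∈ Icc 0 T) (ht : t ∈ Icc 0 T) : eLpNorm (fun x => U t x - U s x) 2 μ ≤
      ENNReal.ofReal |∫ τ in s..t, (M * (2 * growthConst μ P (dataRadius T g F)) ^ (1 / 2 : ℝ) +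
        ‖lpIncl μ h.two_le (F τ)‖)| := by
  have hF := intervalIntegrable_lpIncl h.two_le h.source
  have hT := h.nonneg_time
  refine (eLpNorm_congr_ae (Lp.coeFn_sub (U t) (U s)).symm).trans_le ?_
  -- It is enough to bound the increments of the approximate solutions, whose time derivatives are
  -- controlled in `L²` uniformly in `k`.
  refine eLpNorm_le_of_tendsto ((hU t ht).sub (hU s hs)) fun k => ?_
  obtain ⟨L, hL⟩ := h.nonlin.lipschitz k
  rw [eLpNorm_lpIncl_sub h1 h.two_le]
  apply ENNReal.ofReal_le_ofReal
  rw [(h.isPrimitive_lpIncl h.two_le k).sub_eq hs ht]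
  refine intervalIntegral.norm_integral_le_abs_of_norm_le ?_
    (intervalIntegrable_const.add (intervalIntegrable_of_mem hF hs ht).norm)
  rw [ae_restrict_iff' measurableSet_uIoc]
  refine ae_of_all _ fun τ hτ => (norm_add_le _ _).trans ?_
  gcongr
  have hτ' : τ ∈ Icc 0 T := by
    have := uIoc_subset_uIcc hτ
    exact (uIcc_subset_Icc hs ht) this
  exact norm_opLp_two_le h.ne_top h.kernel hL (h.nonlin.zero k) (h.nonlin.growth k)
    (h.eLpNorm_lpIncl_le h.two_le k hτ')

/-- Continuous dependence of the limit on the kernel and the data, in `L²`. -/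
theorem eLpNorm_two_sub_le_of_kernels (h : ApproxFamily μ K M ψ θ T g F u) {K' : α → α → ℝ}
    {M' MD : NNReal} {g' : Lp ℝ P μ} {F' : ℝ → Lp ℝ P μ} {u' : ℕ → ℝ → Lp ℝ P μ}
    (h' : ApproxFamily μ K' M' ψ θ T g' F' u')
    (hD : SymmKernel μ (fun x y => K' x y - K x y) MD) (h1 : 1 ≤ P)
    (hU : ∀ t ∈ Icc 0 T, Tendsto (fun k => lpIncl μ h1 (u k t)) atTop (𝓝 (U t)))
    {U' : ℝ → Lp ℝ 1 μ}
    (hU' : ∀ t ∈ Icc 0 T, Tendsto (fun k => lpIncl μ h1 (u' k t)) atTop (𝓝 (U' t))) {t : ℝ}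
    (ht : t ∈ Icc 0 T) :
    eLpNorm (fun x => U' t x - U t x) 2 μ ≤ ENNReal.ofReal
      (‖lpIncl μ h.two_le g' - lpIncl μ h.two_le g‖ +
        (∫ s in (0)..T, ‖lpIncl μ h.two_le (F' s) - lpIncl μ h.two_le (F s)‖) +
        MD * (2 * growthConst μ P (dataRadius T g F)) ^ (1 / 2 : ℝ) * T) := by
  have hF := intervalIntegrable_lpIncl h.two_le h.source
  have hF' := intervalIntegrable_lpIncl h.two_le h'.source
  have hc := growthConst_nonneg (μ := μ) (P := P) (dataRadius T g F)
  refine (eLpNorm_congr_ae (Lp.coeFn_sub (U' t) (U t)).symm).trans_le ?_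
  refine eLpNorm_le_of_tendsto ((hU' t ht).sub (hU t ht)) fun k => ?_
  obtain ⟨L, hL⟩ := h.nonlin.lipschitz k
  rw [eLpNorm_lpIncl_sub h1 h.two_le]
  apply ENNReal.ofReal_le_ofReal
  -- Dissipativity is taken from the primed kernel, and the defect is evaluated along the unprimed
  -- solution. Thus only the radius of `(g, F)` enters, and the primed data and kernel appear only
  -- through differences.
  have key := IsPrimitive.norm_sub_le_of_dissipative
    (h'.kernel.dissipative_opLp (r := 2) h'.nonneg (by simp) (h.nonlin.monotone k)
      (h.nonlin.odd k) hL)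
    (h'.isPrimitive_lpIncl h.two_le k) (h.isPrimitive_lpIncl h.two_le k) hF' hF
    (c := MD * (2 * growthConst μ P (dataRadius T g F)) ^ (1 / 2 : ℝ))
    (fun s hs => by
      rw [opLp_sub_kernel h.kernel h'.kernel hD (by simp) hL (h.nonlin.zero k)]
      exact norm_opLp_two_le h.ne_top hD hL (h.nonlin.zero k) (h.nonlin.growth k)
        (h.eLpNorm_lpIncl_le h.two_le k hs)) ht
  simp only [h.init, h'.init] at key
  refine key.trans ?_
  gcongr
  · exact intervalIntegral.integral_mono_interval le_rfl ht.1 ht.2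
      (ae_of_all _ fun s => norm_nonneg _) (hF'.sub hF).norm
  · exact ht.2

end ApproxFamily

end Limit

/-! ### Uniqueness, existence and convolution kernels -/

section Problem

set_option linter.unusedSectionVars false

variable {d : ℕ} {Ω : Set (EuclideanSpace ℝ (Fin d))} [IsFiniteMeasure (volume.restrict Ω)]
  {T p : ℝ} {K : EuclideanSpace ℝ (Fin d) → EuclideanSpace ℝ (Fin d) → ℝ} {M : NNReal}
  {f : ℝ → EuclideanSpace ℝ (Fin d) → ℝ} {g : EuclideanSpace ℝ (Fin d) → ℝ}

/-- The solution is unique. -/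
theorem IsSolution.eq (hK : SymmKernel (volume.restrict Ω) K M) (hK0 : ∀ x y, 0 ≤ K x y)
    (hT : 0 < T) (hp : 1 < p) {u v : ℝ → L1 Ω} (hu : IsSolution Ω T p K f g u)
    (hv : IsSolution Ω T p K f g v) {t : ℝ} (ht : t ∈ Icc 0 T) : v t = u t := by
  obtain ⟨hv1, hv2, v', hv3, hv4⟩ := hv
  obtain ⟨hu1, hu2, u', hu3, hu4⟩ := hu
  have hw := (hv3.isPrimitive hT hv1).sub hT.le (hu3.isPrimitive hT hu1)
  have h0 : v 0 = u 0 := Lp.ext (hv2.trans hu2.symm)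
  rw [ae_restrict_iff' measurableSet_Ioo] at hv4 hu4
  -- The sources cancel, so `L¹` dissipativity holds without error and the distance of two solutions
  -- cannot grow from zero.
  have key := hw.norm_le_of_dissipative (ρ := fun _ => 0) intervalIntegrable_const ?_ ht
  · simp only [Pi.sub_apply, h0, sub_self, norm_zero, intervalIntegral.integral_zero, add_zero]
      at key
    exact sub_eq_zero.1 (norm_le_zero_iff.1 key)
  · filter_upwards [hv4, hu4] with s hs1 hs2 hs δ hδ
    obtain ⟨a1, a2⟩ := hs1 hs
    obtain ⟨b1, b2⟩ := hs2 hs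
    have h := hK.eLpNorm_one_sub_le hK0 (monotone_psi hp) (psi_neg p) (Lp.memLp (v s))
      (Lp.memLp (u s)) a1 b1 hδ
    simp only [Pi.sub_apply, mul_zero, add_zero]
    rw [← ENNReal.ofReal_le_ofReal_iff (by positivity), ← eLpNorm_sub_eq_ofReal,
      ← eLpNorm_eq_ofReal]
    refine h.trans (le_of_eq (eLpNorm_congr_ae ?_))
    filter_upwards [a2, b2, Lp.coeFn_sub (v s - u s) (δ • (v' s - u' s)), Lp.coeFn_sub (v s) (u s),
      Lp.coeFn_smul δ (v' s - u' s), Lp.coeFn_sub (v' s) (u' s)] with x h1 h2 h3 h4 h5 h6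
    rw [h3, Pi.sub_apply, h4, h5, Pi.sub_apply, Pi.smul_apply, h6, Pi.sub_apply, h1, h2, smul_eq_mul]
    simp only [pLaplacian, nonlocalOp]
    ring

variable {P : ℝ≥0∞} [Fact (1 ≤ P)] {θ : ℕ → ℝ → ℝ} {G : Lp ℝ P (volume.restrict Ω)}
  {F : ℝ → Lp ℝ P (volume.restrict Ω)} {u : ℕ → ℝ → Lp ℝ P (volume.restrict Ω)} {U : ℝ → L1 Ω}

theorem ApproxFamily.isSolution (h : ApproxFamily (volume.restrict Ω) K M (psi p) θ T G F u)
    (h1 : 1 ≤ P)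
    (hU : ∀ t ∈ Icc 0 T,
      Tendsto (fun k => lpIncl (volume.restrict Ω) h1 (u k t)) atTop (𝓝 (U t)))
    (hG : G =ᵐ[volume.restrict Ω] g)
    (hF : ∀ᵐ t ∂(volume.restrict (Icc 0 T)), F t =ᵐ[volume.restrict Ω] f t) :
    IsSolution Ω T p K f g U := by
  have hprim := h.isPrimitive_limit h1 hU
  refine ⟨hprim.continuousOn h.nonneg_time, ?_, _, hprim.hasWeakTimeDeriv h.nonneg_time, ?_⟩
  · rw [h.limit_zero h1 hU]
    exact (coeFn_lpIncl h1 G).trans hG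
  · rw [ae_restrict_iff' measurableSet_Icc] at hF
    rw [ae_restrict_iff' measurableSet_Ioo]
    filter_upwards [hF] with t ht htT
    have htI := Ioo_subset_Icc_self htT
    have hi := h.integrable_limit h1 hU htI
    refine ⟨hi, ?_⟩
    have hm : MemLp (nonlocalOp (volume.restrict Ω) K (psi p) (U t)) 1 (volume.restrict Ω) :=
      memLp_one_iff_integrable.2 hi.integral_prod_left
    filter_upwards [ht htI, coeFn_opLp hm, coeFn_lpIncl h1 (F t),
      Lp.coeFn_add (opLp (volume.restrict Ω) K (psi p) (U t)) (lpIncl (volume.restrict Ω) h1 (F t))]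
      with x a1 a2 a3 a4
    rw [a4, Pi.add_apply, a2, a3, a1]
    simp only [pLaplacian, nonlocalOp, neg_neg]

/-- The critical integrability exponent of the data. -/
def dataExponent (p : ℝ) : ℝ≥0∞ := ENNReal.ofReal (max 2 (2 * (p - 1)))

theorem toReal_dataExponent (p : ℝ) : (dataExponent p).toReal = max 2 (2 * (p - 1)) :=
  ENNReal.toReal_ofReal (by positivity)

theorem two_le_dataExponent (p : ℝ) : 2 ≤ dataExponent p := by
  rw [dataExponent, ← ENNReal.ofReal_ofNat]
  exact ENNReal.ofReal_le_ofReal (le_max_left _ _)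

instance (p : ℝ) : Fact (1 ≤ dataExponent p) := ⟨one_le_two.trans (two_le_dataExponent p)⟩

theorem dataExponent_ne_top (p : ℝ) : dataExponent p ≠ ⊤ := ENNReal.ofReal_ne_top

theorem exists_nonlinApprox (hp : 1 < p) :
    ∃ θ, NonlinApprox (dataExponent p).toReal (psi p) θ := by
  rw [toReal_dataExponent]
  have := fun k : ℕ => exists_lipschitz_approx_psi hp (Nat.one_div_pos_of_nat (α := ℝ) (n := k))
  choose θ h1 h2 h3 h4 h5 using this
  have hg : ∀ s, |psi p s| ≤ 1 + |s| ^ (max 2 (2 * (p - 1)) / 2) := fun s => by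
    rw [abs_psi hp]
    refine rpow_le_one_add_rpow (abs_nonneg s) (by linarith) ?_
    have := le_max_right 2 (2 * (p - 1))
    linarith
  exact ⟨θ, h1, h2, h3, fun k s => (h4 k s).trans (hg s), monotone_psi hp, hg, h5⟩

/-- The even function `D` defines a symmetric convolution kernel. -/
theorem symmKernel_of_even (hΩ : MeasurableSet Ω) {D : EuclideanSpace ℝ (Fin d) → ℝ}
    (hD : AEMeasurable D volume) (heven : ∀ x, D (-x) = D x)
    (hfin : eLpNorm D 1 (volume.restrict (Ω - Ω)) ≠ ⊤) :
    SymmKernel (volume.restrict Ω) (fun x y => D (x - y))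
      (eLpNorm D 1 (volume.restrict (Ω - Ω))).toNNReal := by
  refine ⟨?_, fun x y => by rw [← heven, neg_sub], ?_⟩
  · have h := hD.aestronglyMeasurable.comp_quasiMeasurePreserving
      (quasiMeasurePreserving_sub_of_right_invariant (volume : Measure (EuclideanSpace ℝ (Fin d)))
        (volume : Measure (EuclideanSpace ℝ (Fin d))))
    rw [Measure.prod_restrict]
    exact h.restrict
  · rw [ae_restrict_iff' hΩ]
    refine ae_of_all _ fun x hx => ?_
    rw [ENNReal.coe_toNNReal hfin, eLpNorm_one_eq_lintegral_enorm]
    -- For fixed `x ∈ Ω`, reflection and translation preserve volume and send `Ω` into `Ω - Ω`;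
    -- every section is thus bounded by one norm of `D`.
    have hmp : MeasurePreserving (fun y => x - y)
        (volume : Measure (EuclideanSpace ℝ (Fin d))) volume :=
      Measure.measurePreserving_sub_left volume x
    have hemb : MeasurableEmbedding (fun y : EuclideanSpace ℝ (Fin d) => x - y) :=
      (MeasurableEquiv.subLeft x).measurableEmbedding
    have := hmp.setLIntegral_comp_emb hemb (fun z => ‖D z‖ₑ) Ω
    rw [this]
    refine lintegral_mono_set ?_
    rintro _ ⟨y, hy, rfl⟩
    exact Set.sub_mem_sub hx hy

theorem IsConvKernel.eLpNorm_one_le {D : EuclideanSpace ℝ (Fin d) → ℝ}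
    (hD : AEMeasurable D volume) : eLpNorm D 1 (volume.restrict (Ω - Ω)) ≤
      eLpNorm D 2 (volume.restrict (Ω - Ω)) * volume (Ω - Ω) ^ (1 / 2 : ℝ) := by
  have := eLpNorm_le_eLpNorm_mul_rpow_measure_univ (p := 1) (q := 2) (f := D)
    (μ := volume.restrict (Ω - Ω)) one_le_two hD.aestronglyMeasurable.restrict
  refine this.trans (le_of_eq ?_)
  rw [Measure.restrict_apply_univ]
  norm_num

/-- Expresses the radius through `f` and `g` themselves, so that the error constant can be fixed
before any kernel or representative is chosen. -/
theorem dataRadius_eq (hT : 0 ≤ T) (hG : G =ᵐ[volume.restrict Ω] g)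
    (hFi : IntervalIntegrable F volume 0 T)
    (hF : ∀ᵐ t ∂(volume.restrict (Icc 0 T)), F t =ᵐ[volume.restrict Ω] f t) :
    dataRadius T G F = (eLpNorm g P (volume.restrict Ω)).toReal + (normL1Lq Ω T P f).toReal := by
  rw [dataRadius, Lp.norm_def, eLpNorm_congr_ae hG, intervalIntegral.integral_of_le hT,
    integral_norm_eq_lintegral_enorm hFi.1.1]
  congr 2
  rw [normL1Lq, restrict_Ioc_eq_restrict_Icc]
  refine lintegral_congr_ae ?_
  filter_upwards [hF] with t ht
  rw [Lp.enorm_def, eLpNorm_congr_ae ht]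

end Problem

/-! ### Well-posedness and the error estimate -/

section WellPosed

set_option linter.unusedSectionVars false

variable {d : ℕ} {Ω : Set (EuclideanSpace ℝ (Fin d))} [IsFiniteMeasure (volume.restrict Ω)]
  {T p : ℝ} {K : EuclideanSpace ℝ (Fin d) → EuclideanSpace ℝ (Fin d) → ℝ} {M : NNReal}
  {f f' : ℝ → EuclideanSpace ℝ (Fin d) → ℝ} {g g' J J' : EuclideanSpace ℝ (Fin d) → ℝ}

theorem DataIn.mono_exponent {q r : ℝ≥0∞} (hq : 1 ≤ q) (hqr : q ≤ r) (h : DataIn Ω T r f g) :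
    DataIn Ω T q f g := by
  refine ⟨h.memLp_initial.mono_exponent hqr, h.measurable_source, ?_⟩
  set c := volume.restrict Ω univ ^ (1 / q.toReal - 1 / r.toReal)
  have hc : c ≠ ⊤ := by
    refine ENNReal.rpow_ne_top_of_nonneg ?_ (measure_ne_top _ _)
    rcases eq_or_ne r ⊤ with rfl | hr
    · simp
    · have hq0 : 0 < q.toReal :=
        ENNReal.toReal_pos (zero_lt_one.trans_le hq).ne' (ne_top_of_le_ne_top hr hqr)
      exact sub_nonneg.2 (one_div_le_one_div_of_le hq0 (ENNReal.toReal_mono hr hqr))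
  have hle : normL1Lq Ω T q f ≤ normL1Lq Ω T r f * c := by
    rw [normL1Lq, normL1Lq, ← lintegral_mul_const' c _ hc]
    refine lintegral_mono_ae ?_
    filter_upwards [AEStronglyMeasurable.prodMk_left h.measurable_source] with t ht
    exact eLpNorm_le_eLpNorm_mul_rpow_measure_univ hqr ht
  exact hle.trans_lt (ENNReal.mul_lt_top h.source_lt_top hc.lt_top)

/-- Existence of a convergent approximating family with data representing `f` and `g`. -/
theorem DataIn.exists_approxFamily (hT : 0 ≤ T) (hK : SymmKernel (volume.restrict Ω) K M)
    (hK0 : ∀ x y, 0 ≤ K x y) {θ : ℕ → ℝ → ℝ}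
    (hθ : NonlinApprox (dataExponent p).toReal (psi p) θ) (h : DataIn Ω T (dataExponent p) f g) :
    ∃ (G : Lp ℝ (dataExponent p) (volume.restrict Ω))
      (F : ℝ → Lp ℝ (dataExponent p) (volume.restrict Ω)) (u : ℕ → ℝ → _) (U : ℝ → L1 Ω),
      ApproxFamily (volume.restrict Ω) K M (psi p) θ T G F u ∧
      (∀ t ∈ Icc 0 T, Tendsto (fun k => lpIncl (volume.restrict Ω) Fact.out (u k t)) atTop
        (𝓝 (U t))) ∧
      G =ᵐ[volume.restrict Ω] g ∧
      ∀ᵐ t ∂(volume.restrict (Icc 0 T)), F t =ᵐ[volume.restrict Ω] f t := by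
  obtain ⟨F, hFi, hF⟩ := exists_lpValued (dataExponent_ne_top p) hT h.measurable_source
    h.source_lt_top
  obtain ⟨u, hu⟩ := NonlocalPLaplace.exists_approxFamily (two_le_dataExponent p)
    (dataExponent_ne_top p) hT hK hK0 hθ h.memLp_initial.toLp hFi
  obtain ⟨U, hU⟩ := hu.exists_tendsto Fact.out
  exact ⟨_, F, u, U, hu, hU, h.memLp_initial.coeFn_toLp, hF⟩

theorem IsConvKernel.symmKernel (hΩ : MeasurableSet Ω) (hv : volume (Ω - Ω) ≠ ⊤)
    (hJ : IsConvKernel Ω J) : SymmKernel (volume.restrict Ω) (convKernel J)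
      (eLpNorm J 1 (volume.restrict (Ω - Ω))).toNNReal :=
  symmKernel_of_even hΩ hJ.measurable hJ.symm <|
    ((IsConvKernel.eLpNorm_one_le hJ.measurable).trans_lt <| ENNReal.mul_lt_top hJ.memLp.2
      (ENNReal.rpow_lt_top_of_nonneg (by norm_num) hv)).ne

theorem uniquelySolvable (hΩ : MeasurableSet Ω) (hv : volume (Ω - Ω) ≠ ⊤) (hT : 0 < T)
    (hp : 1 < p) (hJ : IsConvKernel Ω J) (h : DataIn Ω T (dataExponent p) f g) :
    UniquelySolvable Ω T p (convKernel J) f g := by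
  obtain ⟨θ, hθ⟩ := exists_nonlinApprox hp
  have hK := hJ.symmKernel hΩ hv
  have hK0 : ∀ x y, 0 ≤ convKernel J x y := fun x y => hJ.nonneg _
  obtain ⟨G, F, u, U, hu, hU, hG, hF⟩ := h.exists_approxFamily hT.le hK hK0 hθ
  have hs := hu.isSolution Fact.out hU hG hF
  exact ⟨U, hs, fun v hv t ht => hs.eq hK hK0 hT hp hv ht⟩

/-- The `L²` increments are dominated by the integral of a fixed integrable function of time, whose
primitive is continuous. -/
theorem ApproxFamily.continuousL2 {P : ℝ≥0∞} [Fact (1 ≤ P)] {θ : ℕ → ℝ → ℝ} {ψ : ℝ → ℝ}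
    {G : Lp ℝ P (volume.restrict Ω)} {F : ℝ → Lp ℝ P (volume.restrict Ω)}
    {u : ℕ → ℝ → Lp ℝ P (volume.restrict Ω)} {U : ℝ → L1 Ω}
    (h : ApproxFamily (volume.restrict Ω) K M ψ θ T G F u) (h1 : 1 ≤ P)
    (hU : ∀ t ∈ Icc 0 T,
      Tendsto (fun k => lpIncl (volume.restrict Ω) h1 (u k t)) atTop (𝓝 (U t))) :
    ContinuousL2 Ω T U := by
  intro t ht
  refine ⟨MemLp.mono_exponent (q := P) ⟨Lp.aestronglyMeasurable _,
    (h.eLpNorm_limit_le h1 hU ht).trans_lt ENNReal.ofReal_lt_top⟩ h.two_le, ?_⟩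
  set φ : ℝ → ℝ := fun τ =>
    M * (2 * growthConst (volume.restrict Ω) P (dataRadius T G F)) ^ (1 / 2 : ℝ) +
      ‖lpIncl (volume.restrict Ω) h.two_le (F τ)‖
  have hφ : IsPrimitive T (fun s => ∫ τ in (0)..s, φ τ) φ :=
    ⟨intervalIntegrable_const.add (intervalIntegrable_lpIncl h.two_le h.source).norm,
      fun s _ => by simp⟩
  have hc := ((hφ.continuousOn h.nonneg_time) t ht).tendsto
  have hz : Tendsto (fun s => ENNReal.ofReal |(∫ τ in (0)..s, φ τ) - ∫ τ in (0)..t, φ τ|)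
      (𝓝[Icc 0 T] t) (𝓝 0) := by
    have := ENNReal.tendsto_ofReal (hc.sub_const (∫ τ in (0)..t, φ τ)).abs
    simpa using this
  refine tendsto_of_tendsto_of_tendsto_of_le_of_le' tendsto_const_nhds hz
    (Eventually.of_forall fun _ => zero_le) ?_
  filter_upwards [self_mem_nhdsWithin] with s hs
  rw [hφ.sub_eq ht hs]
  exact (eLpNorm_congr_ae (Lp.coeFn_sub _ _)).trans_le (h.eLpNorm_two_sub_le h1 hU ht hs)

theorem ContinuousL2.congr {u v : ℝ → L1 Ω} (h : ContinuousL2 Ω T u)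
    (huv : ∀ t ∈ Icc 0 T, v t = u t) : ContinuousL2 Ω T v := by
  intro t ht
  rw [huv t ht]
  refine ⟨(h t ht).1, (h t ht).2.congr' ?_⟩
  filter_upwards [self_mem_nhdsWithin] with s hs
  rw [huv s hs]

theorem IsSolution.continuousL2 (hΩ : MeasurableSet Ω) (hv : volume (Ω - Ω) ≠ ⊤) (hT : 0 < T)
    (hp : 1 < p) (hJ : IsConvKernel Ω J) (h : DataIn Ω T (dataExponent p) f g) {v : ℝ → L1 Ω}
    (hsol : IsSolution Ω T p (convKernel J) f g v) : ContinuousL2 Ω T v := by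
  obtain ⟨θ, hθ⟩ := exists_nonlinApprox hp
  have hK := hJ.symmKernel hΩ hv
  have hK0 : ∀ x y, 0 ≤ convKernel J x y := fun x y => hJ.nonneg _
  obtain ⟨G, F, u, U, hu, hU, hG, hF⟩ := h.exists_approxFamily hT.le hK hK0 hθ
  have hs := hu.isSolution Fact.out hU hG hF
  exact (hu.continuousL2 Fact.out hU).congr fun t ht => hs.eq hK hK0 hT hp hsol ht

/-- The constant in the error estimate. -/
def errorConst (Ω : Set (EuclideanSpace ℝ (Fin d))) [IsFiniteMeasure (volume.restrict Ω)]
    (T p : ℝ) (f : ℝ → EuclideanSpace ℝ (Fin d) → ℝ) (g : EuclideanSpace ℝ (Fin d) → ℝ) : ℝ :=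
  (volume (Ω - Ω) ^ (1 / 2 : ℝ)).toReal * (2 * growthConst (volume.restrict Ω) (dataExponent p)
    ((eLpNorm g (dataExponent p) (volume.restrict Ω)).toReal +
      (normL1Lq Ω T (dataExponent p) f).toReal)) ^ (1 / 2 : ℝ) + 1

theorem errorConst_pos : 0 < errorConst Ω T p f g := by
  have := growthConst_nonneg (μ := volume.restrict Ω) (P := dataExponent p)
    ((eLpNorm g (dataExponent p) (volume.restrict Ω)).toReal +
      (normL1Lq Ω T (dataExponent p) f).toReal)
  unfold errorConst
  positivity

theorem eLpNorm_lpIncl_sub_of_ae {P r : ℝ≥0∞} [Fact (1 ≤ P)] [Fact (1 ≤ r)] (h : r ≤ P)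
    {w w' : Lp ℝ P (volume.restrict Ω)} (hw : w =ᵐ[volume.restrict Ω] g)
    (hw' : w' =ᵐ[volume.restrict Ω] g') :
    ENNReal.ofReal ‖lpIncl (volume.restrict Ω) h w' - lpIncl (volume.restrict Ω) h w‖ =
      eLpNorm (g' - g) r (volume.restrict Ω) := by
  rw [← eLpNorm_sub_eq_ofReal]
  refine eLpNorm_congr_ae ?_
  filter_upwards [hw, hw', coeFn_lpIncl h w, coeFn_lpIncl h w'] with x a b c e
  rw [c, e, a, b, Pi.sub_apply]

theorem ofReal_integral_lpIncl_sub {P r : ℝ≥0∞} [Fact (1 ≤ P)] [Fact (1 ≤ r)] (h : r ≤ P)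
    (hT : 0 ≤ T) {F F' : ℝ → Lp ℝ P (volume.restrict Ω)} (hFi : IntervalIntegrable F volume 0 T)
    (hFi' : IntervalIntegrable F' volume 0 T)
    (hF : ∀ᵐ t ∂(volume.restrict (Icc 0 T)), F t =ᵐ[volume.restrict Ω] f t)
    (hF' : ∀ᵐ t ∂(volume.restrict (Icc 0 T)), F' t =ᵐ[volume.restrict Ω] f' t) :
    ENNReal.ofReal (∫ s in (0)..T,
      ‖lpIncl (volume.restrict Ω) h (F' s) - lpIncl (volume.restrict Ω) h (F s)‖) =
      normL1Lq Ω T r (f' - f) := by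
  have hi := (intervalIntegrable_lpIncl h hFi').sub (intervalIntegrable_lpIncl h hFi)
  rw [intervalIntegral.integral_of_le hT, ofReal_integral_norm_eq_lintegral_enorm hi.1,
    restrict_Ioc_eq_restrict_Icc, normL1Lq]
  refine lintegral_congr_ae ?_
  filter_upwards [hF, hF'] with t ht ht'
  rw [← ofReal_norm, eLpNorm_lpIncl_sub_of_ae h ht ht', Pi.sub_apply]

theorem IsConvKernel.ofReal_toNNReal_mul_le (hv : volume (Ω - Ω) ≠ ⊤) (hJ : IsConvKernel Ω J)
    (hJ' : IsConvKernel Ω J') {c : ℝ} :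
    ENNReal.ofReal ((eLpNorm (J' - J) 1 (volume.restrict (Ω - Ω))).toNNReal * c) ≤
      ENNReal.ofReal ((volume (Ω - Ω) ^ (1 / 2 : ℝ)).toReal * c) *
        eLpNorm (J' - J) 2 (volume.restrict (Ω - Ω)) := by
  have hvt : volume (Ω - Ω) ^ (1 / 2 : ℝ) ≠ ⊤ := ENNReal.rpow_ne_top_of_nonneg (by norm_num) hv
  have h := IsConvKernel.eLpNorm_one_le (Ω := Ω) (hJ'.measurable.sub hJ.measurable)
  have h1 : eLpNorm (J' - J) 1 (volume.restrict (Ω - Ω)) ≠ ⊤ :=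
    (h.trans_lt (ENNReal.mul_lt_top (hJ'.memLp.sub hJ.memLp).2 hvt.lt_top)).ne
  rw [ENNReal.ofReal_mul NNReal.zero_le_coe, ENNReal.ofReal_coe_nnreal, ENNReal.coe_toNNReal h1,
    ENNReal.ofReal_mul ENNReal.toReal_nonneg, ENNReal.ofReal_toReal hvt, mul_right_comm]
  gcongr
  rwa [mul_comm]

/-- Uniqueness identifies the given solutions with the constructed limits, so the estimate for
approximating families applies. The kernel term, an `L¹` norm, is converted to `L²` by
Cauchy-Schwarz on the finite-measure set `Ω - Ω`. -/
theorem normCL2_sub_le (hΩ : MeasurableSet Ω) (hv : volume (Ω - Ω) ≠ ⊤) (hT : 0 < T)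
    (hp : 1 < p) (hJ : IsConvKernel Ω J) (hJ' : IsConvKernel Ω J')
    (h : DataIn Ω T (dataExponent p) f g) (h' : DataIn Ω T (dataExponent p) f' g')
    {v v' : ℝ → L1 Ω} (hs : IsSolution Ω T p (convKernel J) f g v)
    (hs' : IsSolution Ω T p (convKernel J') f' g' v') :
    normCL2 Ω T (v' - v) ≤ eLpNorm (g' - g) 2 (volume.restrict Ω) + normL1Lq Ω T 2 (f' - f) +
      ENNReal.ofReal (errorConst Ω T p f g * T) *
        eLpNorm (J' - J) 2 (volume.restrict (Ω - Ω)) := by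
  -- One sequence `θ` serves both problems, because the two approximate solutions are compared at
  -- the same index.
  obtain ⟨θ, hθ⟩ := exists_nonlinApprox hp
  have hK := hJ.symmKernel hΩ hv
  have hK' := hJ'.symmKernel hΩ hv
  have hK0 : ∀ x y, 0 ≤ convKernel J x y := fun x y => hJ.nonneg _
  have hK0' : ∀ x y, 0 ≤ convKernel J' x y := fun x y => hJ'.nonneg _
  obtain ⟨G, F, u, U, hu, hU, hG, hF⟩ := h.exists_approxFamily hT.le hK hK0 hθ
  obtain ⟨G', F', u', U', hu', hU', hG', hF'⟩ := h'.exists_approxFamily hT.le hK' hK0' hθ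
  have hsU := hu.isSolution Fact.out hU hG hF
  have hsU' := hu'.isSolution Fact.out hU' hG' hF'
  have hD : SymmKernel (volume.restrict Ω) (fun x y => convKernel J' x y - convKernel J x y)
      (eLpNorm (J' - J) 1 (volume.restrict (Ω - Ω))).toNNReal := by
    refine symmKernel_of_even (D := J' - J) hΩ (hJ'.measurable.sub hJ.measurable)
      (fun x => by simp [hJ.symm, hJ'.symm]) ?_
    exact ((IsConvKernel.eLpNorm_one_le (hJ'.measurable.sub hJ.measurable)).trans_lt <|
      ENNReal.mul_lt_top (hJ'.memLp.sub hJ.memLp).2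
        (ENNReal.rpow_lt_top_of_nonneg (by norm_num) hv)).ne
  refine iSup₂_le fun t ht => ?_
  rw [Pi.sub_apply, hsU.eq hK hK0 hT hp hs ht, hsU'.eq hK' hK0' hT hp hs' ht,
    eLpNorm_congr_ae (Lp.coeFn_sub _ _)]
  refine (hu.eLpNorm_two_sub_le_of_kernels hu' hD Fact.out hU hU' ht).trans ?_
  have hg := growthConst_nonneg (μ := volume.restrict Ω) (P := dataExponent p) (dataRadius T G F)
  have hint : 0 ≤ ∫ s in (0)..T, ‖lpIncl (volume.restrict Ω) hu.two_le (F' s) -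
      lpIncl (volume.restrict Ω) hu.two_le (F s)‖ :=
    intervalIntegral.integral_nonneg hT.le fun _ _ => norm_nonneg _
  rw [ENNReal.ofReal_add (by positivity) (by positivity),
    ENNReal.ofReal_add (by positivity) hint, eLpNorm_lpIncl_sub_of_ae _ hG hG',
    ofReal_integral_lpIncl_sub _ hT.le hu.source hu'.source hF hF', mul_assoc]
  gcongr
  refine (IsConvKernel.ofReal_toNNReal_mul_le hv hJ hJ').trans ?_
  rw [← mul_assoc, dataRadius_eq hT.le hG hu.source hF]
  gcongr
  -- The summand `1` in `errorConst` is there only to make the constant positive.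
  exact le_add_of_nonneg_right zero_le_one

end WellPosed

/-! ### Uniform integrability and convergence of the data -/

section Convergence

variable {α : Type*} [MeasurableSpace α] {μ : Measure α}

theorem unifIntegrable_of_abs_rpow {q : ℝ} (hq : 0 < q) {h : ℕ → α → ℝ}
    (hui : UnifIntegrable (fun n x => |h n x| ^ q) 1 μ) :
    UnifIntegrable h (ENNReal.ofReal q) μ := by
  intro ε hε
  obtain ⟨δ, hδ, H⟩ := hui (Real.rpow_pos_of_pos hε q)
  refine ⟨δ, hδ, fun n s hs hμ => ?_⟩
  have h1 := H n s hs hμ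
  have h2 : s.indicator (fun x => |h n x| ^ q) = fun x => ‖s.indicator (h n) x‖ ^ q := by
    ext x
    by_cases hx : x ∈ s
    · simp [hx]
    · simp [hx, Real.zero_rpow hq.ne']
  rw [h2, eLpNorm_norm_rpow _ hq, one_mul, ← ENNReal.ofReal_rpow_of_pos hε] at h1
  exact (ENNReal.rpow_le_rpow_iff hq).1 h1

variable [IsFiniteMeasure μ]

/-- Vitali's theorem, without integrability of the limit. -/
theorem tendsto_eLpNorm_sub_of_unifIntegrable {q : ℝ≥0∞} (hq : 1 ≤ q) (hq' : q ≠ ⊤)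
    {h : ℕ → α → ℝ} {h' : α → ℝ} (hm : ∀ n, AEStronglyMeasurable (h n) μ)
    (hui : UnifIntegrable h q μ) (ht : ∀ᵐ x ∂μ, Tendsto (fun n => h n x) atTop (𝓝 (h' x))) :
    Tendsto (fun n => eLpNorm (h n - h') q μ) atTop (𝓝 0) := by
  have hm' : AEStronglyMeasurable h' μ := aestronglyMeasurable_of_tendsto_ae atTop hm ht
  -- The limit inherits uniform integrability from the sequence. The differences are then uniformly
  -- integrable and tend to zero a.e., so Vitali's theorem is applied with limit `0`.
  have hui' : UnifIntegrable (fun _ : ℕ => h') q μ := fun ε hε => by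
    obtain ⟨δ, hδ, H⟩ := hui.unifIntegrable_of_ae_tendsto (κ := ℕ) atTop hm hε
    exact ⟨δ, hδ, fun _ s hs hμ => H ⟨h', id, ht⟩ s hs hμ⟩
  have := tendsto_Lp_finite_of_tendsto_ae (g := fun _ => (0:ℝ)) hq hq' (f := h - fun _ => h')
    (fun n => (hm n).sub hm') MemLp.zero' (hui.sub hui' hq hm fun _ => hm') (by
      filter_upwards [ht] with x hx
      simpa using hx.sub_const (h' x))
  refine this.congr fun n => ?_
  congr 1
  ext x
  simp

theorem unifIntegrable_mono_exponent {q r : ℝ≥0∞} (hq : 1 ≤ q) (hqr : q ≤ r) (hr : r ≠ ⊤)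
    {h : ℕ → α → ℝ} (hm : ∀ n, AEStronglyMeasurable (h n) μ) (hui : UnifIntegrable h r μ) :
    UnifIntegrable h q μ := by
  intro ε hε
  set c := μ univ ^ (1 / q.toReal - 1 / r.toReal)
  have hc : c ≠ ⊤ := by
    refine ENNReal.rpow_ne_top_of_nonneg ?_ (measure_ne_top _ _)
    have hq0 : 0 < q.toReal :=
      ENNReal.toReal_pos (zero_lt_one.trans_le hq).ne' (ne_top_of_le_ne_top hr hqr)
    exact sub_nonneg.2 (one_div_le_one_div_of_le hq0 (ENNReal.toReal_mono hr hqr))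
  have hpos : 0 < c.toReal + 1 := by positivity
  obtain ⟨δ, hδ, H⟩ := hui (div_pos hε hpos)
  refine ⟨δ, hδ, fun n s hs hμ => ?_⟩
  refine (eLpNorm_le_eLpNorm_mul_rpow_measure_univ hqr ((hm n).indicator hs)).trans ?_
  calc _ ≤ ENNReal.ofReal (ε / (c.toReal + 1)) * ENNReal.ofReal (c.toReal + 1) := by
        refine mul_le_mul' (H n s hs hμ) ?_
        refine (ENNReal.ofReal_toReal hc).symm.le.trans (ENNReal.ofReal_le_ofReal ?_)
        linarith
    _ = ENNReal.ofReal ε := by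
        rw [← ENNReal.ofReal_mul (by positivity), div_mul_cancel₀ _ hpos.ne']

theorem unifIntegrable_of_ae_bound {q : ℝ≥0∞} (hq : 1 ≤ q) (hq' : q ≠ ⊤) {h : ℕ → α → ℝ} {M : ℝ}
    (hM : ∀ᵐ x ∂μ, ∀ n, |h n x| ≤ M) : UnifIntegrable h q μ := by
  intro ε hε
  obtain ⟨δ, hδ, H⟩ := unifIntegrable_const (ι := ℕ) hq hq' (memLp_const (μ := μ) M) hε
  refine ⟨δ, hδ, fun n s hs hμ => (eLpNorm_mono_ae ?_).trans (H n s hs hμ)⟩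
  filter_upwards [hM] with x hx
  by_cases hxs : x ∈ s
  · simpa [hxs] using (hx n).trans (le_abs_self M)
  · simp [hxs]

/-- Each of the three conditions implies uniform integrability in `L²`. -/
theorem unifIntegrable_two_of_cases {p : ℝ} {h : ℕ → α → ℝ}
    (hm : ∀ n, AEStronglyMeasurable (h n) μ)
    (H : UnifIntegrable (fun n x => |h n x| ^ 2) 1 μ ∨
      (2 ≤ p ∧ UnifIntegrable (fun n x => |h n x| ^ (2 * (p - 1))) 1 μ) ∨
      ∃ M : ℝ, ∀ᵐ x ∂μ, ∀ n, |h n x| ≤ M) : UnifIntegrable h 2 μ := by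
  rcases H with H | ⟨hp, H⟩ | ⟨M, hM⟩
  · simp_rw [← Real.rpow_two] at H
    simpa using unifIntegrable_of_abs_rpow two_pos H
  · refine unifIntegrable_mono_exponent one_le_two ?_ ENNReal.ofReal_ne_top hm
      (unifIntegrable_of_abs_rpow (by linarith) H)
    rw [← ENNReal.ofReal_ofNat]
    exact ENNReal.ofReal_le_ofReal (by linarith)
  · exact unifIntegrable_of_ae_bound one_le_two (by simp) hM

variable {d : ℕ} {Ω : Set (EuclideanSpace ℝ (Fin d))} {T : ℝ}

/-- Cauchy-Schwarz in time. Uniform integrability on the cylinder yields convergence in `L²` of the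
cylinder, and the estimate needs the mixed norm. -/
theorem normL1Lq_two_le {f : ℝ → EuclideanSpace ℝ (Fin d) → ℝ}
    (hf : AEStronglyMeasurable (Function.uncurry f) (cylinderMeasure Ω T)) :
    normL1Lq Ω T 2 f ≤ eLpNorm (Function.uncurry f) 2 (cylinderMeasure Ω T) *
      ENNReal.ofReal T ^ (1 / 2 : ℝ) := by
  have hm : AEMeasurable (fun z : ℝ × EuclideanSpace ℝ (Fin d) => ‖f z.1 z.2‖ₑ ^ (2:ℝ))
      ((volume.restrict (Icc 0 T)).prod (volume.restrict Ω)) := hf.enorm.pow_const 2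
  have hm' := hm.lintegral_prod_right'
  have key := ENNReal.lintegral_mul_le_Lp_mul_Lq (volume.restrict (Icc 0 T))
    (Real.HolderConjugate.two_two) (f := fun t => (∫⁻ x in Ω, ‖f t x‖ₑ ^ (2:ℝ)) ^ (1 / 2 : ℝ))
    (g := fun _ => 1) (hm'.pow_const _) aemeasurable_const
  have e1 : ∀ a : ℝ≥0∞, (a ^ (1 / 2 : ℝ)) ^ (2 : ℝ) = a := fun a => by
    rw [← ENNReal.rpow_mul]; norm_num
  simp only [Pi.mul_apply, mul_one, ENNReal.one_rpow, lintegral_one, e1] at key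
  rw [normL1Lq, eLpNorm_eq_lintegral_rpow_enorm_toReal two_ne_zero ENNReal.ofNat_ne_top]
  simp_rw [eLpNorm_eq_lintegral_rpow_enorm_toReal two_ne_zero ENNReal.ofNat_ne_top]
  rw [cylinderMeasure, lintegral_prod _ (hf.enorm.pow_const _)]
  simpa using key

end Convergence

end

end NonlocalPLaplace

/-! ### Assembly of the main theorem -/

theorem mainTheorem12 (d : ℕ) (hd : 1 ≤ d)
    (Ω : Set (EuclideanSpace ℝ (Fin d))) (hΩm : MeasurableSet Ω) (hΩb : Bornology.IsBounded Ω)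
    (T : ℝ) (hT : 0 < T) (p : ℝ) (hp : 1 < p)
    (f : ℝ → EuclideanSpace ℝ (Fin d) → ℝ) (g : EuclideanSpace ℝ (Fin d) → ℝ) :
    -- the constant depends only on `p`, `f`, `g` (functions on `Ω × [0,T]` and on `Ω`)
    ∃ C : ℝ, 0 < C ∧
      ∀ (J : EuclideanSpace ℝ (Fin d) → ℝ) (Jn : ℕ → EuclideanSpace ℝ (Fin d) → ℝ)
        (fn : ℕ → ℝ → EuclideanSpace ℝ (Fin d) → ℝ) (gn : ℕ → EuclideanSpace ℝ (Fin d) → ℝ),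
        NonlocalPLaplace.IsConvKernel Ω J →
        (∀ n, NonlocalPLaplace.IsConvKernel Ω (Jn n)) →
        ((p < 2 ∧ NonlocalPLaplace.DataIn Ω T 2 f g ∧
            ∀ n, NonlocalPLaplace.DataIn Ω T 2 (fn n) (gn n)) ∨
          (2 ≤ p ∧ NonlocalPLaplace.DataIn Ω T (ENNReal.ofReal (2 * (p - 1))) f g ∧
            ∀ n, NonlocalPLaplace.DataIn Ω T (ENNReal.ofReal (2 * (p - 1))) (fn n) (gn n)) ∨
          (NonlocalPLaplace.DataIn Ω T (⊤ : ENNReal) f g ∧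
            ∀ n, NonlocalPLaplace.DataIn Ω T (⊤ : ENNReal) (fn n) (gn n))) →
        -- (i) well-posedness
        (NonlocalPLaplace.UniquelySolvable Ω T p (NonlocalPLaplace.convKernel J) f g ∧
          ∀ n, NonlocalPLaplace.UniquelySolvable Ω T p
            (NonlocalPLaplace.convKernel (Jn n)) (fn n) (gn n)) ∧
        ∀ (u : ℝ → NonlocalPLaplace.L1 Ω) (un : ℕ → ℝ → NonlocalPLaplace.L1 Ω),
          NonlocalPLaplace.IsSolution Ω T p (NonlocalPLaplace.convKernel J) f g u →
          (∀ n, NonlocalPLaplace.IsSolution Ω T p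
            (NonlocalPLaplace.convKernel (Jn n)) (fn n) (gn n) (un n)) →
          -- (ii) error estimate, in the norm of `C([0,T]; L²(Ω))`
          (NonlocalPLaplace.ContinuousL2 Ω T u ∧
            (∀ n, NonlocalPLaplace.ContinuousL2 Ω T (un n)) ∧
            ∀ n, NonlocalPLaplace.normCL2 Ω T (un n - u) ≤
              eLpNorm (gn n - g) 2 (volume.restrict Ω) +
              NonlocalPLaplace.normL1Lq Ω T 2 (fn n - f) +
              ENNReal.ofReal (C * T) * eLpNorm (Jn n - J) 2 (volume.restrict (Ω - Ω))) ∧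
          -- (iii) convergence
          (UnifIntegrable (fun n x => |Jn n x| ^ 2) 1 (volume.restrict (Ω - Ω)) →
            (∀ᵐ x ∂(volume.restrict (Ω - Ω)), Tendsto (fun n => Jn n x) atTop (𝓝 (J x))) →
            (∀ᵐ x ∂(volume.restrict Ω), Tendsto (fun n => gn n x) atTop (𝓝 (g x))) →
            (∀ᵐ z ∂(NonlocalPLaplace.cylinderMeasure Ω T),
              Tendsto (fun n => fn n z.1 z.2) atTop (𝓝 (f z.1 z.2))) →
            ((p < 2 ∧
                UnifIntegrable (fun n x => |gn n x| ^ 2) 1 (volume.restrict Ω) ∧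
                UnifIntegrable (fun n (z : ℝ × EuclideanSpace ℝ (Fin d)) => |fn n z.1 z.2| ^ 2) 1
                  (NonlocalPLaplace.cylinderMeasure Ω T)) ∨
              (2 ≤ p ∧
                UnifIntegrable (fun n x => |gn n x| ^ (2 * (p - 1))) 1 (volume.restrict Ω) ∧
                UnifIntegrable
                  (fun n (z : ℝ × EuclideanSpace ℝ (Fin d)) => |fn n z.1 z.2| ^ (2 * (p - 1))) 1
                  (NonlocalPLaplace.cylinderMeasure Ω T)) ∨
              (∃ M : ℝ,
                (∀ᵐ x ∂(volume.restrict Ω), ∀ n, |gn n x| ≤ M) ∧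
                (∀ᵐ z ∂(NonlocalPLaplace.cylinderMeasure Ω T), ∀ n, |fn n z.1 z.2| ≤ M))) →
            Tendsto (fun n => NonlocalPLaplace.normCL2 Ω T (un n - u)) atTop (𝓝 0)) := by
  have hΩΩ : Bornology.IsBounded (Ω - Ω) := hΩb.sub hΩb
  have hv : volume (Ω - Ω) ≠ ⊤ := hΩΩ.measure_lt_top.ne
  have : IsFiniteMeasure (volume.restrict Ω) := isFiniteMeasure_restrict.2 hΩb.measure_lt_top.ne
  have : IsFiniteMeasure (volume.restrict (Ω - Ω)) := isFiniteMeasure_restrict.2 hv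
  have : IsFiniteMeasure (NonlocalPLaplace.cylinderMeasure Ω T) := by
    unfold NonlocalPLaplace.cylinderMeasure
    infer_instance
  refine ⟨NonlocalPLaplace.errorConst Ω T p f g, NonlocalPLaplace.errorConst_pos, ?_⟩
  intro J Jn fn gn hJ hJn hdata
  -- All three cases reduce to the single exponent `max 2 (2(p-1))`; bounded data belong to that
  -- class because `Ω` has finite measure.
  obtain ⟨h, hn⟩ : NonlocalPLaplace.DataIn Ω T (NonlocalPLaplace.dataExponent p) f g ∧
      ∀ n, NonlocalPLaplace.DataIn Ω T (NonlocalPLaplace.dataExponent p) (fn n) (gn n) := by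
    rcases hdata with ⟨hp2, h⟩ | ⟨hp2, h⟩ | ⟨h, hn⟩
    · rwa [NonlocalPLaplace.dataExponent, max_eq_left (by linarith), ENNReal.ofReal_ofNat]
    · rwa [NonlocalPLaplace.dataExponent, max_eq_right (by linarith)]
    · exact ⟨h.mono_exponent Fact.out le_top, fun n => (hn n).mono_exponent Fact.out le_top⟩
  refine ⟨⟨NonlocalPLaplace.uniquelySolvable hΩm hv hT hp hJ h,
    fun n => NonlocalPLaplace.uniquelySolvable hΩm hv hT hp (hJn n) (hn n)⟩, ?_⟩
  intro u un hu hun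
  have est := fun n => NonlocalPLaplace.normCL2_sub_le hΩm hv hT hp hJ (hJn n) h (hn n) hu (hun n)
  refine ⟨⟨hu.continuousL2 hΩm hv hT hp hJ h,
    fun n => (hun n).continuousL2 hΩm hv hT hp (hJn n) (hn n), est⟩, ?_⟩
  intro hJui hJt hgt hft hcases
  have hgm := fun n => (hn n).memLp_initial.aestronglyMeasurable
  have hfm := fun n => (hn n).measurable_source
  have hJlim := NonlocalPLaplace.tendsto_eLpNorm_sub_of_unifIntegrable one_le_two (by simp)
    (fun n => (hJn n).memLp.aestronglyMeasurable)
    (NonlocalPLaplace.unifIntegrable_two_of_cases (p := p)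
      (fun n => (hJn n).memLp.aestronglyMeasurable) (Or.inl hJui)) hJt
  have hglim := NonlocalPLaplace.tendsto_eLpNorm_sub_of_unifIntegrable one_le_two (by simp) hgm
    (NonlocalPLaplace.unifIntegrable_two_of_cases hgm (hcases.imp (fun H => H.2.1)
      (Or.imp (fun H => ⟨H.1, H.2.1⟩) fun ⟨M, H⟩ => ⟨M, H.1⟩))) hgt
  have hflim := NonlocalPLaplace.tendsto_eLpNorm_sub_of_unifIntegrable one_le_two (by simp) hfm
    (NonlocalPLaplace.unifIntegrable_two_of_cases hfm (hcases.imp (fun H => H.2.2)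
      (Or.imp (fun H => ⟨H.1, H.2.2⟩) fun ⟨M, H⟩ => ⟨M, H.2⟩)))
      (h' := Function.uncurry f) hft
  have hflim' : Tendsto (fun n => NonlocalPLaplace.normL1Lq Ω T 2 (fn n - f)) atTop (𝓝 0) := by
    have hz := ENNReal.Tendsto.mul_const (b := ENNReal.ofReal T ^ (1 / 2 : ℝ)) hflim
      (Or.inr (by finiteness))
    rw [zero_mul] at hz
    exact tendsto_of_tendsto_of_tendsto_of_le_of_le tendsto_const_nhds hz (fun _ => zero_le)
      fun n => NonlocalPLaplace.normL1Lq_two_le ((hfm n).sub h.measurable_source)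
  have hz := (hglim.add hflim').add (ENNReal.Tendsto.const_mul
    (a := ENNReal.ofReal (NonlocalPLaplace.errorConst Ω T p f g * T)) hJlim
    (Or.inr ENNReal.ofReal_ne_top))
  simp only [mul_zero, add_zero] at hz
  exact tendsto_of_tendsto_of_tendsto_of_le_of_le tendsto_const_nhds hz (fun _ => zero_le) est
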